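/- Theorem 1.2. Let $n\ge 2$, let $f(x,y)=\sum_{i+j\le n}a_{i,j}x^iy^j$ and $g(x,y)=\sum_{i+j\le n}b_{i,j}x^iy^j$ be real polynomials, and consider, for small $\varepsilon\neq 0$, the smooth planar system $$\dot x=xy+\varepsilon f(x,y),\qquad \dot y=\tfrac32y^2-2x^2+2x+\varepsilon g(x,y).\qquad (1)$$ For $\varepsilon=0$ it has the first integral $H(x,y)=x^{-3}\big(\tfrac12y^2-2x^2+x\big)$, a center at $(1,0)$, and the period annulus $\mathcal A=\{(x,y):x>0,\ -1<H(x,y)<0\}$, which is filled with the ovals $\Gamma_h=\{(x,y):x>0,\ H(x,y)=h\}$, $-1<h<0$. Suppose that the first order Melnikov function $$M(h)=\oint_{\Gamma_h}x^{-4}\big(g(x,y)\,dx-f(x,y)\,dy\big),\qquad h\in(-1,0),$$ does not vanish identically. Then for every compact set $K\subset\mathcal A$ there is $\varepsilon_0>0$ such that for all $\varepsilon$ with $0<|\varepsilon|<\varepsilon_0$ the number of limit cycles (isolated periodic orbits) of (1) that lie in $K$, each counted with its multiplicity (the order of the zero of the displacement function, i.e. Poincaré return map minus identity, at the limit cycle),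 is (i) at most $4$ if $n=2$ or $n=3$; (ii) at most $3n-8$ if $n\ge 4$. -/

import Mathlib

open scoped Topology

/-! ### Planar autonomous systems, limit cycles and their multiplicities -/

namespace PlanarSystem

/-- `φ` is a solution, defined for all times, of the autonomous system `q' = X q`. -/
def IsSolution (X : ℝ × ℝ → ℝ × ℝ) (φ : ℝ → ℝ × ℝ) : Prop :=
  ∀ t, HasDerivAt φ (X (φ t)) t

/-- `γ` is the orbit of a non-constant periodic solution. -/
def IsPeriodicOrbit (X : ℝ × ℝ → ℝ × ℝ) (γ : Set (ℝ × ℝ)) : Prop :=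
  ∃ (φ : ℝ → ℝ × ℝ) (T : ℝ), 0 < T ∧ IsSolution X φ ∧ Function.Periodic φ T ∧
    (∃ t, φ t ≠ φ 0) ∧ γ = Set.range φ

/-- A limit cycle is an isolated periodic orbit: some neighbourhood of it contains no other
periodic orbit. -/
def IsLimitCycle (X : ℝ × ℝ → ℝ × ℝ) (γ : Set (ℝ × ℝ)) : Prop :=
  IsPeriodicOrbit X γ ∧
    ∃ U : Set (ℝ × ℝ), IsOpen U ∧ γ ⊆ U ∧ ∀ γ', IsPeriodicOrbit X γ' → γ' ⊆ U → γ' = γ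

/-- `T` is the minimal period of the periodic solution that starts at `p`. -/
def IsMinimalPeriod (X : ℝ × ℝ → ℝ × ℝ) (p : ℝ × ℝ) (T : ℝ) : Prop :=
  0 < T ∧ ∃ φ : ℝ → ℝ × ℝ, IsSolution X φ ∧ φ 0 = p ∧ φ T = p ∧ ∀ t ∈ Set.Ioo 0 T, φ t ≠ p

/-- The vector `v` is transversal to the field at `p`. -/
def IsTransversal (X : ℝ × ℝ → ℝ × ℝ) (p v : ℝ × ℝ) : Prop :=
  (X p).1 * v.2 - (X p).2 * v.1 ≠ 0

/-- `P` is (near `0`) the Poincaré return map along the periodic orbit through `p`, on the section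
`s ↦ p + s • v`: the solution starting at `p + s • v` is at `p + P s • v` at the return time `τ s`,
where `τ` is continuous at `0` and `τ 0` is the minimal period of the orbit through `p`. For a
continuously differentiable field and a transversal `v` these conditions determine the germ of `P`
at `0`. -/
def IsReturnMap (X : ℝ × ℝ → ℝ × ℝ) (p v : ℝ × ℝ) (P : ℝ → ℝ) : Prop :=
  ∃ τ : ℝ → ℝ, IsMinimalPeriod X p (τ 0) ∧ ContinuousAt τ 0 ∧
    ∀ᶠ s in 𝓝 (0 : ℝ), ∃ φ : ℝ → ℝ × ℝ,
      (∀ t ∈ Set.Icc 0 (τ s), HasDerivWithinAt φ (X (φ t)) (Set.Icc 0 (τ s)) t) ∧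
      φ 0 = p + s • v ∧ φ (τ s) = p + P s • v

/-- The displacement function `s ↦ P s - s` of the periodic orbit `γ` has a zero of order at
least `m`. For a continuously differentiable field the return map exists and this does not depend
on the transversal section, so that 'every section' can be read as 'some section'. -/
def DisplacementVanishes (X : ℝ × ℝ → ℝ × ℝ) (γ : Set (ℝ × ℝ)) (m : ℕ) : Prop :=
  ∀ p ∈ γ, ∀ v : ℝ × ℝ, IsTransversal X p v →
    ∃ P : ℝ → ℝ, IsReturnMap X p v P ∧
      (fun s => P s - s) =O[𝓝 (0 : ℝ)] (fun s => s ^ m)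

/-- The multiplicity of a periodic orbit: the order of the zero of its displacement function.
It is at least `1` for a smooth field. -/
noncomputable def multiplicity (X : ℝ × ℝ → ℝ × ℝ) (γ : Set (ℝ × ℝ)) : ℕ∞ :=
  ⨆ (m : ℕ) (_ : DisplacementVanishes X γ m), (m : ℕ∞)

/-- The number of limit cycles lying in `K`, each counted with its multiplicity. -/
noncomputable def limitCycleCount (X : ℝ × ℝ → ℝ × ℝ) (K : Set (ℝ × ℝ)) : ℕ∞ :=
  ⨆ (S : Finset (Set (ℝ × ℝ))) (_ : ∀ γ ∈ S, IsLimitCycle X γ ∧ γ ⊆ K),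
    ∑ γ ∈ S, multiplicity X γ

end PlanarSystem

/-! ### The nongeneric quadratic reversible system and its perturbations -/

namespace ReversibleSystem

/-- The polynomial `∑ c i j * x ^ i * y ^ j` over `i + j ≤ n`. -/
def poly (n : ℕ) (c : ℕ → ℕ → ℝ) (q : ℝ × ℝ) : ℝ :=
  ∑ i ∈ Finset.range (n + 1), ∑ j ∈ Finset.range (n + 1 - i), c i j * q.1 ^ i * q.2 ^ j

/-- The perturbed system `x' = x y + ε f`, `y' = (3/2) y² - 2 x² + 2 x + ε g`, where `f` and `g`
are the polynomials with coefficients `a` and `b`. -/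
noncomputable def field (n : ℕ) (a b : ℕ → ℕ → ℝ) (ε : ℝ) (q : ℝ × ℝ) : ℝ × ℝ :=
  (q.1 * q.2 + ε * poly n a q,
    3 / 2 * q.2 ^ 2 - 2 * q.1 ^ 2 + 2 * q.1 + ε * poly n b q)

/-- The first integral of the unperturbed system. -/
noncomputable def H (q : ℝ × ℝ) : ℝ :=
  (q.2 ^ 2 / 2 - 2 * q.1 ^ 2 + q.1) / q.1 ^ 3

/-- The period annulus around the center `(1, 0)`, the union of the ovals `H = h`, `-1 < h < 0`.
(The level sets of `H` have further, unbounded branches in `x < 0`.) -/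
def annulus : Set (ℝ × ℝ) :=
  {q | 0 < q.1 ∧ -1 < H q ∧ H q < 0}

/-- First coordinate of the parametrization of the oval `H = h` by the angle `θ`. -/
noncomputable def ovalX (h θ : ℝ) : ℝ :=
  1 / (1 + √(1 + h) * Real.cos θ)

/-- Second coordinate of the parametrization of the oval `H = h` by the angle `θ`. -/
noncomputable def ovalY (h θ : ℝ) : ℝ :=
  √2 * √(1 + h) * Real.sin θ / √(1 + √(1 + h) * Real.cos θ) ^ 3

/-- The parametrization runs through the whole oval. -/
theorem range_oval {h : ℝ} (h1 : -1 < h) (h0 : h < 0) :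
    Set.range (fun θ => (ovalX h θ, ovalY h θ)) = {q : ℝ × ℝ | 0 < q.1 ∧ H q = h} := by
  have hr0 : 0 < 1 + h := by linarith
  set r := √(1 + h) with hr
  have hrpos : 0 < r := Real.sqrt_pos.mpr hr0
  have hr2 : r ^ 2 = 1 + h := Real.sq_sqrt hr0.le
  have hr1 : r < 1 := by nlinarith
  have hs2 : √2 ^ 2 = 2 := Real.sq_sqrt (by norm_num)
  have hs2p : 0 < √2 := Real.sqrt_pos.mpr (by norm_num)
  ext ⟨x, y⟩
  simp only [Set.mem_range, Set.mem_ofPred_eq, Prod.mk.injEq, ovalX, ovalY, H, ← hr]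
  constructor
  · rintro ⟨θ, rfl, rfl⟩
    have hu : 0 < 1 + r * Real.cos θ := by nlinarith [Real.neg_one_le_cos θ]
    have hsu := Real.sqrt_pos.mpr hu
    have hsq : √(1 + r * Real.cos θ) ^ 2 = 1 + r * Real.cos θ := Real.sq_sqrt hu.le
    refine ⟨by positivity, ?_⟩
    generalize √(1 + r * Real.cos θ) = w at *
    rw [← hsq]
    field_simp
    have hc := Real.sin_sq_add_cos_sq θ
    have hsn : Real.sin θ ^ 2 = 1 - Real.cos θ ^ 2 := by linarith
    rw [hs2, hsn]
    have e : r * Real.cos θ = w ^ 2 - 1 := by linarith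
    have e2 : r ^ 2 * Real.cos θ ^ 2 = (w ^ 2 - 1) ^ 2 := by rw [← e]; ring
    linear_combination 2 * hr2 - 2 * e2
  · rintro ⟨hx, hH⟩
    rw [div_eq_iff (by positivity)] at hH
    have hsx := Real.sqrt_pos.mpr hx
    have hsq : √x ^ 2 = x := Real.sq_sqrt hx.le
    set w := √x with hw
    -- the unit vector with the wanted cosine and sine
    set c := (1 / x - 1) / r with hc
    set s := y / (√2 * r * w ^ 3) with hs
    have hcs : c ^ 2 + s ^ 2 = 1 := by
      rw [hc, hs, div_pow, div_pow, mul_pow, mul_pow, hs2, hr2, ← pow_mul,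
        show 3 * 2 = 2 * 3 by norm_num, pow_mul, hsq]
      field_simp
      linear_combination 2 * hH
    obtain ⟨θ, hθ⟩ : ∃ θ : ℝ, Real.cos θ = c ∧ Real.sin θ = s := by
      have hn : ‖(⟨c, s⟩ : ℂ)‖ = 1 := by
        rw [Complex.norm_def, Complex.normSq_mk, Real.sqrt_eq_one]
        linarith [hcs, sq c, sq s]
      have hne : (⟨c, s⟩ : ℂ) ≠ 0 := by
        intro h
        rw [h] at hn
        simp at hn
      refine ⟨Complex.arg ⟨c, s⟩, ?_, ?_⟩
      · rw [Complex.cos_arg hne, hn]; simp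
      · rw [Complex.sin_arg, hn]; simp
    have hu : 1 + r * c = 1 / x := by
      rw [hc]; field_simp; ring
    refine ⟨θ, ?_, ?_⟩
    · rw [hθ.1, hu, one_div_one_div]
    · rw [hθ.1, hθ.2, hu, Real.sqrt_div (by norm_num), Real.sqrt_one, hs, ← hw]
      field_simp

/-- The first order Melnikov function `M(h) = ∮ x⁻⁴ (g dx - f dy)` along the oval `H = h`, in the
direction of the unperturbed flow: the upper half `0 < θ < π` runs from left to right. -/
noncomputable def melnikov (n : ℕ) (a b : ℕ → ℕ → ℝ) (h : ℝ) : ℝ :=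
  ∫ θ in (0 : ℝ)..(2 * Real.pi),
    (ovalX h θ ^ 4)⁻¹ *
      (poly n b (ovalX h θ, ovalY h θ) * deriv (ovalX h) θ -
        poly n a (ovalX h θ, ovalY h θ) * deriv (ovalY h) θ)

end ReversibleSystem

/-!
In the coordinates `p = 1 / x - 1 = r cos θ`, `q = y x ^ (-3/2) / √2 = r sin θ` the first integral
is `H = r ^ 2 - 1`, and the unperturbed flow is `r' = 0`, `θ' = √2 / √(1 + r cos θ)`. The perturbed
system becomes `dr/dθ = ε N / (√2 + ε D)` with `N` and `D` analytic in `r ∈ (0, 1)`, and its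
displacement over one turn is `ε (∫ N / √2 + o(1))`, where the integral is the Melnikov function up
to the factor `1 / (2 r)`.

*Zeros of the Melnikov function.* Integration by parts reduces all the integrals to
`∫ (1 + r cos θ) ^ (3/2 - m) (r sin θ) ^ 2 dθ` with `m ≤ n`. Their binomial expansions are
`r ^ 2 ∑ ω k P k r ^ (2 k)` with the same positive weights `ω k` and a polynomial `P` of degree
`m`, the quotient of two binomial coefficients. So the Melnikov function is of this form with
`P` of degree at most `n` (`isMelnikovSeries_melnikov`). Multiplying `P` by a linear factor `X - κ`
amounts to applying `x ^ (2 κ + 1) d/dx x ^ (-2 κ)`, which loses at most one zero by Rolle's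
theorem; multiplying by all the real linear factors of `P` makes the coefficients of one sign, and
no zero is left. Hence there are at most `n` zeros, with multiplicity (`not_hasZeros_evenSeries`), and
`n` is at most `4` for `n = 2, 3` and at most `3 n - 8` for `n ≥ 4`.

*Zeros of the displacement.* The polar system is solved by Picard iteration for complex initial
radii, so the displacement is holomorphic near a compact interval of radii, and after division
by `ε` it converges to the Melnikov integral (`exists_isSolutionFamily`). By a form of
Hurwitz's theorem (`eventually_not_hasZeros`) it too has at most `n` zeros for small `ε`.

*Limit cycles.* A periodic orbit in the compact set `K` rotates in the positive direction about the
center, because it does so for `ε = 0`; so it crosses the section `y = 0`, `x < 1`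
(`exists_mem_section`). The return map of the polar system is monotone, so that one of the
crossings is a fixed point (`exists_fixed_radius`), and there the multiplicity of the orbit
is at most the order of the zero of the displacement (`isBigO_of_displacementVanishes`). Distinct
orbits have distinct fixed points (`periodicOrbit_eq_of_mem`).
-/


/-! ### Zeros counted with multiplicity, and Rolle's theorem -/

section ZeroCounting

open Set Filter

/-- The function `f` has at least `N` zeros in `I`, counted with multiplicity: there are finitely
many points of `I` and lower bounds `m` for the orders of vanishing of `f` there, of sum at least
`N`. A function that is not analytic at a point has order `0` there. -/
def HasZeros {𝕜 : Type*} [NontriviallyNormedField 𝕜] (f : 𝕜 → 𝕜) (I : Set 𝕜) (N : ℕ) : Prop :=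
  ∃ (S : Finset 𝕜) (m : 𝕜 → ℕ), (S : Set 𝕜) ⊆ I ∧
    (∀ x ∈ S, (m x : ℕ∞) ≤ analyticOrderAt f x) ∧ N ≤ ∑ x ∈ S, m x

theorem HasZeros.congr_order {𝕜 : Type*} [NontriviallyNormedField 𝕜] {f g : 𝕜 → 𝕜} {I : Set 𝕜}
    {N : ℕ} (h : HasZeros f I N) (hfg : ∀ x ∈ I, analyticOrderAt f x ≤ analyticOrderAt g x) :
    HasZeros g I N := by
  obtain ⟨S, m, hS, hm, hN⟩ := h
  exact ⟨S, m, hS, fun x hx => (hm x hx).trans (hfg x (hS hx)), hN⟩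

theorem HasZeros.exists_eq_zero {𝕜 : Type*} [NontriviallyNormedField 𝕜] {f : 𝕜 → 𝕜} {I : Set 𝕜}
    (h : HasZeros f I 1) : ∃ x ∈ I, f x = 0 := by
  obtain ⟨S, m, hS, hm, hN⟩ := h
  obtain ⟨x, hx, hx0⟩ : ∃ x ∈ S, m x ≠ 0 := by
    by_contra! hc
    rw [Finset.sum_eq_zero hc] at hN
    omega
  refine ⟨x, hS hx, apply_eq_zero_of_analyticOrderAt_ne_zero fun h0 => hx0 ?_⟩
  simpa [h0] using hm x hx

theorem le_analyticOrderAt_deriv {f : ℝ → ℝ} {x : ℝ} (hf : AnalyticAt ℝ f x) {k : ℕ}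
    (h : ((k + 1 : ℕ) : ℕ∞) ≤ analyticOrderAt f x) :
    (k : ℕ∞) ≤ analyticOrderAt (deriv f) x := by
  have h0 : f x = 0 := apply_eq_zero_of_analyticOrderAt_ne_zero fun h0 => by simp [h0] at h
  have h1 := hf.analyticOrderAt_deriv_add_one
  simp only [h0, sub_zero] at h1
  rw [← h1] at h
  push_cast at h
  exact (ENat.add_le_add_iff_right (by simp)).1 h

/-- **Rolle's theorem with multiplicities**: passing to the derivative loses at most one zero. -/
theorem hasZeros_deriv {f : ℝ → ℝ} {a b : ℝ} (hf : AnalyticOnNhd ℝ f (Ioo a b)) {N : ℕ}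
    (h : HasZeros f (Ioo a b) (N + 1)) : HasZeros (deriv f) (Ioo a b) N := by
  classical
  obtain ⟨S, m, hS, hm, hN⟩ := h
  have key : ∀ S : Finset ℝ, (S : Set ℝ) ⊆ Ioo a b →
      (∀ x ∈ S, m x ≠ 0 ∧ (m x : ℕ∞) ≤ analyticOrderAt f x) →
      ∃ (S' : Finset ℝ) (m' : ℝ → ℕ), (S' : Set ℝ) ⊆ Ioo a b ∧
        (∀ y ∈ S', ∃ x ∈ S, y ≤ x) ∧
        (∀ y ∈ S', (m' y : ℕ∞) ≤ analyticOrderAt (deriv f) y) ∧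
        ∑ x ∈ S, m x ≤ (∑ y ∈ S', m' y) + 1 := by
    intro S
    induction S using Finset.induction_on_max with
    | empty => exact fun _ _ => ⟨∅, 0, by simp, by simp, by simp, by simp⟩
    | insert p s hs ih =>
      intro hsub hord
      have hps : p ∉ s := fun h => (hs p h).false
      have hpI : p ∈ Ioo a b := hsub (by simp)
      have hzero : ∀ x ∈ insert p s, f x = 0 := fun x hx =>
        apply_eq_zero_of_analyticOrderAt_ne_zero fun h0 => (hord x hx).1 (by
          simpa [h0] using (hord x hx).2)
      have hp' : ((m p - 1 : ℕ) : ℕ∞) ≤ analyticOrderAt (deriv f) p := by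
        apply le_analyticOrderAt_deriv (hf p hpI)
        rw [Nat.sub_add_cancel (Nat.one_le_iff_ne_zero.2 (hord p (by simp)).1)]
        exact (hord p (by simp)).2
      have hp1 : m p = m p - 1 + 1 :=
        (Nat.sub_add_cancel (Nat.one_le_iff_ne_zero.2 (hord p (by simp)).1)).symm
      rcases s.eq_empty_or_nonempty with rfl | hne
      · refine ⟨{p}, fun _ => m p - 1, by simpa using hpI, by simp, by simpa using hp', ?_⟩
        simp only [insert_empty_eq, Finset.sum_singleton]
        omega
      · obtain ⟨S', m', hS', hle, hm', hsum⟩ := ih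
          (fun x hx => hsub (Finset.mem_coe.2 (Finset.mem_insert_of_mem hx)))
          (fun x hx => hord x (by simp [hx]))
        set q := s.max' hne with hq
        have hqs : q ∈ s := s.max'_mem hne
        have hqI : q ∈ Ioo a b := hsub (by simp [hqs])
        have hsubI : Icc q p ⊆ Ioo a b := fun x hx => ⟨hqI.1.trans_le hx.1, hx.2.trans_lt hpI.2⟩
        obtain ⟨c, hc, hc0⟩ := exists_deriv_eq_zero (f := f) (hs q hqs)
          (fun x hx => (hf x (hsubI hx)).continuousAt.continuousWithinAt)
          ((hzero q (by simp [hqs])).trans (hzero p (by simp)).symm)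
        have hcI : c ∈ Ioo a b := hsubI (Ioo_subset_Icc_self hc)
        have hS'q : ∀ y ∈ S', y ≤ q := fun y hy => by
          obtain ⟨x, hx, hyx⟩ := hle y hy
          exact hyx.trans (s.le_max' x hx)
        have hcS : c ∉ S' := fun h => (hS'q c h).not_gt hc.1
        have hpS : p ∉ insert c S' := by
          simp only [Finset.mem_insert, not_or]
          exact ⟨hc.2.ne', fun h => (hS'q p h).not_gt (hs q hqs)⟩
        refine ⟨insert p (insert c S'),
          fun y => if y = p then m p - 1 else if y = c then 1 else m' y, ?_, ?_, ?_, ?_⟩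
        · intro y hy
          simp only [Finset.coe_insert, mem_insert_iff] at hy
          rcases hy with rfl | rfl | hy
          · exact hpI
          · exact hcI
          · exact hS' hy
        · intro y hy
          refine ⟨p, by simp, ?_⟩
          simp only [Finset.mem_insert] at hy
          rcases hy with rfl | rfl | hy
          · exact le_rfl
          · exact hc.2.le
          · exact (hS'q y hy).trans (hs q hqs).le
        · intro y hy
          simp only [Finset.mem_insert] at hy
          beta_reduce
          rcases hy with rfl | rfl | hy
          · simpa using hp'
          · rw [if_neg hc.2.ne, if_pos rfl, Nat.cast_one, Order.one_le_iff_ne_zero]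
            exact analyticOrderAt_ne_zero.2 ⟨(hf _ hcI).deriv, hc0⟩
          · rw [if_neg, if_neg]
            · exact hm' y hy
            · rintro rfl; exact hcS hy
            · rintro rfl; exact hpS (by simp [hy])
        · rw [Finset.sum_insert hps, Finset.sum_insert hpS, Finset.sum_insert hcS]
          have hrest : ∑ y ∈ S', (if y = p then m p - 1 else if y = c then 1 else m' y) =
              ∑ y ∈ S', m' y := by
            refine Finset.sum_congr rfl fun y hy => ?_
            rw [if_neg, if_neg]
            · rintro rfl; exact hcS hy
            · rintro rfl; exact hpS (by simp [hy])
          rw [hrest, if_pos rfl, if_neg hc.2.ne, if_pos rfl]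
          omega
  obtain ⟨S', m', hS', -, hm', hsum⟩ := key (S.filter fun x => m x ≠ 0)
    (fun x hx => hS (Finset.mem_filter.1 hx).1)
    (fun x hx => ⟨(Finset.mem_filter.1 hx).2, hm x (Finset.mem_filter.1 hx).1⟩)
  refine ⟨S', m', hS', hm', ?_⟩
  rw [Finset.sum_filter_ne_zero] at hsum
  omega

end ZeroCounting

/-! ### Even power series with coefficients a positive sequence times a polynomial -/

section EvenSeries

open Set Filter Polynomial

/-- The even power series `∑ ω k * P k * x ^ (2 k)` attached to a weight `ω` and a polynomial
`P`. -/
noncomputable def evenSeries (ω : ℕ → ℝ) (P : ℝ[X]) (x : ℝ) : ℝ :=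
  ∑' k : ℕ, ω k * P.eval (k : ℝ) * x ^ (2 * k)

variable {ω : ℕ → ℝ} {B : ℝ}

theorem summable_norm_evenSeries (hB : ∀ k, |ω k| ≤ B) (P : ℝ[X]) {x : ℝ} (hx : |x| < 1) :
    Summable fun k : ℕ => ‖ω k * P.eval (k : ℝ) * x ^ (2 * k)‖ := by
  have hx2 : ‖x ^ 2‖ < 1 := by
    rw [norm_pow, Real.norm_eq_abs]
    exact pow_lt_one₀ (abs_nonneg x) hx two_ne_zero
  have h1 : ∀ i : ℕ, Summable fun k : ℕ => B * |P.coeff i| * ((k : ℝ) ^ i * (x ^ 2) ^ k) :=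
    fun i => (summable_pow_mul_geometric_of_norm_lt_one i hx2).mul_left _
  refine Summable.of_nonneg_of_le (fun _ => norm_nonneg _) (fun k => ?_)
    (summable_sum fun i (_ : i ∈ Finset.range (P.natDegree + 1)) => h1 i)
  rw [eval_eq_sum_range, Finset.mul_sum, Finset.sum_mul]
  refine (norm_sum_le _ _).trans (Finset.sum_le_sum fun i _ => ?_)
  rw [norm_mul, norm_mul, norm_mul, Real.norm_eq_abs, Real.norm_eq_abs, norm_pow, norm_pow,
    pow_mul, Real.norm_eq_abs, Real.norm_eq_abs, sq_abs, Nat.abs_cast]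
  have := mul_le_mul_of_nonneg_right (hB k)
    (show 0 ≤ |P.coeff i| * ((k : ℝ) ^ i * (x ^ 2) ^ k) by positivity)
  linarith

theorem evenSeries_X_sub_C_mul (hB : ∀ k, |ω k| ≤ B) (P : ℝ[X]) (κ : ℝ) {x : ℝ} (hx : |x| < 1) :
    evenSeries ω ((X - C κ) * P) x = evenSeries ω (X * P) x - κ * evenSeries ω P x := by
  unfold evenSeries
  rw [← tsum_mul_left, ← Summable.tsum_sub (summable_norm_evenSeries hB _ hx).of_norm
    ((summable_norm_evenSeries hB _ hx).of_norm.mul_left _)]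
  refine tsum_congr fun k => ?_
  simp only [eval_mul, eval_sub, eval_X, eval_C]
  ring

/-- The series converges to a holomorphic function on the complex unit disc; this gives analyticity
on the real interval, and the action of `x d/dx`. -/
theorem analyticAt_evenSeries_and_deriv (hB : ∀ k, |ω k| ≤ B) (P : ℝ[X]) {x : ℝ} (hx : |x| < 1) :
    AnalyticAt ℝ (evenSeries ω P) x ∧
      x * deriv (evenSeries ω P) x = 2 * evenSeries ω (X * P) x := by
  obtain ⟨ρ, hxρ, hρ⟩ := exists_between hx
  have hρ0 : 0 ≤ ρ := (abs_nonneg x).trans hxρ.le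
  set F : ℕ → ℂ → ℂ := fun k z => ((ω k * P.eval (k : ℝ) : ℝ) : ℂ) * z ^ (2 * k) with hF
  have hu : Summable fun k : ℕ => ‖ω k * P.eval (k : ℝ) * ρ ^ (2 * k)‖ :=
    summable_norm_evenSeries hB P (by rwa [abs_of_nonneg hρ0])
  have hd : ∀ k, DifferentiableOn ℂ (F k) (Metric.ball 0 ρ) := fun k => by
    simp only [hF]; fun_prop
  have hle : ∀ k, ∀ z ∈ Metric.ball (0 : ℂ) ρ, ‖F k z‖ ≤ ‖ω k * P.eval (k : ℝ) * ρ ^ (2 * k)‖ := by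
    intro k z hz
    rw [mem_ball_zero_iff] at hz
    simp only [hF]
    rw [norm_mul, norm_mul (ω k * _), Complex.norm_real, norm_pow, norm_pow,
      Real.norm_of_nonneg hρ0]
    gcongr
  have hxb : (x : ℂ) ∈ Metric.ball (0 : ℂ) ρ := by simpa using hxρ
  have hdiff := Complex.differentiableOn_tsum_of_summable_norm hu hd Metric.isOpen_ball hle
  have hder := Complex.hasSum_deriv_of_summable_norm hu hd Metric.isOpen_ball hle hxb
  have hre : evenSeries ω P = fun y : ℝ => (∑' k, F k (y : ℂ)).re := by
    funext y
    have h : ∀ k, F k (y : ℂ) = ((ω k * P.eval (k : ℝ) * y ^ (2 * k) : ℝ) : ℂ) := fun k => by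
      simp [hF]
    simp_rw [h, ← Complex.ofReal_tsum, Complex.ofReal_re]
    rfl
  have han : AnalyticAt ℂ (fun z => ∑' k, F k z) (x : ℂ) :=
    hdiff.analyticAt (Metric.isOpen_ball.mem_nhds hxb)
  refine ⟨?_, ?_⟩
  · rw [hre]
    exact (Complex.reCLM.analyticAt _).comp
      ((han.restrictScalars (𝕜 := ℝ)).comp (Complex.ofRealCLM.analyticAt x))
  · have h1 : HasDerivAt (evenSeries ω P) (deriv (fun z => ∑' k, F k z) (x : ℂ)).re x := by
      rw [hre]
      exact han.differentiableAt.hasDerivAt.real_of_complex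
    rw [h1.deriv]
    have h2 := Complex.hasSum_re (hder.mul_left (x : ℂ))
    rw [Complex.re_ofReal_mul] at h2
    rw [← h2.tsum_eq, evenSeries, ← tsum_mul_left]
    refine tsum_congr fun k => ?_
    have h3 : deriv (F k) (x : ℂ) =
        ((ω k * P.eval (k : ℝ) * ((2 * k : ℕ) * x ^ (2 * k - 1)) : ℝ) : ℂ) := by
      simp only [hF]
      rw [deriv_const_mul_field, deriv_pow_field]
      push_cast
      ring
    rw [h3, ← Complex.ofReal_mul, Complex.ofReal_re]
    simp only [eval_mul, eval_X]
    rcases k.eq_zero_or_pos with rfl | hk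
    · simp
    · have : x ^ (2 * k) = x * x ^ (2 * k - 1) := by
        rw [← pow_succ']; congr 1; omega
      rw [this]
      push_cast
      ring

theorem analyticOnNhd_evenSeries (hB : ∀ k, |ω k| ≤ B) (P : ℝ[X]) :
    AnalyticOnNhd ℝ (evenSeries ω P) (Ioo 0 1) := fun x hx =>
  (analyticAt_evenSeries_and_deriv hB P (by rw [abs_of_pos hx.1]; exact hx.2)).1

theorem analyticOrderAt_mul_of_ne_zero {g f : ℝ → ℝ} {x : ℝ} (hg : AnalyticAt ℝ g x)
    (hg0 : g x ≠ 0) (hf : AnalyticAt ℝ f x) :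
    analyticOrderAt (fun y => g y * f y) x = analyticOrderAt f x := by
  have := analyticOrderAt_mul hg hf
  rw [hg.analyticOrderAt_eq_zero.2 hg0, zero_add] at this
  exact this

/-- Multiplying the coefficient polynomial by `X - κ` amounts to `x ^ (2 κ + 1) d/dx x ^ (-2 κ)`, up
to a factor `2`, so that it loses at most one zero. -/
theorem HasZeros.evenSeries_X_sub_C_mul (hB : ∀ k, |ω k| ≤ B) {P : ℝ[X]} (κ : ℝ) {N : ℕ}
    (h : HasZeros (evenSeries ω P) (Ioo 0 1) (N + 1)) :
    HasZeros (evenSeries ω ((X - C κ) * P)) (Ioo 0 1) N := by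
  have hpow : ∀ s : ℝ, ∀ x ∈ Ioo (0 : ℝ) 1, AnalyticAt ℝ (fun y : ℝ => y ^ s) x := fun s x hx =>
    (Real.contDiffAt_rpow_const_of_ne (n := ⊤) hx.1.ne').analyticAt
  have hpow0 : ∀ s : ℝ, ∀ x ∈ Ioo (0 : ℝ) 1, x ^ s ≠ 0 := fun s x hx =>
    (Real.rpow_pos_of_pos hx.1 s).ne'
  have hE := analyticOnNhd_evenSeries hB (ω := ω)
  set f : ℝ → ℝ := fun y => y ^ (-(2 * κ)) * evenSeries ω P y with hf
  have h1 : HasZeros f (Ioo 0 1) (N + 1) := h.congr_order fun x hx =>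
    (analyticOrderAt_mul_of_ne_zero (hpow _ x hx) (hpow0 _ x hx) (hE P x hx)).ge
  have h2 : HasZeros (deriv f) (Ioo 0 1) N :=
    hasZeros_deriv (fun x hx => (hpow _ x hx).mul (hE P x hx)) h1
  refine h2.congr_order fun x hx => ?_
  have h3 : deriv f =ᶠ[𝓝 x]
      fun y => (2 * y ^ (-(2 * κ) - 1)) * evenSeries ω ((X - C κ) * P) y := by
    filter_upwards [isOpen_Ioo.mem_nhds hx] with y hy
    have hy1 : |y| < 1 := by rw [abs_of_pos hy.1]; exact hy.2
    have hd := (Real.hasDerivAt_rpow_const (x := y) (p := -(2 * κ)) (Or.inl hy.1.ne')).mul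
      (hE P y hy).differentiableAt.hasDerivAt
    have hd' : deriv f y = _ := hd.deriv
    rw [hd', _root_.evenSeries_X_sub_C_mul hB P κ hy1]
    have h4 := (analyticAt_evenSeries_and_deriv hB P hy1).2
    have h5 : y ^ (-(2 * κ)) = y ^ (-(2 * κ) - 1) * y := by
      rw [← Real.rpow_add_one hy.1.ne']; congr 1; ring
    rw [h5]
    linear_combination y ^ (-(2 * κ) - 1) * h4
  rw [analyticOrderAt_congr h3]
  exact (analyticOrderAt_mul_of_ne_zero (analyticAt_const.mul (hpow _ x hx))
    (mul_ne_zero two_ne_zero (hpow0 _ x hx)) (hE _ x hx)).le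

theorem HasZeros.evenSeries_prod (hB : ∀ k, |ω k| ≤ B) (s : Multiset ℝ) {P : ℝ[X]} {N : ℕ}
    (h : HasZeros (evenSeries ω P) (Ioo 0 1) (N + Multiset.card s)) :
    HasZeros (evenSeries ω ((s.map fun a => X - C a).prod * P)) (Ioo 0 1) N := by
  induction s using Multiset.induction generalizing N with
  | empty => simpa using h
  | cons κ s ih =>
    rw [Multiset.map_cons, Multiset.prod_cons, mul_assoc]
    refine (ih ?_).evenSeries_X_sub_C_mul hB κ
    rw [Multiset.card_cons] at h
    convert h using 1
    ring

theorem evenSeries_pos (hB : ∀ k, |ω k| ≤ B) (hω : ∀ k, 0 < ω k) {P : ℝ[X]}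
    (hP : ∀ k : ℕ, 0 ≤ P.eval (k : ℝ)) (hP0 : P ≠ 0) {x : ℝ} (hx : x ∈ Ioo (0 : ℝ) 1) :
    0 < evenSeries ω P x := by
  obtain ⟨k, hk⟩ : ∃ k : ℕ, P.eval (k : ℝ) ≠ 0 := by
    by_contra! hc
    refine hP0 (P.eq_zero_of_infinite_isRoot ?_)
    exact (infinite_range_of_injective (Nat.cast_injective (R := ℝ))).mono
      (by rintro _ ⟨k, rfl⟩; exact hc k)
  refine (summable_norm_evenSeries hB P (by rw [abs_of_pos hx.1]; exact hx.2)).of_norm.tsum_pos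
    (fun j => mul_nonneg (mul_nonneg (hω j).le (hP j)) (pow_nonneg hx.1.le _)) k ?_
  exact mul_pos (mul_pos (hω k) ((hP k).lt_of_ne' hk)) (pow_pos hx.1 _)

theorem evenSeries_neg_poly (P : ℝ[X]) (x : ℝ) : evenSeries ω (-P) x = -evenSeries ω P x := by
  simp [evenSeries, tsum_neg]

theorem eval_sign_of_roots_eq_zero {Q : ℝ[X]} (hQ0 : Q ≠ 0) (hQ : Q.roots = 0) :
    (∀ x, 0 ≤ Q.eval x) ∨ ∀ x, Q.eval x ≤ 0 := by
  by_contra! hc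
  obtain ⟨⟨x, hx⟩, y, hy⟩ := hc
  obtain ⟨z, hz⟩ := intermediate_value_univ x y Q.continuous ⟨hx.le, hy.le⟩
  have : z ∈ Q.roots := (mem_roots hQ0).2 hz
  simp [hQ] at this

/-- A variant of Descartes' rule of signs: if the coefficients are a positive sequence times a
polynomial `P`, the series has at most `P.natDegree` zeros in `(0, 1)`, counted with multiplicity.
Multiplying `P` by the linear factors of all its real roots makes the coefficients of constant sign
and costs at most one zero per root. -/
theorem not_hasZeros_evenSeries (hB : ∀ k, |ω k| ≤ B) (hω : ∀ k, 0 < ω k) {P : ℝ[X]}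
    (hP0 : P ≠ 0) : ¬ HasZeros (evenSeries ω P) (Ioo 0 1) (P.natDegree + 1) := by
  intro h
  obtain ⟨Q, hPQ, hdeg, hQ⟩ := P.exists_prod_multiset_X_sub_C_mul
  set L := (P.roots.map fun a => X - C a).prod with hL
  have hQ0 : Q ≠ 0 := by rintro rfl; simp at hPQ; exact hP0 hPQ.symm
  have hLP : L * P ≠ 0 := by
    refine mul_ne_zero ?_ hP0
    rintro h0; rw [h0, zero_mul] at hPQ; exact hP0 hPQ.symm
  have h1 : HasZeros (evenSeries ω (L * P)) (Ioo 0 1) 1 := by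
    refine HasZeros.evenSeries_prod hB P.roots ?_
    obtain ⟨S, m, hS, hm, hN⟩ := h
    exact ⟨S, m, hS, hm, by have := P.card_roots'; omega⟩
  obtain ⟨x, hx, hx0⟩ := h1.exists_eq_zero
  have hev : ∀ y, (L * P).eval y = L.eval y ^ 2 * Q.eval y := fun y => by
    rw [← hPQ, eval_mul, eval_mul]; ring
  rcases eval_sign_of_roots_eq_zero hQ0 hQ with hs | hs
  · exact (evenSeries_pos hB hω (fun k => by rw [hev]; exact mul_nonneg (sq_nonneg _) (hs _))
      hLP hx).ne' hx0
  · refine (evenSeries_pos hB hω (P := -(L * P)) (fun k => ?_) (neg_ne_zero.2 hLP) hx).ne' ?_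
    · rw [eval_neg, hev, ← mul_neg]
      exact mul_nonneg (sq_nonneg _) (neg_nonneg.2 (hs _))
    · rw [evenSeries_neg_poly, hx0, neg_zero]

end EvenSeries

/-! ### The trigonometric integrals behind the Melnikov function -/

section TrigIntegrals

open Set Filter Polynomial MeasureTheory

/-- The integral of `(1 + r cos θ) ^ e * (r sin θ) ^ j` over a period. -/
noncomputable def trigInt (r e : ℝ) (j : ℕ) : ℝ :=
  ∫ θ in (0 : ℝ)..(2 * Real.pi), (1 + r * Real.cos θ) ^ e * (r * Real.sin θ) ^ j

theorem one_add_mul_cos_pos {r : ℝ} (hr : r ∈ Ioo (0 : ℝ) 1) (θ : ℝ) : 0 < 1 + r * Real.cos θ := by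
  nlinarith [Real.neg_one_le_cos θ, hr.1, hr.2]

theorem continuous_one_add_mul_cos_rpow {r : ℝ} (hr : r ∈ Ioo (0 : ℝ) 1) (e : ℝ) :
    Continuous fun θ => (1 + r * Real.cos θ) ^ e :=
  (by fun_prop : Continuous fun θ => 1 + r * Real.cos θ).rpow_const
    fun θ => Or.inl (one_add_mul_cos_pos hr θ).ne'

theorem intervalIntegrable_trigInt {r : ℝ} (hr : r ∈ Ioo (0 : ℝ) 1) (e : ℝ) (j : ℕ) (a b : ℝ) :
    IntervalIntegrable (fun θ => (1 + r * Real.cos θ) ^ e * (r * Real.sin θ) ^ j) volume a b :=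
  ((continuous_one_add_mul_cos_rpow hr e).mul (by fun_prop)).intervalIntegrable a b

theorem trigInt_of_odd (r e : ℝ) {j : ℕ} (hj : Odd j) : trigInt r e j = 0 := by
  have h := intervalIntegral.integral_comp_sub_left (a := 0) (b := 2 * Real.pi)
    (fun θ => (1 + r * Real.cos θ) ^ e * (r * Real.sin θ) ^ j) (2 * Real.pi)
  simp only [Real.cos_two_pi_sub, Real.sin_two_pi_sub, sub_self, sub_zero, mul_neg, hj.neg_pow,
    intervalIntegral.integral_neg] at h
  unfold trigInt
  linarith

/-- Integration by parts, from the periodic primitive `(1 + r cos θ) ^ e * (r sin θ) ^ (j + 1)`. -/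
theorem integral_rpow_mul_cos_mul_sin {r : ℝ} (hr : r ∈ Ioo (0 : ℝ) 1) (e : ℝ) (j : ℕ) :
    ∫ θ in (0 : ℝ)..(2 * Real.pi),
      (1 + r * Real.cos θ) ^ e * (r * Real.cos θ) * (r * Real.sin θ) ^ j =
      e / (j + 1) * trigInt r (e - 1) (j + 2) := by
  have hder : ∀ θ ∈ uIcc 0 (2 * Real.pi), HasDerivAt
      (fun θ => (1 + r * Real.cos θ) ^ e * (r * Real.sin θ) ^ (j + 1))
      ((j + 1) * ((1 + r * Real.cos θ) ^ e * (r * Real.cos θ) * (r * Real.sin θ) ^ j) -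
        e * ((1 + r * Real.cos θ) ^ (e - 1) * (r * Real.sin θ) ^ (j + 2))) θ := by
    intro θ _
    have h1 : HasDerivAt (fun θ => 1 + r * Real.cos θ) (r * -Real.sin θ) θ :=
      ((Real.hasDerivAt_cos θ).const_mul r).const_add 1
    have h2 : HasDerivAt (fun θ => r * Real.sin θ) (r * Real.cos θ) θ :=
      (Real.hasDerivAt_sin θ).const_mul r
    refine ((h1.rpow_const (p := e) (Or.inl (one_add_mul_cos_pos hr θ).ne')).mul
      (h2.pow (j + 1))).congr_deriv ?_
    push_cast
    simp only [Pi.pow_apply]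
    ring
  have hc1 : Continuous fun θ =>
      (1 + r * Real.cos θ) ^ e * (r * Real.cos θ) * (r * Real.sin θ) ^ j :=
    ((continuous_one_add_mul_cos_rpow hr e).mul (by fun_prop)).mul (by fun_prop)
  have hc2 : Continuous fun θ => (1 + r * Real.cos θ) ^ (e - 1) * (r * Real.sin θ) ^ (j + 2) :=
    (continuous_one_add_mul_cos_rpow hr (e - 1)).mul (by fun_prop)
  have h := intervalIntegral.integral_eq_sub_of_hasDerivAt hder
    ((((continuous_const (y := (j + 1 : ℝ))).mul hc1).sub
      ((continuous_const (y := e)).mul hc2)).intervalIntegrable _ _)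
  rw [intervalIntegral.integral_sub ((hc1.intervalIntegrable _ _).const_mul _)
    ((hc2.intervalIntegrable _ _).const_mul _),
    intervalIntegral.integral_const_mul, intervalIntegral.integral_const_mul] at h
  simp only [Real.sin_two_pi, Real.sin_zero, mul_zero, ne_eq, Nat.add_eq_zero_iff, one_ne_zero,
    and_false, not_false_eq_true, zero_pow, sub_self] at h
  have hj : (j : ℝ) + 1 ≠ 0 := by positivity
  unfold trigInt
  rw [div_mul_eq_mul_div, eq_div_iff hj]
  linarith

theorem trigInt_add_two {r : ℝ} (hr : r ∈ Ioo (0 : ℝ) 1) {e : ℝ} (he : e + 1 ≠ 0) (j : ℕ) :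
    trigInt r e (j + 2) =
      (j + 1) / (e + 1) * (trigInt r (e + 2) j - trigInt r (e + 1) j) := by
  have h1 := integral_rpow_mul_cos_mul_sin hr (e + 1) j
  have h2 : ∫ θ in (0 : ℝ)..(2 * Real.pi),
      (1 + r * Real.cos θ) ^ (e + 1) * (r * Real.cos θ) * (r * Real.sin θ) ^ j =
      trigInt r (e + 2) j - trigInt r (e + 1) j := by
    unfold trigInt
    rw [← intervalIntegral.integral_sub (intervalIntegrable_trigInt hr _ _ _ _)
      (intervalIntegrable_trigInt hr _ _ _ _)]
    refine intervalIntegral.integral_congr fun θ _ => ?_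
    have : (1 + r * Real.cos θ) ^ (e + 2) =
        (1 + r * Real.cos θ) ^ (e + 1) * (1 + r * Real.cos θ) := by
      rw [← Real.rpow_add_one (one_add_mul_cos_pos hr θ).ne']; congr 1; ring
    simp only [this]
    ring
  have hj : (j : ℝ) + 1 ≠ 0 := by positivity
  rw [h2, add_sub_cancel_right] at h1
  rw [h1]
  field_simp

/-! ### Binomial coefficients at half-integers -/

theorem choose_succ_mul (a : ℝ) (j : ℕ) :
    Ring.choose a (j + 1) * (j + 1) = Ring.choose a j * (a - j) := by
  have h1 := Ring.descPochhammer_eq_factorial_smul_choose a (j + 1)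
  have h2 := Ring.descPochhammer_eq_factorial_smul_choose a j
  rw [descPochhammer_succ_right, smeval_mul, h2] at h1
  simp only [smeval_sub, smeval_X, pow_one, smeval_natCast, pow_zero, nsmul_eq_mul, mul_one,
    Nat.factorial_succ, Nat.cast_mul, Nat.cast_succ] at h1
  have : (j.factorial : ℝ) ≠ 0 := by positivity
  apply mul_left_cancel₀ this
  linarith

theorem choose_sub_one_mul (a : ℝ) (j : ℕ) :
    Ring.choose (a - 1) j * a = Ring.choose a j * (a - j) := by
  induction j with
  | zero => simp
  | succ j ih =>
    have h1 := choose_succ_mul (a - 1) j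
    have h2 := choose_succ_mul a j
    have : ((j : ℝ) + 1) ≠ 0 := by positivity
    apply mul_right_cancel₀ this
    push_cast
    linear_combination a * h1 + (a - 1 - j) * ih - (a - (j + 1)) * h2

/-- The polynomial `∏ i < m, (3/2 - i - 2 X) / (3/2 - i)`, the quotient of the binomial coefficients
`(3/2 - m, 2 k)` and `(3/2, 2 k)` as a function of `k`. -/
noncomputable def choosePoly : ℕ → ℝ[X]
  | 0 => 1
  | m + 1 => choosePoly m * (C ((3 / 2 - (m : ℝ))⁻¹) * (C (3 / 2 - (m : ℝ)) - C 2 * X))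

theorem three_half_sub_natCast_ne_zero (m : ℕ) : (3 / 2 - (m : ℝ)) ≠ 0 := by
  intro h
  have h2 : (3 : ℝ) = ((2 * m : ℕ) : ℝ) := by push_cast; linarith
  have h3 : 3 = 2 * m := by exact_mod_cast h2
  omega

theorem natDegree_choosePoly_le (m : ℕ) : (choosePoly m).natDegree ≤ m := by
  induction m with
  | zero => simp [choosePoly]
  | succ m ih =>
    rw [choosePoly]
    refine natDegree_mul_le.trans (add_le_add ih ?_)
    compute_degree

theorem choose_three_half_sub (m k : ℕ) :
    Ring.choose (3 / 2 - (m : ℝ)) (2 * k) =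
      Ring.choose (3 / 2 : ℝ) (2 * k) * (choosePoly m).eval (k : ℝ) := by
  induction m with
  | zero => simp [choosePoly]
  | succ m ih =>
    have h := choose_sub_one_mul (3 / 2 - (m : ℝ)) (2 * k)
    rw [ih] at h
    have h0 := three_half_sub_natCast_ne_zero m
    rw [show (3 / 2 - ((m + 1 : ℕ) : ℝ)) = 3 / 2 - (m : ℝ) - 1 by push_cast; ring,
      choosePoly, eval_mul]
    simp only [eval_mul, eval_C, eval_sub, eval_X]
    apply mul_right_cancel₀ h0
    rw [h, show ∀ a b c d : ℝ, a * (b * (c⁻¹ * d)) * c = a * b * d * (c⁻¹ * c) by intros; ring,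
      inv_mul_cancel₀ h0]
    push_cast
    ring

theorem choose_three_half_pos (k : ℕ) : 0 < Ring.choose (3 / 2 : ℝ) (2 * k) := by
  induction k with
  | zero => simp
  | succ k ih =>
    have h1 := choose_succ_mul (3 / 2) (2 * k)
    have h2 := choose_succ_mul (3 / 2) (2 * k + 1)
    push_cast at h1 h2
    have h3 : Ring.choose (3 / 2 : ℝ) (2 * k + 1 + 1) * ((2 * k + 1 + 1) * (2 * k + 1)) =
        Ring.choose (3 / 2 : ℝ) (2 * k) * ((3 / 2 - 2 * k) * (3 / 2 - (2 * k + 1))) := by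
      linear_combination (2 * k + 1) * h2 + (3 / 2 - (2 * k + 1)) * h1
    have h4 : (0 : ℝ) < (3 / 2 - 2 * k) * (3 / 2 - (2 * k + 1)) := by
      rcases k.eq_zero_or_pos with rfl | hk
      · norm_num
      · have : (1 : ℝ) ≤ k := by exact_mod_cast hk
        nlinarith
    have h5 : (0 : ℝ) < (2 * k + 1 + 1) * (2 * k + 1) := by positivity
    have h6 := mul_pos ih h4
    rw [← h3] at h6
    exact (mul_pos_iff_of_pos_right h5).1 h6

theorem abs_choose_three_half_succ_le (j : ℕ) : |Ring.choose (3 / 2 : ℝ) (j + 1)| ≤ 3 / 2 := by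
  induction j with
  | zero => norm_num [abs_le]
  | succ j ih =>
    have h1 := choose_succ_mul (3 / 2) (j + 1)
    push_cast at h1
    have h2 : |Ring.choose (3 / 2 : ℝ) (j + 1 + 1)| * (j + 1 + 1) ≤ 3 / 2 * (j + 1 + 1) := by
      rw [← abs_of_pos (show (0 : ℝ) < j + 1 + 1 by positivity), ← abs_mul, h1, abs_mul,
        abs_of_pos (show (0 : ℝ) < j + 1 + 1 by positivity)]
      refine mul_le_mul ih ?_ (abs_nonneg _) (by norm_num)
      have : (0 : ℝ) ≤ j := Nat.cast_nonneg j
      rw [abs_le]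
      constructor <;> linarith
    exact le_of_mul_le_mul_right h2 (by positivity)

theorem abs_choose_three_half_le (j : ℕ) : |Ring.choose (3 / 2 : ℝ) j| ≤ 3 / 2 := by
  rcases j with _ | j
  · norm_num
  · exact abs_choose_three_half_succ_le j

/-! ### The Melnikov function as an even power series -/

/-- The positive weights of the power series of the trigonometric integrals. -/
noncomputable def trigWeight (k : ℕ) : ℝ :=
  Ring.choose (3 / 2 : ℝ) (2 * k) *
    ∫ θ in (0 : ℝ)..(2 * Real.pi), Real.cos θ ^ (2 * k) * Real.sin θ ^ 2

theorem trigWeight_pos (k : ℕ) : 0 < trigWeight k := by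
  refine mul_pos (choose_three_half_pos k) ?_
  refine intervalIntegral.integral_pos Real.two_pi_pos (by fun_prop)
    (fun θ _ => by rw [pow_mul]; positivity) ⟨Real.pi / 4, ⟨by positivity, ?_⟩, ?_⟩
  · linarith [Real.pi_pos]
  · rw [Real.cos_pi_div_four, Real.sin_pi_div_four]
    positivity

theorem abs_trigWeight_le (k : ℕ) : |trigWeight k| ≤ 3 / 2 * (2 * Real.pi) := by
  rw [trigWeight, abs_mul]
  refine mul_le_mul (abs_choose_three_half_le _) ?_ (abs_nonneg _) (by norm_num)
  have h := intervalIntegral.norm_integral_le_of_norm_le_const (a := 0) (b := 2 * Real.pi) (C := 1)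
    (f := fun θ => Real.cos θ ^ (2 * k) * Real.sin θ ^ 2) fun θ _ => by
      rw [norm_mul, norm_pow, norm_pow]
      exact mul_le_one₀ (pow_le_one₀ (norm_nonneg _) (Real.abs_cos_le_one θ))
        (pow_nonneg (norm_nonneg _) _)
        (pow_le_one₀ (norm_nonneg _) (Real.abs_sin_le_one θ))
  rwa [one_mul, sub_zero, abs_of_pos Real.two_pi_pos, Real.norm_eq_abs] at h

theorem integral_cos_pow_mul_sin_sq_of_odd {j : ℕ} (hj : Odd j) :
    ∫ θ in (0 : ℝ)..(2 * Real.pi), Real.cos θ ^ j * Real.sin θ ^ 2 = 0 := by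
  have hper : Function.Periodic (fun θ => Real.cos θ ^ j * Real.sin θ ^ 2) (2 * Real.pi) :=
    fun θ => by simp only [Real.cos_add_two_pi, Real.sin_add_two_pi]
  have h := intervalIntegral.integral_comp_add_right (a := 0) (b := 2 * Real.pi)
    (fun θ => Real.cos θ ^ j * Real.sin θ ^ 2) Real.pi
  have h2 := hper.intervalIntegral_add_eq 0 (0 + Real.pi)
  rw [zero_add, zero_add, add_comm Real.pi] at h2
  rw [zero_add, ← h2] at h
  simp only [Real.cos_add_pi, Real.sin_add_pi, hj.neg_pow, even_two.neg_pow, neg_mul,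
    intervalIntegral.integral_neg] at h
  linarith

theorem trigInt_three_half_sub {r : ℝ} (hr : r ∈ Ioo (0 : ℝ) 1) (m : ℕ) :
    trigInt r (3 / 2 - m) 2 = r ^ 2 * evenSeries trigWeight (choosePoly m) r := by
  set e : ℝ := 3 / 2 - m with he
  have hfps := Real.one_add_rpow_hasFPowerSeriesOnBall_zero (a := e)
  have hsum : ∀ x : ℝ, |x| < 1 →
      HasSum (fun j : ℕ => Ring.choose e j * x ^ j) ((1 + x) ^ e) := fun x hx => by
    have h := hfps.hasSum (y := x) (by simpa [← ofReal_norm] using hx)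
    simpa [binomialSeries, FormalMultilinearSeries.coeff_ofScalars, mul_comm] using h
  have hnorm : Summable fun j : ℕ => ‖Ring.choose e j * r ^ j‖ := by
    have := (binomialSeries ℝ e).summable_norm_apply (x := r) (by
      refine Metric.eball_subset_eball hfps.r_le ?_
      simpa [← ofReal_norm, abs_of_pos hr.1] using hr.2)
    simpa [binomialSeries, FormalMultilinearSeries.coeff_ofScalars, mul_comm] using this
  have hint : HasSum (fun j : ℕ => ∫ θ in (0 : ℝ)..(2 * Real.pi),
      Ring.choose e j * (r * Real.cos θ) ^ j * (r * Real.sin θ) ^ 2) (trigInt r e 2) := by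
    refine intervalIntegral.hasSum_integral_of_dominated_convergence
      (fun j _ => ‖Ring.choose e j * r ^ j‖) (fun j => ?_) (fun j => ?_) ?_ ?_ ?_
    · exact (by fun_prop : Continuous fun θ =>
        Ring.choose e j * (r * Real.cos θ) ^ j * (r * Real.sin θ) ^ 2).aestronglyMeasurable
    · refine Eventually.of_forall fun θ _ => ?_
      rw [mul_pow, mul_pow, norm_mul, norm_mul, norm_mul, norm_mul, norm_mul]
      have h1 : ‖Real.cos θ ^ j‖ ≤ 1 := by
        rw [norm_pow]; exact pow_le_one₀ (norm_nonneg _) (Real.abs_cos_le_one θ)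
      have h2 : ‖Real.sin θ ^ 2‖ ≤ 1 := by
        rw [norm_pow]; exact pow_le_one₀ (norm_nonneg _) (Real.abs_sin_le_one θ)
      have h3 : ‖r ^ 2‖ ≤ 1 := by
        rw [norm_pow, Real.norm_of_nonneg hr.1.le]; exact pow_le_one₀ hr.1.le hr.2.le
      calc ‖Ring.choose e j‖ * (‖r ^ j‖ * ‖Real.cos θ ^ j‖) * (‖r ^ 2‖ * ‖Real.sin θ ^ 2‖)
          ≤ ‖Ring.choose e j‖ * (‖r ^ j‖ * 1) * (1 * 1) := by gcongr
        _ = ‖Ring.choose e j‖ * ‖r ^ j‖ := by ring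
    · exact Eventually.of_forall fun _ _ => hnorm
    · exact intervalIntegrable_const
    · refine Eventually.of_forall fun θ _ => (hsum _ ?_).mul_right _
      rw [abs_mul, abs_of_pos hr.1]
      exact (mul_le_of_le_one_right hr.1.le (Real.abs_cos_le_one θ)).trans_lt hr.2
  have hterm : ∀ j : ℕ, ∫ θ in (0 : ℝ)..(2 * Real.pi),
      Ring.choose e j * (r * Real.cos θ) ^ j * (r * Real.sin θ) ^ 2 =
      Ring.choose e j * r ^ (j + 2) *
        ∫ θ in (0 : ℝ)..(2 * Real.pi), Real.cos θ ^ j * Real.sin θ ^ 2 := fun j => by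
    rw [← intervalIntegral.integral_const_mul]
    refine intervalIntegral.integral_congr fun θ _ => ?_
    ring
  simp_rw [hterm] at hint
  have hinj : Function.Injective fun k : ℕ => 2 * k := fun a b h => by simpa using h
  have heven := (hinj.hasSum_iff (fun j hj => by
    rw [integral_cos_pow_mul_sin_sq_of_odd, mul_zero]
    rw [← Nat.not_even_iff_odd]
    rintro ⟨k, rfl⟩
    exact hj ⟨k, by ring⟩)).2 hint
  rw [← heven.tsum_eq, evenSeries, ← tsum_mul_left]
  refine tsum_congr fun k => ?_
  simp only [Function.comp_apply, trigWeight, he, choose_three_half_sub]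
  ring

/-- The function `F` of the amplitude `r` is `r ^ 2` times an even power series with weights
`trigWeight` and coefficient polynomial of degree at most `n`. -/
def IsMelnikovSeries (n : ℕ) (F : ℝ → ℝ) : Prop :=
  ∃ P : ℝ[X], P.natDegree ≤ n ∧ ∀ r ∈ Ioo (0 : ℝ) 1, F r = r ^ 2 * evenSeries trigWeight P r

namespace IsMelnikovSeries

variable {n : ℕ} {F G : ℝ → ℝ}

theorem congr (hF : IsMelnikovSeries n F) (h : ∀ r ∈ Ioo (0 : ℝ) 1, G r = F r) :
    IsMelnikovSeries n G := by
  obtain ⟨P, hP, hFP⟩ := hF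
  exact ⟨P, hP, fun r hr => (h r hr).trans (hFP r hr)⟩

theorem zero : IsMelnikovSeries n fun _ => 0 := ⟨0, by simp, fun r _ => by simp [evenSeries]⟩

theorem add (hF : IsMelnikovSeries n F) (hG : IsMelnikovSeries n G) :
    IsMelnikovSeries n fun r => F r + G r := by
  obtain ⟨P, hP, hFP⟩ := hF
  obtain ⟨Q, hQ, hGQ⟩ := hG
  refine ⟨P + Q, natDegree_add_le_of_degree_le hP hQ, fun r hr => ?_⟩
  have hr1 : |r| < 1 := by rw [abs_of_pos hr.1]; exact hr.2
  beta_reduce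
  rw [hFP r hr, hGQ r hr, ← mul_add, evenSeries, evenSeries, ← Summable.tsum_add
    (summable_norm_evenSeries abs_trigWeight_le P hr1).of_norm
    (summable_norm_evenSeries abs_trigWeight_le Q hr1).of_norm, evenSeries]
  congr 1
  refine tsum_congr fun k => ?_
  rw [eval_add]
  ring

theorem const_mul (c : ℝ) (hF : IsMelnikovSeries n F) : IsMelnikovSeries n fun r => c * F r := by
  obtain ⟨P, hP, hFP⟩ := hF
  refine ⟨C c * P, (natDegree_C_mul_le c P).trans hP, fun r hr => ?_⟩
  beta_reduce
  rw [hFP r hr, evenSeries, evenSeries, mul_left_comm, ← tsum_mul_left]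
  congr 1
  refine tsum_congr fun k => ?_
  rw [eval_mul, eval_C]
  ring

theorem sum {ι : Type*} {s : Finset ι} {F : ι → ℝ → ℝ} (h : ∀ i ∈ s, IsMelnikovSeries n (F i)) :
    IsMelnikovSeries n fun r => ∑ i ∈ s, F i r := by
  classical
  induction s using Finset.induction_on with
  | empty => simpa using zero
  | insert i s hi ih =>
    simp only [Finset.sum_insert hi]
    exact (h i (by simp)).add (ih fun j hj => h j (by simp [hj]))

/-- Each integration by parts lowers the power of the sine by two and raises the exponent of
`1 + r cos θ` by one or two. -/
theorem trigInt (k : ℕ) : ∀ m : ℕ, 3 * k ≤ m → m ≤ n + k →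
    IsMelnikovSeries n fun r => trigInt r (3 / 2 - m) (2 * k + 2) := by
  induction k with
  | zero =>
    intro m _ hm
    exact ⟨choosePoly m, (natDegree_choosePoly_le m).trans hm,
      fun r hr => trigInt_three_half_sub hr m⟩
  | succ k ih =>
    intro m hm1 hm2
    obtain ⟨l, rfl⟩ : ∃ l, m = l + 2 := ⟨m - 2, by omega⟩
    have h1 := ih l (by omega) (by omega)
    have h2 := ih (l + 1) (by omega) (by omega)
    have hne : (3 / 2 - ((l + 2 : ℕ) : ℝ)) + 1 ≠ 0 := by
      have := three_half_sub_natCast_ne_zero (l + 1)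
      push_cast at this ⊢
      intro h
      exact this (by linarith)
    refine ((h1.add (h2.const_mul (-1))).const_mul
      (((2 * k + 2 : ℕ) + 1) / ((3 / 2 - ((l + 2 : ℕ) : ℝ)) + 1))).congr fun r hr => ?_
    rw [show 2 * (k + 1) + 2 = (2 * k + 2) + 2 by ring, trigInt_add_two hr hne,
      show 3 / 2 - ((l + 2 : ℕ) : ℝ) + 2 = 3 / 2 - l by push_cast; ring,
      show 3 / 2 - ((l + 2 : ℕ) : ℝ) + 1 = 3 / 2 - ((l + 1 : ℕ) : ℝ) by push_cast; ring]
    ring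

end IsMelnikovSeries

end TrigIntegrals

/-! ### The perturbation in polar coordinates -/

section PolarPerturbation

open Set Filter

variable {𝕜 : Type*} [RCLike 𝕜]

/-- The value at a point of `𝕜 × 𝕜`, for `𝕜 = ℝ` or `ℂ`, of the polynomial with real coefficients
`c i j`, `i + j ≤ n`. -/
noncomputable def polyAt (n : ℕ) (c : ℕ → ℕ → ℝ) (x y : 𝕜) : 𝕜 :=
  ∑ i ∈ Finset.range (n + 1), ∑ j ∈ Finset.range (n + 1 - i), (c i j : 𝕜) * x ^ i * y ^ j

/-- In the coordinates `p = 1 / x - 1 = r cos θ`, `q = y x ^ (-3/2) / √2 = r sin θ` this is the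
coefficient of `ε` in `p'`. Here `s = sin θ` and `w = √(1 + r cos θ)`, so that `x = 1 / w ^ 2` and
`y = √2 r s / w ^ 3`. -/
noncomputable def perturbP (n : ℕ) (a : ℕ → ℕ → ℝ) (w r s : 𝕜) : 𝕜 :=
  -(w ^ 4) * polyAt n a (1 / w ^ 2) ((√2 : ℝ) * r * s / w ^ 3)

/-- The coefficient of `ε` in `q'`, in the same coordinates. -/
noncomputable def perturbQ (n : ℕ) (a b : ℕ → ℕ → ℝ) (w r s : 𝕜) : 𝕜 :=
  w ^ 3 / (√2 : ℝ) * (polyAt n b (1 / w ^ 2) ((√2 : ℝ) * r * s / w ^ 3) -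
    3 / 2 * ((√2 : ℝ) * r * s / w ^ 3) * w ^ 2 *
      polyAt n a (1 / w ^ 2) ((√2 : ℝ) * r * s / w ^ 3))

/-- `w` times the coefficient of `ε` in `r'`; here `c = cos θ`. -/
noncomputable def perturbRad (n : ℕ) (a b : ℕ → ℕ → ℝ) (w r c s : 𝕜) : 𝕜 :=
  w * (perturbP n a w r s * c + perturbQ n a b w r s * s)

/-- `w` times the coefficient of `ε` in `θ'`. -/
noncomputable def perturbAng (n : ℕ) (a b : ℕ → ℕ → ℝ) (w r c s : 𝕜) : 𝕜 :=
  w / r * (perturbQ n a b w r s * c - perturbP n a w r s * s)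

theorem polyAt_real (n : ℕ) (c : ℕ → ℕ → ℝ) (x y : ℝ) :
    polyAt n c x y = ReversibleSystem.poly n c (x, y) := rfl

theorem ofReal_polyAt (n : ℕ) (c : ℕ → ℕ → ℝ) (x y : ℝ) :
    ((polyAt n c x y : ℝ) : ℂ) = polyAt n c (x : ℂ) (y : ℂ) := by
  simp [polyAt]

theorem ofReal_perturbRad (n : ℕ) (a b : ℕ → ℕ → ℝ) (w r c s : ℝ) :
    ((perturbRad n a b w r c s : ℝ) : ℂ) = perturbRad n a b (w : ℂ) (r : ℂ) (c : ℂ) (s : ℂ) := by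
  simp [perturbRad, perturbP, perturbQ, ofReal_polyAt]

theorem ofReal_perturbAng (n : ℕ) (a b : ℕ → ℕ → ℝ) (w r c s : ℝ) :
    ((perturbAng n a b w r c s : ℝ) : ℂ) = perturbAng n a b (w : ℂ) (r : ℂ) (c : ℂ) (s : ℂ) := by
  simp [perturbAng, perturbP, perturbQ, ofReal_polyAt]

end PolarPerturbation

section MelnikovFormula

open Set Filter

/-- The point of the half-plane `x > 0` with polar coordinates `(r, θ)`. -/
noncomputable def polarX (r θ : ℝ) : ℝ := 1 / (1 + r * Real.cos θ)

/-- Second coordinate of the point with polar coordinates `(r, θ)`. -/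
noncomputable def polarY (r θ : ℝ) : ℝ := √2 * r * Real.sin θ / √(1 + r * Real.cos θ) ^ 3

theorem hasDerivAt_sqrt_one_add_mul_cos {r : ℝ} (hr : r ∈ Ioo (0 : ℝ) 1) (θ : ℝ) :
    HasDerivAt (fun θ => √(1 + r * Real.cos θ))
      (-(r * Real.sin θ) / (2 * √(1 + r * Real.cos θ))) θ := by
  have h1 : HasDerivAt (fun θ => 1 + r * Real.cos θ) (r * -Real.sin θ) θ :=
    ((Real.hasDerivAt_cos θ).const_mul r).const_add 1
  refine (h1.sqrt (one_add_mul_cos_pos hr θ).ne').congr_deriv ?_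
  ring

theorem deriv_ovalX {h r : ℝ} (hr : r ∈ Ioo (0 : ℝ) 1) (hh : √(1 + h) = r) (θ : ℝ) :
    deriv (ReversibleSystem.ovalX h) θ = r * Real.sin θ / (1 + r * Real.cos θ) ^ 2 := by
  have h1 : HasDerivAt (fun θ => 1 + r * Real.cos θ) (r * -Real.sin θ) θ :=
    ((Real.hasDerivAt_cos θ).const_mul r).const_add 1
  have h2 : ReversibleSystem.ovalX h = fun θ => 1 / (1 + r * Real.cos θ) := by
    funext t; rw [ReversibleSystem.ovalX, hh]
  have h3 := h1.inv (one_add_mul_cos_pos hr θ).ne'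
  rw [h2]
  simp only [one_div]
  rw [show (fun θ => (1 + r * Real.cos θ)⁻¹) = (fun θ => 1 + r * Real.cos θ)⁻¹ from rfl, h3.deriv]
  ring

theorem deriv_ovalY {h r : ℝ} (hr : r ∈ Ioo (0 : ℝ) 1) (hh : √(1 + h) = r) (θ : ℝ) :
    deriv (ReversibleSystem.ovalY h) θ =
      √2 * (r * Real.cos θ) / √(1 + r * Real.cos θ) ^ 3 +
        3 / 2 * √2 * (r * Real.sin θ) ^ 2 / √(1 + r * Real.cos θ) ^ 5 := by
  have hw := hasDerivAt_sqrt_one_add_mul_cos hr θ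
  have hpos : 0 < √(1 + r * Real.cos θ) := Real.sqrt_pos.2 (one_add_mul_cos_pos hr θ)
  have h1 : HasDerivAt (fun θ => √2 * r * Real.sin θ) (√2 * r * Real.cos θ) θ :=
    (Real.hasDerivAt_sin θ).const_mul _
  have h2 : ReversibleSystem.ovalY h =
      fun θ => √2 * r * Real.sin θ / √(1 + r * Real.cos θ) ^ 3 := by
    funext t; rw [ReversibleSystem.ovalY, hh]
  have h3 := h1.div (hw.pow 3) (pow_pos hpos 3).ne'
  have h4 : ReversibleSystem.ovalY h = (fun θ => √2 * r * Real.sin θ) /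
      (fun θ => √(1 + r * Real.cos θ)) ^ 3 := h2
  rw [h4, h3.deriv]
  simp only [Pi.pow_apply]
  field_simp
  push_cast
  ring

/-- The Melnikov integrand in terms of `w = √(1 + r cos θ)`. -/
theorem melnikov_integrand {h r : ℝ} (hr : r ∈ Ioo (0 : ℝ) 1) (hh : √(1 + h) = r)
    (n : ℕ) (a b : ℕ → ℕ → ℝ) (θ : ℝ) :
    (ReversibleSystem.ovalX h θ ^ 4)⁻¹ *
      (ReversibleSystem.poly n b (ReversibleSystem.ovalX h θ, ReversibleSystem.ovalY h θ) *
          deriv (ReversibleSystem.ovalX h) θ -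
        ReversibleSystem.poly n a (ReversibleSystem.ovalX h θ, ReversibleSystem.ovalY h θ) *
          deriv (ReversibleSystem.ovalY h) θ) =
    √2 * r * perturbRad n a b (√(1 + r * Real.cos θ)) r (Real.cos θ) (Real.sin θ) := by
  have hpos : 0 < √(1 + r * Real.cos θ) := Real.sqrt_pos.2 (one_add_mul_cos_pos hr θ)
  have hsq : 1 + r * Real.cos θ = √(1 + r * Real.cos θ) ^ 2 :=
    (Real.sq_sqrt (one_add_mul_cos_pos hr θ).le).symm
  rw [deriv_ovalX hr hh, deriv_ovalY hr hh]
  simp only [ReversibleSystem.ovalX, ReversibleSystem.ovalY, perturbRad, perturbP, perturbQ,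
    polyAt_real, hh, RCLike.ofReal_real_eq_id, id_eq]
  generalize √(1 + r * Real.cos θ) = w at *
  rw [hsq]
  generalize ReversibleSystem.poly n a _ = f
  generalize ReversibleSystem.poly n b _ = g
  have h2 : √2 ^ 2 = 2 := Real.sq_sqrt (by norm_num)
  have h20 : √2 ≠ 0 := by positivity
  field_simp
  ring_nf

theorem melnikov_eq {h r : ℝ} (hr : r ∈ Ioo (0 : ℝ) 1) (hh : √(1 + h) = r)
    (n : ℕ) (a b : ℕ → ℕ → ℝ) :
    ReversibleSystem.melnikov n a b h = √2 * r * ∫ θ in (0 : ℝ)..(2 * Real.pi),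
      perturbRad n a b (√(1 + r * Real.cos θ)) r (Real.cos θ) (Real.sin θ) := by
  rw [ReversibleSystem.melnikov, ← intervalIntegral.integral_const_mul]
  exact intervalIntegral.integral_congr fun θ _ => melnikov_integrand hr hh n a b θ

theorem pow_eq_rpow_of_sqrt {u : ℝ} (hu : 0 < u) (v : ℝ) (i j : ℕ) :
    u ^ 4 * ((1 / u) ^ i * (√2 * v / √u ^ 3) ^ j) =
      √2 ^ j * (u ^ (4 - i - 3 / 2 * j : ℝ) * v ^ j) := by
  have h1 : (√u ^ 3) ^ j = u ^ (3 / 2 * j : ℝ) := by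
    rw [← pow_mul, Real.sqrt_eq_rpow, ← Real.rpow_mul_natCast hu.le]
    congr 1
    push_cast
    ring
  rw [Real.rpow_sub hu, Real.rpow_sub hu, Real.rpow_natCast, ← h1,
    show (4 : ℝ) = ((4 : ℕ) : ℝ) by norm_num, Real.rpow_natCast, div_pow, div_pow, mul_pow, one_pow]
  field_simp

theorem melnikov_monomial_dx {u : ℝ} (hu : 0 < u) (v : ℝ) (i j : ℕ) :
    u ^ 4 * ((1 / u) ^ i * (√2 * v / √u ^ 3) ^ j) * (v / u ^ 2) =
      √2 ^ j * (u ^ (2 - i - 3 / 2 * j : ℝ) * v ^ (j + 1)) := by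
  have h1 : u ^ (4 - i - 3 / 2 * j : ℝ) = u ^ (2 - i - 3 / 2 * j : ℝ) * u ^ 2 := by
    rw [← Real.rpow_add_natCast hu.ne']
    congr 1
    push_cast
    ring
  rw [pow_eq_rpow_of_sqrt hu, h1]
  field_simp
  ring

theorem melnikov_monomial_dy {u : ℝ} (hu : 0 < u) (p v : ℝ) (i j : ℕ) :
    u ^ 4 * ((1 / u) ^ i * (√2 * v / √u ^ 3) ^ j) *
        (√2 * p / √u ^ 3 + 3 / 2 * √2 * v ^ 2 / √u ^ 5) =
      √2 ^ (j + 1) * (u ^ (5 / 2 - i - 3 / 2 * j : ℝ) * p * v ^ j) +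
        3 / 2 * √2 ^ (j + 1) * (u ^ (3 / 2 - i - 3 / 2 * j : ℝ) * v ^ (j + 2)) := by
  have hw : 0 < √u := Real.sqrt_pos.2 hu
  have h0 : ∀ k : ℕ, √u ^ k = u ^ (k / 2 : ℝ) := fun k => by
    rw [Real.sqrt_eq_rpow, ← Real.rpow_mul_natCast hu.le]
    congr 1
    ring
  have h1 : u ^ (4 - i - 3 / 2 * j : ℝ) = u ^ (5 / 2 - i - 3 / 2 * j : ℝ) * √u ^ 3 := by
    rw [h0, ← Real.rpow_add hu]
    congr 1
    push_cast
    ring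
  have h2 : u ^ (4 - i - 3 / 2 * j : ℝ) = u ^ (3 / 2 - i - 3 / 2 * j : ℝ) * √u ^ 5 := by
    rw [h0, ← Real.rpow_add hu]
    congr 1
    push_cast
    ring
  rw [pow_eq_rpow_of_sqrt hu, mul_add]
  congr 1
  · rw [h1]
    field_simp
    ring
  · rw [h2]
    field_simp
    ring

/-- The contribution of the monomial `x ^ i * y ^ j` in `g` to the Melnikov function. -/
theorem isMelnikovSeries_dx {n i j : ℕ} (h : i + j ≤ n) :
    IsMelnikovSeries n fun r => trigInt r (2 - i - 3 / 2 * j) (j + 1) := by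
  rcases Nat.even_or_odd' j with ⟨k, rfl | rfl⟩
  · exact IsMelnikovSeries.zero.congr fun r _ => trigInt_of_odd _ _ ⟨k, rfl⟩
  · refine (IsMelnikovSeries.trigInt k (1 + i + 3 * k) (by omega) (by omega)).congr fun r _ => ?_
    congr 1
    push_cast
    ring

/-- The contribution of the monomial `x ^ i * y ^ j` in `f` to the Melnikov function. -/
theorem isMelnikovSeries_dy {n i j : ℕ} (h : i + j ≤ n) :
    IsMelnikovSeries n fun r => trigInt r (3 / 2 - i - 3 / 2 * j) (j + 2) := by
  rcases Nat.even_or_odd' j with ⟨k, rfl | rfl⟩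
  · refine (IsMelnikovSeries.trigInt k (i + 3 * k) (by omega) (by omega)).congr fun r _ => ?_
    congr 1
    push_cast
    ring
  · exact IsMelnikovSeries.zero.congr fun r _ => trigInt_of_odd _ _ ⟨k + 1, by ring⟩

theorem melnikov_eq_sum {h r : ℝ} (hr : r ∈ Ioo (0 : ℝ) 1) (hh : √(1 + h) = r)
    (n : ℕ) (a b : ℕ → ℕ → ℝ) :
    ReversibleSystem.melnikov n a b h =
      ∑ i ∈ Finset.range (n + 1), ∑ j ∈ Finset.range (n + 1 - i),
        (b i j * √2 ^ j * trigInt r (2 - i - 3 / 2 * j) (j + 1) +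
          -(a i j * √2 ^ (j + 1) * ((5 / 2 - i - 3 / 2 * j) / (j + 1) + 3 / 2)) *
            trigInt r (3 / 2 - i - 3 / 2 * j) (j + 2)) := by
  have hterm : ∀ i j : ℕ, ∀ θ : ℝ,
      b i j * √2 ^ j * ((1 + r * Real.cos θ) ^ (2 - i - 3 / 2 * j : ℝ) *
          (r * Real.sin θ) ^ (j + 1)) +
        (-(a i j * √2 ^ (j + 1)) * ((1 + r * Real.cos θ) ^ (5 / 2 - i - 3 / 2 * j : ℝ) *
          (r * Real.cos θ) * (r * Real.sin θ) ^ j) +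
        -(a i j * √2 ^ (j + 1) * (3 / 2)) * ((1 + r * Real.cos θ) ^ (3 / 2 - i - 3 / 2 * j : ℝ) *
          (r * Real.sin θ) ^ (j + 2))) =
      (1 + r * Real.cos θ) ^ 4 * (b i j * (1 / (1 + r * Real.cos θ)) ^ i *
        (√2 * r * Real.sin θ / √(1 + r * Real.cos θ) ^ 3) ^ j *
          (r * Real.sin θ / (1 + r * Real.cos θ) ^ 2) -
        a i j * (1 / (1 + r * Real.cos θ)) ^ i *
        (√2 * r * Real.sin θ / √(1 + r * Real.cos θ) ^ 3) ^ j *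
          (√2 * (r * Real.cos θ) / √(1 + r * Real.cos θ) ^ 3 +
        3 / 2 * √2 * (r * Real.sin θ) ^ 2 / √(1 + r * Real.cos θ) ^ 5)) := fun i j θ => by
    have h1 := melnikov_monomial_dx (one_add_mul_cos_pos hr θ) (r * Real.sin θ) i j
    have h2 := melnikov_monomial_dy (one_add_mul_cos_pos hr θ) (r * Real.cos θ)
      (r * Real.sin θ) i j
    rw [← mul_assoc √2 r] at h1 h2
    linear_combination -(b i j) * h1 + a i j * h2
  have hcont : ∀ e : ℝ, ∀ j : ℕ, Continuous fun θ =>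
      (1 + r * Real.cos θ) ^ e * (r * Real.cos θ) * (r * Real.sin θ) ^ j := fun e j =>
    ((continuous_one_add_mul_cos_rpow hr e).mul (by fun_prop)).mul (by fun_prop)
  have hI := fun e j => intervalIntegrable_trigInt hr e j 0 (2 * Real.pi)
  have hJ := fun e j => (hcont e j).intervalIntegrable (μ := MeasureTheory.volume) 0 (2 * Real.pi)
  have hmain : ReversibleSystem.melnikov n a b h = ∫ θ in (0 : ℝ)..(2 * Real.pi),
      ∑ i ∈ Finset.range (n + 1), ∑ j ∈ Finset.range (n + 1 - i),
      (b i j * √2 ^ j * ((1 + r * Real.cos θ) ^ (2 - i - 3 / 2 * j : ℝ) *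
          (r * Real.sin θ) ^ (j + 1)) +
        (-(a i j * √2 ^ (j + 1)) * ((1 + r * Real.cos θ) ^ (5 / 2 - i - 3 / 2 * j : ℝ) *
          (r * Real.cos θ) * (r * Real.sin θ) ^ j) +
        -(a i j * √2 ^ (j + 1) * (3 / 2)) * ((1 + r * Real.cos θ) ^ (3 / 2 - i - 3 / 2 * j : ℝ) *
          (r * Real.sin θ) ^ (j + 2)))) := by
    refine intervalIntegral.integral_congr fun θ _ => ?_
    simp only [hterm]
    rw [deriv_ovalX hr hh, deriv_ovalY hr hh]
    simp only [ReversibleSystem.ovalX, ReversibleSystem.ovalY, hh, ReversibleSystem.poly,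
      ← Finset.mul_sum, Finset.sum_sub_distrib, ← Finset.sum_mul, div_pow, one_pow,
      inv_div, div_one]
  rw [hmain, intervalIntegral.integral_finsetSum]
  · refine Finset.sum_congr rfl fun i _ => ?_
    rw [intervalIntegral.integral_finsetSum]
    · refine Finset.sum_congr rfl fun j _ => ?_
      rw [intervalIntegral.integral_add ((hI _ _).const_mul _)
        (((hJ _ _).const_mul _).add ((hI _ _).const_mul _)),
        intervalIntegral.integral_add ((hJ _ _).const_mul _) ((hI _ _).const_mul _),
        intervalIntegral.integral_const_mul, intervalIntegral.integral_const_mul,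
        intervalIntegral.integral_const_mul, integral_rpow_mul_cos_mul_sin hr,
        show (5 / 2 - i - 3 / 2 * j - 1 : ℝ) = 3 / 2 - i - 3 / 2 * j by ring]
      unfold trigInt
      ring
    · exact fun j _ => ((hI _ _).const_mul _).add
        (((hJ _ _).const_mul _).add ((hI _ _).const_mul _))
  · refine fun i _ => (continuous_finsetSum _ fun j _ => ?_).intervalIntegrable _ _
    exact (continuous_const.mul ((continuous_one_add_mul_cos_rpow hr _).mul (by fun_prop))).add
      ((continuous_const.mul (hcont _ _)).add
        (continuous_const.mul ((continuous_one_add_mul_cos_rpow hr _).mul (by fun_prop))))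

/-- The Melnikov function as a function of the amplitude `r`, with `r ^ 2 = 1 + h`. -/
theorem isMelnikovSeries_melnikov (n : ℕ) (a b : ℕ → ℕ → ℝ) :
    IsMelnikovSeries n fun r => ReversibleSystem.melnikov n a b (r ^ 2 - 1) := by
  refine IsMelnikovSeries.congr (F := fun r =>
    ∑ i ∈ Finset.range (n + 1), ∑ j ∈ Finset.range (n + 1 - i),
        (b i j * √2 ^ j * trigInt r (2 - i - 3 / 2 * j) (j + 1) +
          -(a i j * √2 ^ (j + 1) * ((5 / 2 - i - 3 / 2 * j) / (j + 1) + 3 / 2)) *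
            trigInt r (3 / 2 - i - 3 / 2 * j) (j + 2))) ?_
    fun r hr => melnikov_eq_sum hr (by rw [add_sub_cancel, Real.sqrt_sq hr.1.le]) n a b
  refine IsMelnikovSeries.sum fun i hi => IsMelnikovSeries.sum fun j hj => ?_
  rw [Finset.mem_range] at hi hj
  exact ((isMelnikovSeries_dx (by omega)).const_mul _).add
    ((isMelnikovSeries_dy (by omega)).const_mul _)

end MelnikovFormula

/-! ### Persistence of the number of zeros under limits of holomorphic functions -/

section Hurwitz

open Set Filter

/-- `f` vanishes at some `a` in `I`, the divided difference `(f z - f a) / (z - a)` vanishes at some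
point of `I`, and so on, `N` times. For holomorphic `f` this says that `f` has `N` zeros in `I`
counted with multiplicity, in a form that passes to limits. -/
def ZeroChain (I : Set ℂ) : ℕ → (ℂ → ℂ) → Prop
  | 0, _ => True
  | N + 1, f => ∃ a ∈ I, f a = 0 ∧ ZeroChain I N (dslope f a)

theorem analyticOrderAt_eq_add_dslope {f : ℂ → ℂ} {U : Set ℂ} (hU : IsOpen U)
    (hf : DifferentiableOn ℂ f U) {a z : ℂ} (ha : a ∈ U) (hz : z ∈ U) (h0 : f a = 0) :
    analyticOrderAt f z = analyticOrderAt (· - a) z + analyticOrderAt (dslope f a) z := by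
  have hd : DifferentiableOn ℂ (dslope f a) U :=
    (Complex.differentiableOn_dslope (hU.mem_nhds ha)).2 hf
  have h1 := analyticOrderAt_mul (f := fun z => z - a) (g := dslope f a) (z₀ := z)
    (by fun_prop) (hd.analyticAt (hU.mem_nhds hz))
  rw [← h1]
  congr 1
  funext y
  have := sub_smul_dslope f a y
  rw [h0, sub_zero, smul_eq_mul] at this
  exact this.symm

theorem HasZeros.zeroChain {U I : Set ℂ} (hU : IsOpen U) (hI : I ⊆ U) {N : ℕ} :
    ∀ {f : ℂ → ℂ}, DifferentiableOn ℂ f U → HasZeros f I N → ZeroChain I N f := by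
  classical
  induction N with
  | zero => exact fun _ _ => trivial
  | succ N ih =>
    intro f hf h
    obtain ⟨S, m, hS, hm, hN⟩ := h
    obtain ⟨a, ha, ha0⟩ : ∃ x ∈ S, m x ≠ 0 := by
      by_contra! hc
      rw [Finset.sum_eq_zero hc] at hN
      omega
    have hfa : f a = 0 := apply_eq_zero_of_analyticOrderAt_ne_zero fun h0 => ha0 (by
      simpa [h0] using hm a ha)
    have hd : DifferentiableOn ℂ (dslope f a) U :=
      (Complex.differentiableOn_dslope (hU.mem_nhds (hI (hS ha)))).2 hf
    refine ⟨a, hS ha, hfa, ih hd ⟨S, fun x => if x = a then m a - 1 else m x, hS, ?_, ?_⟩⟩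
    · intro x hx
      have h1 := hm x hx
      rw [analyticOrderAt_eq_add_dslope hU hf (hI (hS ha)) (hI (hS hx)) hfa] at h1
      beta_reduce
      split_ifs with hxa
      · subst hxa
        rw [analyticOrderAt_id_sub_const_self] at h1
        have h2 : (m x : ℕ∞) = 1 + (m x - 1 : ℕ) := by
          rw [← Nat.cast_one, ← Nat.cast_add]; congr 1; omega
        rw [h2] at h1
        exact (ENat.add_le_add_iff_left (by simp)).1 h1
      · rwa [analyticOrderAt_id_sub_const_of_ne hxa, zero_add] at h1
    · rw [← Finset.add_sum_erase S _ ha] at hN ⊢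
      have : ∑ x ∈ S.erase a, (if x = a then m a - 1 else m x) = ∑ x ∈ S.erase a, m x :=
        Finset.sum_congr rfl fun x hx => if_neg (Finset.ne_of_mem_erase hx)
      rw [if_pos rfl, this]
      omega

theorem ZeroChain.hasZeros {U I : Set ℂ} (hU : IsOpen U) (hI : I ⊆ U) {N : ℕ} :
    ∀ {f : ℂ → ℂ}, DifferentiableOn ℂ f U → ZeroChain I N f → HasZeros f I N := by
  classical
  induction N with
  | zero => exact fun _ _ => ⟨∅, 0, by simp, by simp, by simp⟩
  | succ N ih =>
    rintro f hf ⟨a, ha, hfa, h⟩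
    have hd : DifferentiableOn ℂ (dslope f a) U :=
      (Complex.differentiableOn_dslope (hU.mem_nhds (hI ha))).2 hf
    obtain ⟨S, m, hS, hm, hN⟩ := ih hd h
    refine ⟨insert a S, fun x => (if x = a then 1 else 0) + (if x ∈ S then m x else 0), ?_, ?_, ?_⟩
    · rw [Finset.coe_insert]
      exact insert_subset ha hS
    · intro x hx
      have hxI : x ∈ I := by
        rcases Finset.mem_insert.1 hx with rfl | hx
        exacts [ha, hS hx]
      rw [analyticOrderAt_eq_add_dslope hU hf (hI ha) (hI hxI) hfa, Nat.cast_add]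
      refine add_le_add ?_ ?_
      · split_ifs with hxa
        · subst hxa
          rw [analyticOrderAt_id_sub_const_self, Nat.cast_one]
        · simp
      · split_ifs with hxS
        · exact hm x hxS
        · simp
    · rw [Finset.sum_add_distrib, Finset.sum_ite_eq' (insert a S) a, if_pos (by simp),
        ← Finset.sum_filter]
      have : (insert a S).filter (· ∈ S) = S := by
        ext x; simp only [Finset.mem_filter, Finset.mem_insert]; tauto
      rw [this]
      omega

/-- Continuous convergence of holomorphic functions gives continuous convergence of derivatives. -/
theorem tendsto_deriv_of_continuous_convergence {F : ℕ → ℂ → ℂ} {f : ℂ → ℂ} {U : Set ℂ}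
    (hU : IsOpen U) (hF : ∀ i, DifferentiableOn ℂ (F i) U) (hf : DifferentiableOn ℂ f U)
    (h : ∀ x ∈ U, Tendsto (fun q : ℕ × ℂ => F q.1 q.2) (atTop ×ˢ 𝓝 x) (𝓝 (f x)))
    {x : ℂ} (hx : x ∈ U) :
    Tendsto (fun q : ℕ × ℂ => deriv (F q.1) q.2) (atTop ×ˢ 𝓝 x) (𝓝 (deriv f x)) := by
  have hlu : TendstoLocallyUniformlyOn F f atTop U := by
    rw [tendstoLocallyUniformlyOn_iff_filter]
    intro y hy
    rw [hU.nhdsWithin_eq hy, tendstoUniformlyOnFilter_iff_tendsto]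
    have hc : Tendsto (fun q : ℕ × ℂ => f q.2) (atTop ×ˢ 𝓝 y) (𝓝 (f y)) :=
      (hf.continuousOn.continuousAt (hU.mem_nhds hy)).tendsto.comp tendsto_snd
    exact (hc.prodMk_nhds (h y hy)).mono_right (nhds_le_uniformity (f y))
  have hd := hlu.deriv (Eventually.of_forall hF) hU
  have h1 := (tendstoLocallyUniformlyOn_iff_filter.1 hd) x hx
  rw [hU.nhdsWithin_eq hx] at h1
  have hdc : ContinuousAt (deriv f) x :=
    (hf.analyticAt (hU.mem_nhds hx)).deriv.continuousAt
  rw [Metric.tendsto_nhds]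
  intro ε hε
  have h2 := Metric.tendstoUniformlyOnFilter_iff.1 h1 (ε / 2) (half_pos hε)
  have h3 := (Metric.tendsto_nhds.1 hdc (ε / 2) (half_pos hε))
  filter_upwards [h2, h3.prod_inr atTop] with q hq1 hq2
  calc dist (deriv (F q.1) q.2) (deriv f x)
      ≤ dist (deriv (F q.1) q.2) (deriv f q.2) + dist (deriv f q.2) (deriv f x) :=
        dist_triangle _ _ _
    _ < ε := by
        rw [dist_comm (deriv (F q.1) q.2)]
        exact (add_lt_add hq1 hq2).trans_eq (add_halves ε)

theorem tendsto_dslope_of_continuous_convergence {F : ℕ → ℂ → ℂ} {f : ℂ → ℂ} {U : Set ℂ}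
    (hU : IsOpen U) (hF : ∀ i, DifferentiableOn ℂ (F i) U) (hf : DifferentiableOn ℂ f U)
    (h : ∀ x ∈ U, Tendsto (fun q : ℕ × ℂ => F q.1 q.2) (atTop ×ˢ 𝓝 x) (𝓝 (f x)))
    {a : ℕ → ℂ} {a₀ : ℂ} (ha₀ : a₀ ∈ U) (ha : Tendsto a atTop (𝓝 a₀)) {x : ℂ} (hx : x ∈ U) :
    Tendsto (fun q : ℕ × ℂ => dslope (F q.1) (a q.1) q.2) (atTop ×ˢ 𝓝 x)
      (𝓝 (dslope f a₀ x)) := by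
  have haq : Tendsto (fun q : ℕ × ℂ => a q.1) (atTop ×ˢ 𝓝 x) (𝓝 a₀) := ha.comp tendsto_fst
  by_cases hxa : x = a₀
  · -- near the base point, the mean value inequality compares difference quotients and derivatives
    subst hxa
    rw [dslope_same]
    have hd := tendsto_deriv_of_continuous_convergence hU hF hf h hx
    rw [Metric.tendsto_nhds]
    intro ε hε
    obtain ⟨s, hs, t, ht, hst⟩ := eventually_prod_iff.1
      (Metric.tendsto_nhds.1 hd (ε / 2) (half_pos hε))
    obtain ⟨ρ, hρ, hball⟩ := Metric.mem_nhds_iff.1 (inter_mem ht (hU.mem_nhds hx))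
    have e1 : ∀ᶠ q : ℕ × ℂ in atTop ×ˢ 𝓝 x, q.2 ∈ Metric.ball x ρ :=
      tendsto_snd (Metric.ball_mem_nhds x hρ)
    have e2 : ∀ᶠ q : ℕ × ℂ in atTop ×ˢ 𝓝 x, a q.1 ∈ Metric.ball x ρ :=
      haq (Metric.ball_mem_nhds x hρ)
    have e3 : ∀ᶠ q : ℕ × ℂ in atTop ×ˢ 𝓝 x, s q.1 := hs.prod_inl _
    filter_upwards [e1, e2, e3] with q hq1 hq2 hq3
    have hder : ∀ w ∈ Metric.ball x ρ, dist (deriv (F q.1) w) (deriv f x) < ε / 2 := fun w hw =>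
      hst hq3 (hball hw).1
    by_cases hqa : q.2 = a q.1
    · rw [hqa, dslope_same]
      exact (hder _ hq2).trans (half_lt_self hε)
    · have hmv := Convex.norm_image_sub_le_of_norm_hasDerivWithin_le
        (f := fun w => F q.1 w - deriv f x * w) (f' := fun w => deriv (F q.1) w - deriv f x)
        (C := ε / 2) (s := Metric.ball x ρ) (fun w hw => by
          have h1 : HasDerivAt (F q.1) (deriv (F q.1) w) w :=
            ((hF q.1).differentiableAt (hU.mem_nhds (hball hw).2)).hasDerivAt
          have h2 : HasDerivAt (fun w => deriv f x * w) (deriv f x) w := by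
            simpa using (hasDerivAt_id w).const_mul (deriv f x)
          exact (h1.sub h2).hasDerivWithinAt)
        (fun w hw => by rw [← dist_eq_norm]; exact (hder w hw).le)
        (convex_ball x ρ) hq2 hq1
      have hne : q.2 - a q.1 ≠ 0 := sub_ne_zero.2 hqa
      rw [dslope_of_ne _ hqa, slope_def_field, dist_eq_norm,
        show (F q.1 q.2 - F q.1 (a q.1)) / (q.2 - a q.1) - deriv f x =
          (F q.1 q.2 - deriv f x * q.2 - (F q.1 (a q.1) - deriv f x * a q.1)) / (q.2 - a q.1) by
          field_simp; ring,
        norm_div, div_lt_iff₀ (norm_pos_iff.2 hne)]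
      have := norm_pos_iff.2 hne
      nlinarith
  · rw [dslope_of_ne _ hxa, slope_def_field]
    have hFa : Tendsto (fun q : ℕ × ℂ => F q.1 (a q.1)) (atTop ×ˢ 𝓝 x) (𝓝 (f a₀)) :=
      ((h a₀ ha₀).comp (tendsto_id.prodMk ha)).comp tendsto_fst
    have hsnd : Tendsto (fun q : ℕ × ℂ => q.2) (atTop ×ˢ 𝓝 x) (𝓝 x) := tendsto_snd
    have hlim := ((h x hx).sub hFa).div (hsnd.sub haq) (sub_ne_zero.2 hxa)
    refine hlim.congr' ?_
    filter_upwards [(hsnd.sub haq).eventually_ne (sub_ne_zero.2 hxa)] with q hq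
    rw [dslope_of_ne _ (sub_ne_zero.1 hq), slope_def_field]
    rfl

theorem ZeroChain.limit {U I : Set ℂ} (hU : IsOpen U) (hI : I ⊆ U) (hIc : IsCompact I) {N : ℕ} :
    ∀ {F : ℕ → ℂ → ℂ} {f : ℂ → ℂ}, (∀ i, DifferentiableOn ℂ (F i) U) → DifferentiableOn ℂ f U →
    (∀ x ∈ U, Tendsto (fun q : ℕ × ℂ => F q.1 q.2) (atTop ×ˢ 𝓝 x) (𝓝 (f x))) →
    (∀ i, ZeroChain I N (F i)) → ZeroChain I N f := by
  induction N with
  | zero => exact fun _ _ _ _ => trivial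
  | succ N ih =>
    intro F f hF hf hlim hZ
    choose a haI ha0 hch using hZ
    obtain ⟨a₀, ha₀, φ, hφ, hφa⟩ := hIc.tendsto_subseq haI
    have hlim' : ∀ x ∈ U, Tendsto (fun q : ℕ × ℂ => F (φ q.1) q.2) (atTop ×ˢ 𝓝 x) (𝓝 (f x)) :=
      fun x hx => (hlim x hx).comp
        ((hφ.tendsto_atTop.comp tendsto_fst).prodMk tendsto_snd)
    refine ⟨a₀, ha₀, ?_, ih (F := fun i => dslope (F (φ i)) (a (φ i))) (fun i => ?_) ?_ ?_
      fun i => hch (φ i)⟩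
    · have h1 := (hlim' a₀ (hI ha₀)).comp (tendsto_id.prodMk hφa)
      refine tendsto_nhds_unique h1 (tendsto_const_nhds.congr fun i => ?_)
      exact (ha0 (φ i)).symm
    · exact (Complex.differentiableOn_dslope (hU.mem_nhds (hI (haI _)))).2 (hF _)
    · exact (Complex.differentiableOn_dslope (hU.mem_nhds (hI ha₀))).2 hf
    · exact fun x hx => tendsto_dslope_of_continuous_convergence hU (fun i => hF (φ i)) hf hlim'
        (hI ha₀) hφa hx

/-- A form of Hurwitz's theorem: the number of zeros in a compact set, counted with multiplicity,
does not increase under small holomorphic perturbations. -/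
theorem eventually_not_hasZeros {ι : Type*} {l : Filter ι} [l.IsCountablyGenerated] {U I : Set ℂ}
    (hU : IsOpen U) (hI : I ⊆ U) (hIc : IsCompact I) {F : ι → ℂ → ℂ} {f : ℂ → ℂ}
    (hF : ∀ᶠ i in l, DifferentiableOn ℂ (F i) U) (hf : DifferentiableOn ℂ f U)
    (hlim : ∀ x ∈ U, Tendsto (fun q : ι × ℂ => F q.1 q.2) (l ×ˢ 𝓝 x) (𝓝 (f x))) {N : ℕ}
    (hN : ¬ HasZeros f I N) : ∀ᶠ i in l, ¬ HasZeros (F i) I N := by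
  by_contra hc
  have hfr : ∃ᶠ i in l, HasZeros (F i) I N ∧ DifferentiableOn ℂ (F i) U := by
    rw [not_eventually] at hc
    exact (hc.and_eventually hF).mono fun i hi => ⟨not_not.1 hi.1, hi.2⟩
  obtain ⟨u, hu, hprop⟩ := exists_seq_forall_of_frequently hfr
  refine hN (ZeroChain.hasZeros hU hI hf (ZeroChain.limit hU hI hIc (F := fun i => F (u i))
    (fun i => (hprop i).2) hf (fun x hx => ?_)
    fun i => (hprop i).1.zeroChain hU hI (hprop i).2))
  exact (hlim x hx).comp ((hu.comp tendsto_fst).prodMk tendsto_snd)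

end Hurwitz

/-! ### Holomorphic dependence on the initial value, by Picard iteration -/

section HolomorphicIntegral

open Set Filter MeasureTheory

/-- A parametric integral of bounded functions that are holomorphic in the parameter is holomorphic;
the derivatives are dominated by Cauchy's estimate. -/
theorem differentiableOn_intervalIntegral {φ : ℝ → ℂ → ℂ} {V : Set ℂ} (hV : IsOpen V) {c C : ℝ}
    (hc : ∀ z ∈ V, Continuous fun t => φ t z) (hd : ∀ t, DifferentiableOn ℂ (φ t) V)
    (hC : ∀ t ∈ uIcc 0 c, ∀ z ∈ V, ‖φ t z‖ ≤ C) :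
    DifferentiableOn ℂ (fun z => ∫ t in (0 : ℝ)..c, φ t z) V := by
  intro z hz
  obtain ⟨ρ, hρ, hball⟩ := Metric.isOpen_iff.1 hV z hz
  have hmeas : AEStronglyMeasurable (fun t => deriv (φ t) z) (volume.restrict (uIoc 0 c)) := by
    -- the derivative is a pointwise limit of continuous difference quotients
    have hlim : ∀ t, Tendsto (fun n : ℕ => slope (φ t) z (z + (ρ / (n + 2) : ℝ))) atTop
        (𝓝 (deriv (φ t) z)) := fun t => by
      have h1 := ((hd t).differentiableAt (hV.mem_nhds hz)).hasDerivAt.tendsto_slope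
      refine h1.comp (tendsto_nhdsWithin_iff.2 ⟨?_, Eventually.of_forall fun n => ?_⟩)
      · have h2 : Tendsto (fun n : ℕ => (ρ / (n + 2) : ℝ)) atTop (𝓝 0) := by
          refine tendsto_const_nhds.div_atTop ?_
          exact tendsto_atTop_add_const_right _ _ tendsto_natCast_atTop_atTop
        have h3 : Tendsto (fun n : ℕ => z + ((ρ / (n + 2) : ℝ) : ℂ)) atTop (𝓝 (z + (0 : ℝ))) :=
          tendsto_const_nhds.add ((Complex.continuous_ofReal.tendsto 0).comp h2)
        simpa using h3
      · have : ((ρ / (n + 2) : ℝ) : ℂ) ≠ 0 := by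
          rw [Complex.ofReal_ne_zero]; positivity
        simpa using this
    refine aestronglyMeasurable_of_tendsto_ae atTop (fun n => ?_)
      (Eventually.of_forall fun t => hlim t)
    refine Continuous.aestronglyMeasurable ?_
    have hmem : z + ((ρ / (n + 2) : ℝ) : ℂ) ∈ V := by
      apply hball
      rw [Metric.mem_ball, dist_eq_norm, add_sub_cancel_left, Complex.norm_real,
        Real.norm_of_nonneg (by positivity), div_lt_iff₀ (by positivity)]
      have : (0 : ℝ) ≤ n := Nat.cast_nonneg n
      nlinarith
    simp only [slope_def_field]
    exact ((hc _ hmem).sub (hc z hz)).div_const _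
  have h := intervalIntegral.hasDerivAt_integral_of_dominated_loc_of_deriv_le
    (F := fun z t => φ t z) (F' := fun z t => deriv (φ t) z) (x₀ := z)
    (s := Metric.ball z (ρ / 2)) (bound := fun _ => C / (ρ / 2)) (μ := volume) (a := 0) (b := c)
    (Metric.ball_mem_nhds z (half_pos hρ))
    (by filter_upwards [hV.mem_nhds hz] with w hw using (hc w hw).aestronglyMeasurable)
    ((hc z hz).intervalIntegrable _ _) hmeas
    (Eventually.of_forall fun t ht w hw => by
      have hsub : Metric.closedBall w (ρ / 2) ⊆ V := fun y hy => hball (by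
        rw [Metric.mem_ball, Metric.mem_closedBall] at *
        linarith [dist_triangle y w z])
      exact Complex.norm_deriv_le_of_forall_mem_sphere_norm_le (half_pos hρ)
        (((hd t).mono hsub).diffContOnCl_ball (by exact subset_rfl))
        fun y hy => hC t (uIoc_subset_uIcc ht) y (hsub (Metric.sphere_subset_closedBall hy)))
    intervalIntegrable_const
    (Eventually.of_forall fun t _ w hw => ((hd t).differentiableAt (hV.mem_nhds (hball
      (Metric.ball_subset_ball (by linarith) hw)))).hasDerivAt)
  exact h.2.differentiableAt.differentiableWithinAt

end HolomorphicIntegral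

section Picard

open Set Filter MeasureTheory

/-- The projection of the angle to the window `[-14, 14]`, which contains two full turns in each
direction. -/
noncomputable def clampAngle (θ : ℝ) : ℝ := max (-14) (min 14 θ)

theorem continuous_clampAngle : Continuous clampAngle :=
  continuous_const.max (continuous_const.min continuous_id)

theorem clampAngle_mem (θ : ℝ) : clampAngle θ ∈ Icc (-14 : ℝ) 14 :=
  ⟨le_max_left _ _, max_le (by norm_num) (min_le_left _ _)⟩

theorem clampAngle_of_mem {θ : ℝ} (h : θ ∈ Icc (-14 : ℝ) 14) : clampAngle θ = θ := by
  rw [clampAngle, min_eq_right h.2, max_eq_right h.1]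

theorem uIcc_clampAngle_subset (θ : ℝ) : uIcc 0 (clampAngle θ) ⊆ Icc (-14 : ℝ) 14 :=
  uIcc_subset_Icc (by norm_num) (clampAngle_mem θ)

theorem norm_integral_clampAngle_le {f : ℝ → ℂ} {C : ℝ} (h : ∀ t ∈ Icc (-14 : ℝ) 14, ‖f t‖ ≤ C)
    (θ : ℝ) : ‖∫ t in (0 : ℝ)..clampAngle θ, f t‖ ≤ 14 * C := by
  have hC : 0 ≤ C := (norm_nonneg _).trans (h 0 (by norm_num))
  refine (intervalIntegral.norm_integral_le_of_norm_le_const (C := C) fun t ht =>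
    h t (uIcc_clampAngle_subset θ (uIoc_subset_uIcc ht))).trans ?_
  rw [sub_zero, mul_comm]
  exact mul_le_mul_of_nonneg_right (abs_le.2 (clampAngle_mem θ)) hC

/-- The Picard iterates of `dR/dθ = ε G(θ, R)`, `R(0) = z`, frozen outside the angular window. -/
noncomputable def picardIter (ε : ℝ) (G : ℝ → ℂ → ℂ) : ℕ → ℝ → ℂ → ℂ
  | 0, _, z => z
  | k + 1, θ, z => z + ε * ∫ t in (0 : ℝ)..clampAngle θ, G t (picardIter ε G k t z)

/-- The hypotheses on the right-hand side that make Picard iteration converge: `G` is continuous,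
holomorphic in the second variable, bounded by `C` and `L`-Lipschitz on the `2 δ`-neighbourhood of
the compact set `I`, and `ε` is small. -/
structure PicardData (I : Set ℂ) (δ C L ε : ℝ) (G : ℝ → ℂ → ℂ) : Prop where
  pos : 0 < δ
  cont : ContinuousOn (Function.uncurry G) (univ ×ˢ Metric.thickening (2 * δ) I)
  diff : ∀ θ, DifferentiableOn ℂ (G θ) (Metric.thickening (2 * δ) I)
  bound : ∀ θ ∈ Icc (-14 : ℝ) 14, ∀ z ∈ Metric.thickening (2 * δ) I, ‖G θ z‖ ≤ C
  lip : ∀ θ ∈ Icc (-14 : ℝ) 14, ∀ z ∈ Metric.thickening (2 * δ) I,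
    ∀ w ∈ Metric.thickening (2 * δ) I, ‖G θ z - G θ w‖ ≤ L * ‖z - w‖
  Lnonneg : 0 ≤ L
  small : |ε| * (14 * C) ≤ δ
  small' : |ε| * (14 * L) ≤ 1 / 2

namespace PicardData

variable {I : Set ℂ} {δ C L ε : ℝ} {G : ℝ → ℂ → ℂ}

theorem mem_of_norm_sub_le {δ : ℝ} {z w : ℂ} (hz : z ∈ Metric.thickening δ I)
    (h : ‖w - z‖ ≤ δ) : w ∈ Metric.thickening (2 * δ) I := by
  obtain ⟨y, hy, hzy⟩ := Metric.mem_thickening_iff.1 hz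
  refine Metric.mem_thickening_iff.2 ⟨y, hy, ?_⟩
  rw [← dist_eq_norm] at h
  linarith [dist_triangle w z y]

theorem continuous_comp (hG : PicardData I δ C L ε G) {R : ℝ → ℂ} (hR : Continuous R)
    (hR2 : ∀ θ, R θ ∈ Metric.thickening (2 * δ) I) : Continuous fun t => G t (R t) :=
  hG.cont.comp_continuous (continuous_id.prodMk hR) fun t => ⟨trivial, hR2 t⟩

theorem iter_spec (hG : PicardData I δ C L ε G) (k : ℕ) :
    (∀ z ∈ Metric.thickening δ I, Continuous fun θ => picardIter ε G k θ z) ∧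
    (∀ z ∈ Metric.thickening δ I, ∀ θ, ‖picardIter ε G k θ z - z‖ ≤ |ε| * (14 * C)) ∧
    (∀ θ, DifferentiableOn ℂ (picardIter ε G k θ) (Metric.thickening δ I)) := by
  induction k with
  | zero =>
    refine ⟨fun z _ => continuous_const, fun z hz θ => ?_, fun θ => differentiableOn_id⟩
    obtain ⟨y, hy, -⟩ := Metric.mem_thickening_iff.1 hz
    have hC : 0 ≤ C := (norm_nonneg _).trans (hG.bound 0 (by norm_num) y
      (Metric.self_subset_thickening (by linarith [hG.pos]) I hy))
    simp only [picardIter, sub_self, norm_zero]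
    positivity
  | succ k ih =>
    obtain ⟨ih1, ih2, ih3⟩ := ih
    have hmem : ∀ z ∈ Metric.thickening δ I, ∀ θ,
        picardIter ε G k θ z ∈ Metric.thickening (2 * δ) I := fun z hz θ =>
      mem_of_norm_sub_le hz ((ih2 z hz θ).trans hG.small)
    have hcont : ∀ z ∈ Metric.thickening δ I, Continuous fun t => G t (picardIter ε G k t z) :=
      fun z hz => hG.continuous_comp (ih1 z hz) (hmem z hz)
    refine ⟨fun z hz => ?_, fun z hz θ => ?_, fun θ => ?_⟩
    · simp only [picardIter]
      refine continuous_const.add (continuous_const.mul ?_)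
      exact (intervalIntegral.continuous_primitive
        (fun a b => (hcont z hz).intervalIntegrable a b) 0).comp continuous_clampAngle
    · simp only [picardIter, add_sub_cancel_left]
      rw [norm_mul, Complex.norm_real, Real.norm_eq_abs]
      exact mul_le_mul_of_nonneg_left
        (norm_integral_clampAngle_le (fun t ht => hG.bound t ht _ (hmem z hz t)) θ) (abs_nonneg ε)
    · simp only [picardIter]
      refine differentiableOn_id.add ((differentiableOn_const _).mul ?_)
      exact differentiableOn_intervalIntegral Metric.isOpen_thickening hcont
        (fun t => (hG.diff t).comp (ih3 t) fun z hz => hmem z hz t)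
        (fun t ht z hz => hG.bound t (uIcc_clampAngle_subset θ ht) _ (hmem z hz t))

theorem iter_mem (hG : PicardData I δ C L ε G) (k : ℕ) {z : ℂ} (hz : z ∈ Metric.thickening δ I)
    (θ : ℝ) : picardIter ε G k θ z ∈ Metric.thickening (2 * δ) I :=
  mem_of_norm_sub_le hz (((hG.iter_spec k).2.1 z hz θ).trans hG.small)

/-- Comparison of the right-hand sides of the integral equation along two curves. -/
theorem norm_integral_sub_le (hG : PicardData I δ C L ε G) {R S : ℝ → ℂ} (hR : Continuous R)
    (hS : Continuous S) (hR2 : ∀ θ, R θ ∈ Metric.thickening (2 * δ) I)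
    (hS2 : ∀ θ, S θ ∈ Metric.thickening (2 * δ) I) {m : ℝ} (hm : ∀ θ, ‖R θ - S θ‖ ≤ m) (θ : ℝ) :
    ‖(ε : ℂ) * (∫ t in (0 : ℝ)..clampAngle θ, G t (R t)) -
      ε * ∫ t in (0 : ℝ)..clampAngle θ, G t (S t)‖ ≤ |ε| * (14 * L) * m := by
  rw [← mul_sub, ← intervalIntegral.integral_sub
    ((hG.continuous_comp hR hR2).intervalIntegrable _ _)
    ((hG.continuous_comp hS hS2).intervalIntegrable _ _), norm_mul, Complex.norm_real,
    Real.norm_eq_abs, mul_assoc, mul_assoc]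
  refine mul_le_mul_of_nonneg_left ?_ (abs_nonneg ε)
  exact norm_integral_clampAngle_le (fun t ht => (hG.lip t ht _ (hR2 t) _ (hS2 t)).trans
    (mul_le_mul_of_nonneg_left (hm t) hG.Lnonneg)) θ

theorem iter_dist (hG : PicardData I δ C L ε G) (k : ℕ) {z : ℂ} (hz : z ∈ Metric.thickening δ I) :
    ∀ θ, dist (picardIter ε G k θ z) (picardIter ε G (k + 1) θ z) ≤ δ * (1 / 2) ^ k := by
  induction k with
  | zero =>
    intro θ
    rw [dist_comm, dist_eq_norm, pow_zero, mul_one]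
    exact ((hG.iter_spec 1).2.1 z hz θ).trans hG.small
  | succ k ih =>
    intro θ
    rw [dist_eq_norm]
    have h := hG.norm_integral_sub_le ((hG.iter_spec k).1 z hz) ((hG.iter_spec (k + 1)).1 z hz)
      (hG.iter_mem k hz) (hG.iter_mem (k + 1) hz)
      (fun θ => by rw [← dist_eq_norm]; exact ih θ) θ
    have h1 : picardIter ε G (k + 1) θ z - picardIter ε G (k + 1 + 1) θ z =
        ε * (∫ t in (0 : ℝ)..clampAngle θ, G t (picardIter ε G k t z)) -
        ε * ∫ t in (0 : ℝ)..clampAngle θ, G t (picardIter ε G (k + 1) t z) := by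
      rw [picardIter, picardIter, add_sub_add_left_eq_sub]
    rw [h1]
    refine h.trans ?_
    have h2 := mul_le_mul_of_nonneg_right hG.small'
      (show 0 ≤ δ * (1 / 2) ^ k by have := hG.pos; positivity)
    refine h2.trans_eq ?_
    ring

theorem iter_im (hG : PicardData I δ C L ε G) (k : ℕ)
    (hreal : ∀ (θ x : ℝ), (x : ℂ) ∈ Metric.thickening (2 * δ) I → (G θ x).im = 0) {x : ℝ}
    (hx : (x : ℂ) ∈ Metric.thickening δ I) (θ : ℝ) : (picardIter ε G k θ x).im = 0 := by
  induction k generalizing θ with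
  | zero => simp [picardIter]
  | succ k ih =>
    have h : ∀ t, G t (picardIter ε G k t x) =
        (((G t (picardIter ε G k t x)).re : ℝ) : ℂ) := fun t => by
      have h1 : picardIter ε G k t x = (((picardIter ε G k t x).re : ℝ) : ℂ) :=
        Complex.ext (by simp) (by simp [ih t])
      have h2 := hreal t (picardIter ε G k t x).re (by rw [← h1]; exact hG.iter_mem k hx t)
      rw [← h1] at h2
      exact Complex.ext rfl (h2.trans (Complex.ofReal_im _).symm)
    rw [picardIter, intervalIntegral.integral_congr (fun t _ => h t),
      intervalIntegral.integral_ofReal, ← Complex.ofReal_mul, ← Complex.ofReal_add,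
      Complex.ofReal_im]

/-- The solution of `dR/dθ = ε G(θ, R)`, `R(0) = z`, in the angular window, for initial values in a
complex neighbourhood of `I`. -/
theorem exists_solution (hG : PicardData I δ C L ε G)
    (hreal : ∀ (θ x : ℝ), (x : ℂ) ∈ Metric.thickening (2 * δ) I → (G θ x).im = 0) :
    ∃ R : ℝ → ℂ → ℂ,
      (∀ z ∈ Metric.thickening δ I, Continuous fun θ => R θ z) ∧
      (∀ z ∈ Metric.thickening δ I, ∀ θ, ‖R θ z - z‖ ≤ |ε| * (14 * C)) ∧
      (∀ θ, DifferentiableOn ℂ (R θ) (Metric.thickening δ I)) ∧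
      (∀ z ∈ Metric.thickening δ I, ∀ θ,
        R θ z = z + ε * ∫ t in (0 : ℝ)..clampAngle θ, G t (R t z)) ∧
      (∀ x : ℝ, (x : ℂ) ∈ Metric.thickening δ I → ∀ θ, (R θ x).im = 0) := by
  have hlim : ∀ z ∈ Metric.thickening δ I, ∀ θ, ∃ y,
      Tendsto (fun k => picardIter ε G k θ z) atTop (𝓝 y) := fun z hz θ =>
    cauchySeq_tendsto_of_complete (cauchySeq_of_le_geometric (1 / 2) δ (by norm_num)
      fun k => hG.iter_dist k hz θ)
  choose! R hR using fun θ z (hz : z ∈ Metric.thickening δ I) => hlim z hz θ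
  have hdist : ∀ z ∈ Metric.thickening δ I, ∀ θ k,
      dist (picardIter ε G k θ z) (R θ z) ≤ 2 * δ * (1 / 2) ^ k := fun z hz θ k => by
    have := dist_le_of_le_geometric_of_tendsto (1 / 2) δ (by norm_num)
      (fun k => hG.iter_dist k hz θ) (hR θ z hz) k
    refine this.trans_eq ?_
    ring
  have hto0 : Tendsto (fun k : ℕ => 2 * δ * (1 / 2 : ℝ) ^ k) atTop (𝓝 0) := by
    simpa using (tendsto_pow_atTop_nhds_zero_of_lt_one (r := (1 / 2 : ℝ)) (by norm_num)
      (by norm_num)).const_mul (2 * δ)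
  have hunif : ∀ z ∈ Metric.thickening δ I,
      TendstoUniformly (fun k θ => picardIter ε G k θ z) (fun θ => R θ z) atTop := fun z hz => by
    rw [Metric.tendstoUniformly_iff]
    intro η hη
    filter_upwards [hto0.eventually (gt_mem_nhds hη)] with k hk θ
    rw [dist_comm]
    exact (hdist z hz θ k).trans_lt hk
  have hcont : ∀ z ∈ Metric.thickening δ I, Continuous fun θ => R θ z := fun z hz =>
    (hunif z hz).continuous (Frequently.of_forall fun k => (hG.iter_spec k).1 z hz)
  have hbound : ∀ z ∈ Metric.thickening δ I, ∀ θ, ‖R θ z - z‖ ≤ |ε| * (14 * C) := fun z hz θ =>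
    le_of_tendsto ((hR θ z hz).sub_const z).norm
      (Eventually.of_forall fun k => (hG.iter_spec k).2.1 z hz θ)
  have hmem : ∀ z ∈ Metric.thickening δ I, ∀ θ, R θ z ∈ Metric.thickening (2 * δ) I :=
    fun z hz θ => mem_of_norm_sub_le hz ((hbound z hz θ).trans hG.small)
  refine ⟨R, hcont, hbound, fun θ => ?_, fun z hz θ => ?_, fun x hx θ => ?_⟩
  · have hloc : TendstoLocallyUniformlyOn (fun k => picardIter ε G k θ) (R θ) atTop
        (Metric.thickening δ I) := by
      refine TendstoUniformlyOn.tendstoLocallyUniformlyOn ?_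
      rw [Metric.tendstoUniformlyOn_iff]
      intro η hη
      filter_upwards [hto0.eventually (gt_mem_nhds hη)] with k hk z hz
      rw [dist_comm]
      exact (hdist z hz θ k).trans_lt hk
    exact hloc.differentiableOn (Eventually.of_forall fun k => (hG.iter_spec k).2.2 θ)
      Metric.isOpen_thickening
  · refine tendsto_nhds_unique ((tendsto_add_atTop_iff_nat 1).2 (hR θ z hz)) ?_
    simp only [picardIter]
    refine tendsto_const_nhds.add ?_
    rw [tendsto_iff_norm_sub_tendsto_zero]
    have hto := hto0.const_mul (|ε| * (14 * L))
    rw [mul_zero] at hto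
    refine squeeze_zero (fun _ => norm_nonneg _) (fun k => ?_) hto
    exact hG.norm_integral_sub_le ((hG.iter_spec k).1 z hz) (hcont z hz) (hG.iter_mem k hz)
      (hmem z hz) (fun θ => by rw [← dist_eq_norm]; exact hdist z hz θ k) θ
  · refine tendsto_nhds_unique (((Complex.continuous_im.tendsto _).comp (hR θ x hx))) ?_
    exact tendsto_const_nhds.congr fun k => (hG.iter_im k hreal hx θ).symm

/-- Dependence of a solution on its initial value. -/
theorem solution_lipschitz (hG : PicardData I δ C L ε G) {R : ℝ → ℂ → ℂ}
    (hcont : ∀ z ∈ Metric.thickening δ I, Continuous fun θ => R θ z)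
    (hbound : ∀ z ∈ Metric.thickening δ I, ∀ θ, ‖R θ z - z‖ ≤ |ε| * (14 * C))
    (heq : ∀ z ∈ Metric.thickening δ I, ∀ θ,
        R θ z = z + ε * ∫ t in (0 : ℝ)..clampAngle θ, G t (R t z))
    {z w : ℂ} (hz : z ∈ Metric.thickening δ I) (hw : w ∈ Metric.thickening δ I) (θ : ℝ) :
    ‖R θ z - R θ w‖ ≤ 2 * ‖z - w‖ ∧ ‖(R θ z - R θ w) - (z - w)‖ ≤ ‖z - w‖ := by
  have hmem : ∀ z ∈ Metric.thickening δ I, ∀ θ, R θ z ∈ Metric.thickening (2 * δ) I :=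
    fun z hz θ => mem_of_norm_sub_le hz ((hbound z hz θ).trans hG.small)
  have hsub : ∀ m, (∀ θ, ‖R θ z - R θ w‖ ≤ m) →
      ∀ θ, ‖(R θ z - R θ w) - (z - w)‖ ≤ m / 2 := fun m hm θ => by
    have h := hG.norm_integral_sub_le (hcont z hz) (hcont w hw) (hmem z hz) (hmem w hw) hm θ
    rw [heq z hz θ, heq w hw θ]
    have hm0 : 0 ≤ m := (norm_nonneg _).trans (hm 0)
    have h2 := mul_le_mul_of_nonneg_right hG.small' hm0
    refine le_trans ?_ (h.trans (h2.trans_eq (by ring)))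
    refine le_of_eq (congrArg _ ?_)
    ring
  have hiter : ∀ k : ℕ, ∀ θ, ‖R θ z - R θ w‖ ≤ 2 * ‖z - w‖ + 2 * δ * (1 / 2) ^ k := fun k => by
    induction k with
    | zero =>
      intro θ
      have h1 := (hbound z hz θ).trans hG.small
      have h2 := (hbound w hw θ).trans hG.small
      have h3 : R θ z - R θ w = (R θ z - z) - (R θ w - w) + (z - w) := by ring
      have h4 := (norm_add_le ((R θ z - z) - (R θ w - w)) (z - w))
      have h5 := norm_sub_le (R θ z - z) (R θ w - w)
      rw [h3, pow_zero]
      linarith [norm_nonneg (z - w)]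
    | succ k ih =>
      intro θ
      have h1 := hsub _ ih θ
      have h2 := norm_add_le ((R θ z - R θ w) - (z - w)) (z - w)
      rw [sub_add_cancel] at h2
      rw [pow_succ]
      linarith
  have hfin : ∀ θ, ‖R θ z - R θ w‖ ≤ 2 * ‖z - w‖ := fun θ => by
    refine ge_of_tendsto (x := (atTop : Filter ℕ)) ?_ (Eventually.of_forall fun k => hiter k θ)
    simpa using ((tendsto_pow_atTop_nhds_zero_of_lt_one (r := (1 / 2 : ℝ)) (by norm_num)
      (by norm_num)).const_mul (2 * δ)).const_add (2 * ‖z - w‖)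
  refine ⟨hfin θ, ?_⟩
  have h := hsub _ hfin θ
  linarith

end PicardData

end Picard

/-! ### The displacement function to first order -/

section Averaging

open Set Filter MeasureTheory

/-- A two-variable function, continuous and periodic in the angle, is bounded near a compact
set. -/
theorem exists_bound_of_periodic {I W : Set ℂ} (hI : IsCompact I) {N : ℝ → ℂ → ℂ}
    (hIW : I ⊆ W) (hcont : ContinuousOn (Function.uncurry N) (univ ×ˢ W))
    (hper : ∀ z, Function.Periodic (fun θ => N θ z) (2 * Real.pi)) :
    ∃ C, ∀ θ, ∀ z ∈ I, ‖N θ z‖ ≤ C := by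
  obtain ⟨C, hC⟩ :=
    ((isCompact_Icc (a := (0 : ℝ)) (b := 2 * Real.pi)).prod hI).exists_bound_of_continuousOn
    (hcont.mono (prod_mono (subset_univ _) hIW))
  refine ⟨C, fun θ z hz => ?_⟩
  obtain ⟨t, ht, hNt⟩ := (hper z).exists_mem_Ico₀ Real.two_pi_pos θ
  have := hC (t, z) ⟨Ico_subset_Icc_self ht, hz⟩
  rw [hNt]
  exact this

/-- The function `R ε θ z` is the solution at the angle `θ` of
`dR/dθ = ε N(θ, R) / (s + ε D(θ, R))`, `R(0) = z`, for `|ε| < ε₁` and for initial values `z` at distance less than `δ` from `I`. It is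
frozen outside the window of `clampAngle`. The field `limit` is the first order term in `ε` of the
displacement over a full turn. -/
structure IsSolutionFamily (I : Set ℂ) (δ ε₁ s : ℝ) (N D : ℝ → ℂ → ℂ) (R : ℝ → ℝ → ℂ → ℂ) :
    Prop where
  cont : ∀ ε, |ε| < ε₁ → ∀ z ∈ Metric.thickening δ I, Continuous fun θ => R ε θ z
  mem : ∀ ε, |ε| < ε₁ → ∀ z ∈ Metric.thickening δ I, ∀ θ,
    R ε θ z ∈ Metric.thickening (2 * δ) I
  diff : ∀ ε, |ε| < ε₁ → ∀ θ, DifferentiableOn ℂ (R ε θ) (Metric.thickening δ I)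
  eqn : ∀ ε, |ε| < ε₁ → ∀ z ∈ Metric.thickening δ I, ∀ θ, R ε θ z =
    z + ε * ∫ t in (0 : ℝ)..clampAngle θ, N t (R ε t z) / (s + ε * D t (R ε t z))
  im : ∀ ε, |ε| < ε₁ → ∀ x : ℝ, (x : ℂ) ∈ Metric.thickening δ I → ∀ θ, (R ε θ x).im = 0
  lip : ∀ ε, |ε| < ε₁ → ∀ z ∈ Metric.thickening δ I, ∀ w ∈ Metric.thickening δ I, ∀ θ,
    ‖R ε θ z - R ε θ w‖ ≤ 2 * ‖z - w‖ ∧ ‖(R ε θ z - R ε θ w) - (z - w)‖ ≤ ‖z - w‖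
  denom : ∀ ε, |ε| < ε₁ → ∀ θ, ∀ z ∈ Metric.thickening (2 * δ) I, ‖(ε : ℂ) * D θ z‖ ≤ s / 2
  limit : ∀ z ∈ Metric.thickening δ I,
    Tendsto (fun q : ℝ × ℂ => (R q.1 (2 * Real.pi) q.2 - q.2) / q.1) (𝓝[≠] 0 ×ˢ 𝓝 z)
      (𝓝 (∫ t in (0 : ℝ)..(2 * Real.pi), N t z / s))

theorem exists_isSolutionFamily {I W : Set ℂ} (hI : IsCompact I) (hconv : Convex ℝ I)
    (hne : I.Nonempty)
    (hW : IsOpen W) (hIW : I ⊆ W) {N D : ℝ → ℂ → ℂ} {s : ℝ} (hs : 0 < s)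
    (hN : ContinuousOn (Function.uncurry N) (univ ×ˢ W))
    (hD : ContinuousOn (Function.uncurry D) (univ ×ˢ W))
    (hNd : ∀ θ, DifferentiableOn ℂ (N θ) W) (hDd : ∀ θ, DifferentiableOn ℂ (D θ) W)
    (hNp : ∀ z, Function.Periodic (fun θ => N θ z) (2 * Real.pi))
    (hDp : ∀ z, Function.Periodic (fun θ => D θ z) (2 * Real.pi))
    (hNr : ∀ θ x : ℝ, (x : ℂ) ∈ W → (N θ x).im = 0)
    (hDr : ∀ θ x : ℝ, (x : ℂ) ∈ W → (D θ x).im = 0) :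
    ∃ δ > 0, ∃ ε₁ > 0, ∃ R, Metric.thickening (2 * δ) I ⊆ W ∧
      IsSolutionFamily I δ ε₁ s N D R := by
  obtain ⟨η, hη, hηW⟩ := hI.exists_cthickening_subset_open hW hIW
  set δ := η / 3 with hδ
  have hδ0 : 0 < δ := by positivity
  have hK : IsCompact (Metric.cthickening η I) := hI.cthickening
  obtain ⟨C₁, hC₁⟩ := exists_bound_of_periodic hK hηW hN hNp
  obtain ⟨C₂, hC₂⟩ := exists_bound_of_periodic hK hηW hD hDp
  have h3 : Metric.thickening (3 * δ) I ⊆ Metric.cthickening η I := by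
    rw [hδ, mul_div_cancel₀ _ (by norm_num : (3 : ℝ) ≠ 0)]
    exact Metric.thickening_subset_cthickening _ _
  have h23 : Metric.thickening (2 * δ) I ⊆ Metric.thickening (3 * δ) I :=
    Metric.thickening_mono (by linarith) _
  obtain ⟨z₀, hz₀⟩ := hne
  have hz₀' : z₀ ∈ Metric.cthickening η I := Metric.self_subset_cthickening _ hz₀
  have hC₁0 : 0 ≤ C₁ := (norm_nonneg _).trans (hC₁ 0 z₀ hz₀')
  have hC₂0 : 0 ≤ C₂ := (norm_nonneg _).trans (hC₂ 0 z₀ hz₀')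
  set C := C₁ / (s / 2) with hC
  have hC0 : 0 ≤ C := by positivity
  set L := C / δ with hL
  have hL0 : 0 ≤ L := by positivity
  set G : ℝ → ℝ → ℂ → ℂ := fun ε θ z => N θ z / (s + ε * D θ z) with hG
  obtain ⟨ε₁, hε₁, hsm1, hsm2, hsm3⟩ : ∃ ε₁ > 0, ε₁ * C₂ ≤ s / 2 ∧ ε₁ * (14 * C) ≤ δ ∧
      ε₁ * (14 * L) ≤ 1 / 2 := by
    have hS : 0 < C₂ + 14 * C + 14 * L + 1 := by positivity
    refine ⟨min (s / 2) (min δ (1 / 2)) / (C₂ + 14 * C + 14 * L + 1), by positivity, ?_, ?_, ?_⟩ <;>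
    · rw [div_mul_eq_mul_div, div_le_iff₀ hS]
      refine mul_le_mul ?_ (by linarith) (by positivity) (by positivity)
      first
      | exact min_le_left _ _
      | exact (min_le_right _ _).trans (min_le_left _ _)
      | exact (min_le_right _ _).trans (min_le_right _ _)
  have hden : ∀ ε, |ε| < ε₁ → ∀ θ, ∀ z ∈ Metric.cthickening η I,
      ‖(ε : ℂ) * D θ z‖ ≤ s / 2 := fun ε hε θ z hz => by
    rw [norm_mul, Complex.norm_real, Real.norm_eq_abs]
    exact (mul_le_mul hε.le (hC₂ θ z hz) (norm_nonneg _) hε₁.le).trans hsm1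
  have hden' : ∀ ε, |ε| < ε₁ → ∀ θ, ∀ z ∈ Metric.cthickening η I,
      s / 2 ≤ ‖(s : ℂ) + ε * D θ z‖ := fun ε hε θ z hz => by
    have h1 := norm_sub_le ((s : ℂ) + ε * D θ z) (ε * D θ z)
    rw [add_sub_cancel_right, Complex.norm_real, Real.norm_of_nonneg hs.le] at h1
    linarith [hden ε hε θ z hz]
  have hden0 : ∀ ε, |ε| < ε₁ → ∀ θ, ∀ z ∈ Metric.cthickening η I,
      (s : ℂ) + ε * D θ z ≠ 0 := fun ε hε θ z hz h => by
    have := hden' ε hε θ z hz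
    rw [h, norm_zero] at this
    linarith
  have hGb : ∀ ε, |ε| < ε₁ → ∀ θ, ∀ z ∈ Metric.cthickening η I, ‖G ε θ z‖ ≤ C :=
      fun ε hε θ z hz => by
    simp only [hG]
    rw [norm_div]
    exact div_le_div₀ hC₁0 (hC₁ θ z hz) (by positivity) (hden' ε hε θ z hz)
  have hGd : ∀ ε, |ε| < ε₁ → ∀ θ, DifferentiableOn ℂ (G ε θ) (Metric.thickening (3 * δ) I) :=
      fun ε hε θ => by
    have hsub : Metric.thickening (3 * δ) I ⊆ W := h3.trans hηW
    exact ((hNd θ).mono hsub).div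
      ((differentiableOn_const _).add ((differentiableOn_const _).mul ((hDd θ).mono hsub)))
      fun z hz => hden0 ε hε θ z (h3 hz)
  have hpic : ∀ ε, |ε| < ε₁ → PicardData I δ C L ε (G ε) := fun ε hε =>
    { pos := hδ0
      cont := by
        have hsub : (univ : Set ℝ) ×ˢ Metric.thickening (2 * δ) I ⊆ univ ×ˢ W :=
          prod_mono subset_rfl ((h23.trans h3).trans hηW)
        have h1 := (hN.mono hsub).div (continuousOn_const (c := (s : ℂ)) |>.add
          ((continuousOn_const (c := (ε : ℂ))).mul (hD.mono hsub)))
          (fun q hq => hden0 ε hε q.1 q.2 (h3 (h23 hq.2)))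
        exact h1
      diff := fun θ => (hGd ε hε θ).mono h23
      bound := fun θ _ z hz => hGb ε hε θ z (h3 (h23 hz))
      lip := fun θ _ z hz w hw => by
        refine Convex.norm_image_sub_le_of_norm_deriv_le (𝕜 := ℂ)
          (s := Metric.thickening (2 * δ) I) (fun y hy => ?_) (fun y hy => ?_)
          (hconv.thickening _) hw hz
        · exact (hGd ε hε θ).differentiableAt (Metric.isOpen_thickening.mem_nhds (h23 hy))
        · have hsub : ∀ x ∈ Metric.ball y δ, x ∈ Metric.thickening (3 * δ) I := fun x hx => by
            obtain ⟨v, hv, hyv⟩ := Metric.mem_thickening_iff.1 hy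
            refine Metric.mem_thickening_iff.2 ⟨v, hv, ?_⟩
            rw [Metric.mem_ball] at hx
            linarith [dist_triangle x y v]
          have hCl : ∀ ρ, 0 < ρ → ρ < δ → ‖deriv (G ε θ) y‖ ≤ C / ρ := fun ρ hρ hρδ => by
            have hsub' : Metric.closedBall y ρ ⊆ Metric.thickening (3 * δ) I := fun x hx =>
              hsub x (Metric.closedBall_subset_ball hρδ hx)
            exact Complex.norm_deriv_le_of_forall_mem_sphere_norm_le hρ
              (((hGd ε hε θ).mono hsub').diffContOnCl_ball subset_rfl)
              fun x hx => hGb ε hε θ x (h3 (hsub' (Metric.sphere_subset_closedBall hx)))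
          have hto : Tendsto (fun ρ : ℝ => C / ρ) (𝓝[<] δ) (𝓝 (C / δ)) :=
            (tendsto_const_nhds.div (tendsto_id (α := ℝ)) hδ0.ne').mono_left nhdsWithin_le_nhds
          refine ge_of_tendsto hto ?_
          filter_upwards [Ioo_mem_nhdsLT hδ0] with ρ hρ using hCl ρ hρ.1 hρ.2
      Lnonneg := hL0
      small := (mul_le_mul_of_nonneg_right hε.le (by positivity)).trans hsm2
      small' := (mul_le_mul_of_nonneg_right hε.le (by positivity)).trans hsm3 }
  have hGr : ∀ ε : ℝ, ∀ (θ x : ℝ), (x : ℂ) ∈ Metric.thickening (2 * δ) I →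
      (G ε θ x).im = 0 := fun ε θ x hx => by
    have hxW : (x : ℂ) ∈ W := hηW (h3 (h23 hx))
    have h1 : N θ x = (((N θ x).re : ℝ) : ℂ) :=
      Complex.ext rfl ((hNr θ x hxW).trans (Complex.ofReal_im _).symm)
    have h2 : D θ x = (((D θ x).re : ℝ) : ℂ) :=
      Complex.ext rfl ((hDr θ x hxW).trans (Complex.ofReal_im _).symm)
    simp only [hG]
    rw [h1, h2, ← Complex.ofReal_mul, ← Complex.ofReal_add, ← Complex.ofReal_div, Complex.ofReal_im]
  choose! R hR1 hR2 hR3 hR4 hR5 using fun ε (hε : |ε| < ε₁) =>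
    (hpic ε hε).exists_solution (hGr ε)
  have hmem : ∀ ε, |ε| < ε₁ → ∀ z ∈ Metric.thickening δ I, ∀ θ,
      R ε θ z ∈ Metric.thickening (2 * δ) I := fun ε hε z hz θ =>
    PicardData.mem_of_norm_sub_le hz ((hR2 ε hε z hz θ).trans (hpic ε hε).small)
  refine ⟨δ, hδ0, ε₁, hε₁, R, (h23.trans h3).trans hηW, hR1, hmem, hR3, hR4, hR5,
    fun ε hε z hz w hw θ => (hpic ε hε).solution_lipschitz (hR1 ε hε) (hR2 ε hε) (hR4 ε hε) hz hw θ,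
    fun ε hε θ z hz => hden ε hε θ z (h3 (h23 hz)), fun z hz => ?_⟩
  have hV : Metric.thickening δ I ∈ 𝓝 z := Metric.isOpen_thickening.mem_nhds hz
  have hzη : z ∈ W := hηW (h3 (Metric.thickening_mono (by linarith) I hz))
  have hpi : clampAngle (2 * Real.pi) = 2 * Real.pi :=
    clampAngle_of_mem ⟨by linarith [Real.pi_pos], by linarith [Real.pi_lt_four,
      Real.pi_lt_d2]⟩
  have e1 : ∀ᶠ q : ℝ × ℂ in 𝓝[≠] 0 ×ˢ 𝓝 z, q.1 ≠ 0 ∧ |q.1| < ε₁ ∧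
      q.2 ∈ Metric.thickening δ I := by
    have h1 : ∀ᶠ ε : ℝ in 𝓝[≠] 0, ε ≠ 0 ∧ |ε| < ε₁ := by
      refine eventually_mem_nhdsWithin.and (nhdsWithin_le_nhds ?_)
      filter_upwards [Metric.ball_mem_nhds (0 : ℝ) hε₁] with ε hε
      simpa using hε
    filter_upwards [h1.prod_mk (show ∀ᶠ w in 𝓝 z, w ∈ Metric.thickening δ I from hV)] with q hq
    exact ⟨hq.1.1, hq.1.2, hq.2⟩
  have hε0 : Tendsto (fun q : ℝ × ℂ => q.1) (𝓝[≠] 0 ×ˢ 𝓝 z) (𝓝 0) :=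
    (tendsto_fst (g := 𝓝 z)).mono_right nhdsWithin_le_nhds
  have hRlim : ∀ t, Tendsto (fun q : ℝ × ℂ => R q.1 t q.2) (𝓝[≠] 0 ×ˢ 𝓝 z) (𝓝 z) := fun t => by
    have h1 : Tendsto (fun q : ℝ × ℂ => |q.1| * (14 * C)) (𝓝[≠] 0 ×ˢ 𝓝 z) (𝓝 0) := by
      simpa using (hε0.abs).mul_const (14 * C)
    have h2 : Tendsto (fun q : ℝ × ℂ => R q.1 t q.2 - q.2) (𝓝[≠] 0 ×ˢ 𝓝 z) (𝓝 0) := by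
      refine squeeze_zero_norm' ?_ h1
      filter_upwards [e1] with q hq using hR2 q.1 hq.2.1 q.2 hq.2.2 t
    simpa using h2.add (tendsto_snd (f := 𝓝[≠] (0 : ℝ)) (g := 𝓝 z))
  have hint : Tendsto (fun q : ℝ × ℂ => ∫ t in (0 : ℝ)..(2 * Real.pi), G q.1 t (R q.1 t q.2))
      (𝓝[≠] 0 ×ˢ 𝓝 z) (𝓝 (∫ t in (0 : ℝ)..(2 * Real.pi), N t z / s)) := by
    refine intervalIntegral.tendsto_integral_filter_of_dominated_convergence (fun _ => C) ?_ ?_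
      intervalIntegrable_const ?_
    · filter_upwards [e1] with q hq
      exact ((hpic q.1 hq.2.1).continuous_comp (hR1 q.1 hq.2.1 q.2 hq.2.2)
        (hmem q.1 hq.2.1 q.2 hq.2.2)).aestronglyMeasurable
    · filter_upwards [e1] with q hq
      exact Eventually.of_forall fun t _ => hGb q.1 hq.2.1 t _
        (h3 (h23 (hmem q.1 hq.2.1 q.2 hq.2.2 t)))
    · refine Eventually.of_forall fun t _ => ?_
      have hNc : Tendsto (fun q : ℝ × ℂ => N t (R q.1 t q.2)) (𝓝[≠] 0 ×ˢ 𝓝 z) (𝓝 (N t z)) :=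
        ((hNd t).continuousOn.continuousAt (hW.mem_nhds hzη)).tendsto.comp (hRlim t)
      have hDc : Tendsto (fun q : ℝ × ℂ => D t (R q.1 t q.2)) (𝓝[≠] 0 ×ˢ 𝓝 z) (𝓝 (D t z)) :=
        ((hDd t).continuousOn.continuousAt (hW.mem_nhds hzη)).tendsto.comp (hRlim t)
      have hεc : Tendsto (fun q : ℝ × ℂ => (q.1 : ℂ)) (𝓝[≠] 0 ×ˢ 𝓝 z) (𝓝 (0 : ℝ)) :=
        (Complex.continuous_ofReal.tendsto 0).comp hε0
      have h1 := hNc.div ((tendsto_const_nhds (x := (s : ℂ))).add (hεc.mul hDc)) (by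
        simpa using hs.ne')
      simp only [Complex.ofReal_zero, zero_mul, add_zero] at h1
      exact h1
  refine hint.congr' ?_
  filter_upwards [e1] with q hq
  rw [hR4 q.1 hq.2.1 q.2 hq.2.2, hpi, add_sub_cancel_left, mul_div_cancel_left₀]
  exact_mod_cast hq.1

end Averaging

/-! ### Planar systems: uniqueness of solutions and change of time -/

section PlanarODE

open Set Filter MeasureTheory PlanarSystem

theorem exists_lipschitzOnWith_of_contDiff {X : ℝ × ℝ → ℝ × ℝ} (hX : ContDiff ℝ 1 X)
    {s : Set (ℝ × ℝ)} (hs : IsCompact s) : ∃ K, LipschitzOnWith K X s :=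
  (hX.locallyLipschitz.locallyLipschitzOn (s := s)).exists_lipschitzOnWith_of_compact hs

theorem eqOn_of_hasDerivWithinAt {X : ℝ × ℝ → ℝ × ℝ} (hX : ContDiff ℝ 1 X)
    {f g : ℝ → ℝ × ℝ} {τ : ℝ}
    (hf : ∀ t ∈ Icc 0 τ, HasDerivWithinAt f (X (f t)) (Icc 0 τ) t)
    (hg : ∀ t ∈ Icc 0 τ, HasDerivWithinAt g (X (g t)) (Icc 0 τ) t) (h0 : f 0 = g 0) :
    EqOn f g (Icc 0 τ) := by
  have hfc : ContinuousOn f (Icc 0 τ) := fun t ht => (hf t ht).continuousWithinAt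
  have hgc : ContinuousOn g (Icc 0 τ) := fun t ht => (hg t ht).continuousWithinAt
  obtain ⟨K, hK⟩ := exists_lipschitzOnWith_of_contDiff hX
    ((isCompact_Icc.image_of_continuousOn hfc).union (isCompact_Icc.image_of_continuousOn hgc))
  have hright : ∀ {u : ℝ → ℝ × ℝ}, (∀ t ∈ Icc 0 τ, HasDerivWithinAt u (X (u t)) (Icc 0 τ) t) →
      ∀ t ∈ Ico 0 τ, HasDerivWithinAt u (X (u t)) (Ici t) t := fun hu t ht =>
    (hu t (Ico_subset_Icc_self ht)).mono_of_mem_nhdsWithin (by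
      filter_upwards [self_mem_nhdsWithin, mem_nhdsWithin_of_mem_nhds (Iio_mem_nhds ht.2)]
        with y hy1 hy2 using ⟨ht.1.trans hy1, hy2.le⟩)
  exact ODE_solution_unique_of_mem_Icc_right (v := fun _ => X)
    (s := fun _ => f '' Icc 0 τ ∪ g '' Icc 0 τ) (fun t _ => hK) hfc (hright hf)
    (fun t ht => Or.inl (mem_image_of_mem f (Ico_subset_Icc_self ht))) hgc (hright hg)
    (fun t ht => Or.inr (mem_image_of_mem g (Ico_subset_Icc_self ht))) h0

theorem PlanarSystem.IsSolution.continuous {X : ℝ × ℝ → ℝ × ℝ} {φ : ℝ → ℝ × ℝ}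
    (hφ : IsSolution X φ) : Continuous φ :=
  continuous_iff_continuousAt.2 fun t => (hφ t).continuousAt

theorem PlanarSystem.IsSolution.comp_add {X : ℝ × ℝ → ℝ × ℝ} {φ : ℝ → ℝ × ℝ}
    (hφ : IsSolution X φ) (c : ℝ) : IsSolution X fun t => φ (t + c) := fun t =>
  (hφ (t + c)).comp_add_const t c

/-- Periodic orbits through a common point coincide. -/
theorem periodicOrbit_eq_of_mem {X : ℝ × ℝ → ℝ × ℝ} (hX : ContDiff ℝ 1 X)
    {γ γ' : Set (ℝ × ℝ)} (h : IsPeriodicOrbit X γ) (h' : IsPeriodicOrbit X γ') {p : ℝ × ℝ}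
    (hp : p ∈ γ) (hp' : p ∈ γ') : γ = γ' := by
  obtain ⟨φ, T, hT, hφ, hper, -, rfl⟩ := h
  obtain ⟨φ', T', hT', hφ', hper', -, rfl⟩ := h'
  obtain ⟨t, rfl⟩ := hp
  obtain ⟨t', ht'⟩ := hp'
  obtain ⟨K, hK⟩ := exists_lipschitzOnWith_of_contDiff hX
    ((hper.compact_of_continuous hT.ne' hφ.continuous).union
      (hper'.compact_of_continuous hT'.ne' hφ'.continuous))
  have h := ODE_solution_unique_univ (v := fun _ => X) (s := fun _ => range φ ∪ range φ')
    (f := fun s => φ (s + t)) (g := fun s => φ' (s + t')) (t₀ := 0) (fun _ => hK)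
    (fun s => ⟨hφ.comp_add t s, Or.inl (mem_range_self _)⟩)
    (fun s => ⟨hφ'.comp_add t' s, Or.inr (mem_range_self _)⟩) (by simpa using ht'.symm)
  have h1 : range (fun s => φ (s + t)) = range φ :=
    (Equiv.addRight t).surjective.range_comp φ
  have h2 : range (fun s => φ' (s + t')) = range φ' :=
    (Equiv.addRight t').surjective.range_comp φ'
  rw [← h1, ← h2, h]

/-- Every point of a periodic orbit is the initial value of a periodic solution. -/
theorem exists_solution_of_mem {X : ℝ × ℝ → ℝ × ℝ} {γ : Set (ℝ × ℝ)} (h : IsPeriodicOrbit X γ)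
    {p : ℝ × ℝ} (hp : p ∈ γ) : ∃ φ : ℝ → ℝ × ℝ, IsSolution X φ ∧ φ 0 = p ∧ ∀ t, φ t ∈ γ := by
  obtain ⟨φ, T, hT, hφ, hper, -, rfl⟩ := h
  obtain ⟨t, rfl⟩ := hp
  exact ⟨fun s => φ (s + t), hφ.comp_add t, by simp, fun s => mem_range_self _⟩

theorem isCompact_of_isPeriodicOrbit {X : ℝ × ℝ → ℝ × ℝ} {γ : Set (ℝ × ℝ)}
    (h : IsPeriodicOrbit X γ) : IsCompact γ := by
  obtain ⟨φ, T, hT, hφ, hper, -, rfl⟩ := h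
  exact hper.compact_of_continuous hT.ne' hφ.continuous

/-- The inverse of the primitive of a continuous function that is bounded below by a positive
constant. -/
theorem exists_inverse_of_primitive {k : ℝ → ℝ} (hk : Continuous k) {c : ℝ} (hc : 0 < c)
    (hck : ∀ t, c ≤ k t) :
    ∃ Θ : ℝ → ℝ, StrictMono Θ ∧ (∀ θ, Θ (∫ t in (0 : ℝ)..θ, k t) = θ) ∧
      ∀ t, HasDerivAt Θ (k (Θ t))⁻¹ t := by
  set T : ℝ → ℝ := fun θ => ∫ t in (0 : ℝ)..θ, k t with hT
  have hder : ∀ θ, HasDerivAt T (k θ) θ := fun θ => hk.integral_hasStrictDerivAt 0 θ |>.hasDerivAt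
  have hmono : StrictMono T := strictMono_of_deriv_pos fun θ => by
    rw [(hder θ).deriv]; exact hc.trans_le (hck θ)
  have hcont : Continuous T := continuous_iff_continuousAt.2 fun θ => (hder θ).continuousAt
  have hgrow : ∀ a b, a ≤ b → c * (b - a) ≤ T b - T a := fun a b hab =>
    Convex.mul_sub_le_image_sub_of_le_deriv convex_univ hcont.continuousOn
      (fun θ _ => (hder θ).differentiableAt.differentiableWithinAt)
      (fun θ _ => by rw [(hder θ).deriv]; exact hck θ) a trivial b trivial hab
  have hT0 : T 0 = 0 := intervalIntegral.integral_same
  have hsurj : Function.Surjective T := by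
    refine hcont.surjective ?_ ?_
    · refine tendsto_atTop_mono' _ ?_ (tendsto_id.const_mul_atTop hc)
      filter_upwards [eventually_ge_atTop 0] with θ hθ
      have := hgrow 0 θ hθ
      simp only [id_eq]
      linarith
    · refine tendsto_atBot_mono' _ ?_ (tendsto_id.const_mul_atBot hc)
      filter_upwards [eventually_le_atBot 0] with θ hθ
      have := hgrow θ 0 hθ
      simp only [id_eq]
      linarith
  set e := (StrictMono.orderIsoOfSurjective T hmono hsurj) with he
  have heT : ∀ θ, e θ = T θ := fun θ => rfl
  refine ⟨e.symm, e.symm.strictMono, fun θ => ?_, fun t => ?_⟩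
  · exact e.symm_apply_apply θ
  · refine HasDerivAt.of_local_left_inverse e.symm.continuous.continuousAt (hder _)
      (hc.trans_le (hck _)).ne' (Eventually.of_forall fun y => ?_)
    exact e.apply_symm_apply y

/-- A function that is analytic at a real point and, along the real line, `O((ρ - x) ^ m)` there,
vanishes to order at least `m`. -/
theorem le_analyticOrderAt_of_isBigO {𝕜 : Type*} [RCLike 𝕜] {f : 𝕜 → 𝕜} {x : ℝ}
    (hf : AnalyticAt 𝕜 f (x : 𝕜)) {m : ℕ}
    (h : (fun ρ : ℝ => f (ρ : 𝕜)) =O[𝓝 x] fun ρ => (ρ - x) ^ m) :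
    (m : ℕ∞) ≤ analyticOrderAt f (x : 𝕜) := by
  by_contra! hlt
  obtain ⟨k, hk⟩ := ENat.ne_top_iff_exists.1 (ne_top_of_lt hlt)
  rw [← hk, Nat.cast_lt] at hlt
  obtain ⟨g, hg, hg0, hfg⟩ := (hf.analyticOrderAt_eq_natCast).1 hk.symm
  have hcast : Tendsto (fun ρ : ℝ => (ρ : 𝕜)) (𝓝 x) (𝓝 (x : 𝕜)) :=
    RCLike.continuous_ofReal.tendsto x
  obtain ⟨C, hC⟩ := h.bound
  have h1 : ∀ᶠ ρ : ℝ in 𝓝[≠] x, ‖g (ρ : 𝕜)‖ ≤ C * |ρ - x| ^ (m - k) := by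
    filter_upwards [hC.filter_mono nhdsWithin_le_nhds,
      (hcast.eventually hfg).filter_mono nhdsWithin_le_nhds, self_mem_nhdsWithin] with ρ h2 h3 h4
    have hpos : 0 < |ρ - x| := abs_pos.2 (sub_ne_zero.2 h4)
    have hp : 0 < |ρ - x| ^ k := pow_pos hpos k
    have hm : |ρ - x| ^ m = |ρ - x| ^ k * |ρ - x| ^ (m - k) := by
      rw [← pow_add, Nat.add_sub_of_le hlt.le]
    rw [h3, smul_eq_mul, norm_mul, norm_pow, norm_pow, ← RCLike.ofReal_sub, RCLike.norm_ofReal,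
      Real.norm_eq_abs, hm, mul_left_comm] at h2
    exact le_of_mul_le_mul_left h2 hp
  have h5 : Tendsto (fun ρ : ℝ => C * |ρ - x| ^ (m - k)) (𝓝[≠] x) (𝓝 0) := by
    have h6 : Continuous fun ρ : ℝ => C * |ρ - x| ^ (m - k) := by fun_prop
    have h7 := h6.tendsto x
    rw [sub_self, abs_zero, zero_pow (by omega), mul_zero] at h7
    exact h7.mono_left nhdsWithin_le_nhds
  have h8 : Tendsto (fun ρ : ℝ => ‖g (ρ : 𝕜)‖) (𝓝[≠] x) (𝓝 ‖g (x : 𝕜)‖) :=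
    ((hg.continuousAt.tendsto.comp hcast).norm).mono_left nhdsWithin_le_nhds
  have h9 := le_of_tendsto_of_tendsto h8 h5 h1
  exact hg0 (norm_le_zero_iff.1 h9)

/-- Conversely, a zero of order at least `m` is `O((ρ - x) ^ m)` along the real line. -/
theorem isBigO_of_le_analyticOrderAt {𝕜 : Type*} [RCLike 𝕜] {f : 𝕜 → 𝕜} {x : ℝ}
    (hf : AnalyticAt 𝕜 f (x : 𝕜)) {m : ℕ} (h : (m : ℕ∞) ≤ analyticOrderAt f (x : 𝕜)) :
    (fun ρ : ℝ => f (ρ : 𝕜)) =O[𝓝 x] fun ρ => (ρ - x) ^ m := by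
  obtain ⟨g, hg, hfg⟩ := (natCast_le_analyticOrderAt hf).1 h
  have hcast : Tendsto (fun ρ : ℝ => (ρ : 𝕜)) (𝓝 x) (𝓝 (x : 𝕜)) :=
    RCLike.continuous_ofReal.tendsto x
  have h8 : Tendsto (fun ρ : ℝ => ‖g (ρ : 𝕜)‖) (𝓝 x) (𝓝 ‖g (x : 𝕜)‖) :=
    (hg.continuousAt.tendsto.comp hcast).norm
  refine Asymptotics.IsBigO.of_bound (‖g (x : 𝕜)‖ + 1) ?_
  filter_upwards [hcast.eventually hfg, h8.eventually (gt_mem_nhds (lt_add_one _))] with ρ h1 h2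
  rw [h1, smul_eq_mul, norm_mul, norm_pow, norm_pow, ← RCLike.ofReal_sub, RCLike.norm_ofReal,
    Real.norm_eq_abs, mul_comm]
  exact mul_le_mul_of_nonneg_right h2.le (by positivity)

end PlanarODE

/-! ### The perturbed system in polar coordinates -/

section PolarSystem

open Set Filter MeasureTheory PlanarSystem ReversibleSystem

theorem contDiff_poly (n : ℕ) (c : ℕ → ℕ → ℝ) : ContDiff ℝ 1 (poly n c) := by
  unfold poly
  fun_prop

theorem contDiff_field (n : ℕ) (a b : ℕ → ℕ → ℝ) (ε : ℝ) : ContDiff ℝ 1 (field n a b ε) := by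
  have h1 := contDiff_poly n a
  have h2 := contDiff_poly n b
  unfold field
  fun_prop

/-- A curve whose polar coordinates satisfy the polar form of the system is a solution. -/
theorem hasDerivAt_polar {n : ℕ} {a b : ℕ → ℕ → ℝ} {ε : ℝ} {R Θ : ℝ → ℝ} {t w : ℝ}
    (hR : R t ∈ Ioo (0 : ℝ) 1) (hw : w = √(1 + R t * Real.cos (Θ t)))
    (h1 : HasDerivAt R
      (ε * perturbRad n a b w (R t) (Real.cos (Θ t)) (Real.sin (Θ t)) / w) t)
    (h2 : HasDerivAt Θ
      ((√2 + ε * perturbAng n a b w (R t) (Real.cos (Θ t)) (Real.sin (Θ t))) / w) t) :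
    HasDerivAt (fun s => (polarX (R s) (Θ s), polarY (R s) (Θ s)))
      (field n a b ε (polarX (R t) (Θ t), polarY (R t) (Θ t))) t := by
  have hu : 0 < 1 + R t * Real.cos (Θ t) := one_add_mul_cos_pos hR _
  have hw0 : 0 < w := by rw [hw]; exact Real.sqrt_pos.2 hu
  have hw2 : 1 + R t * Real.cos (Θ t) = w ^ 2 := by rw [hw, Real.sq_sqrt hu.le]
  have hR0 := hR.1.ne'
  have hcs := Real.sin_sq_add_cos_sq (Θ t)
  have h20 : √2 ≠ 0 := by positivity
  have h22 : √2 ^ 2 = 2 := Real.sq_sqrt (by norm_num)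
  have hww : √(w ^ 2) = w := Real.sqrt_sq hw0.le
  set S := Real.sin (Θ t) with hS
  set C := Real.cos (Θ t) with hC
  set P := perturbP n a w (R t) S with hP
  set Q := perturbQ n a b w (R t) S with hQ
  have hu' : HasDerivAt (fun s => 1 + R s * Real.cos (Θ s)) (ε * P - √2 * R t * S / w) t := by
    refine ((h1.mul h2.cos).const_add 1).congr_deriv ?_
    simp only [perturbRad, perturbAng, ← hP, ← hQ, ← hS, ← hC]
    field_simp
    linear_combination ε * w * P * hcs
  have hq' : HasDerivAt (fun s => √2 * (R s * Real.sin (Θ s)))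
      (√2 * (ε * Q + √2 * R t * C / w)) t := by
    refine ((h1.mul h2.sin).const_mul (√2)).congr_deriv ?_
    simp only [perturbRad, perturbAng, ← hP, ← hQ, ← hS, ← hC]
    field_simp
    linear_combination ε * Q * w * hcs
  have hw' := hu'.sqrt hu.ne'
  have hX : HasDerivAt (fun s => polarX (R s) (Θ s))
      (field n a b ε (polarX (R t) (Θ t), polarY (R t) (Θ t))).1 t := by
    have h := hu'.inv hu.ne'
    refine (h.congr_of_eventuallyEq (Eventually.of_forall fun s => by simp [polarX])).congr_deriv ?_
    simp only [field, polarX, polarY, hP, perturbP, polyAt_real, RCLike.ofReal_real_eq_id, id_eq,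
      ← hC, ← hS, hw2, hww]
    generalize poly n a _ = f
    field_simp
    ring
  have hRC : R t * C = w ^ 2 - 1 := by linarith
  have hY : HasDerivAt (fun s => polarY (R s) (Θ s))
      (field n a b ε (polarX (R t) (Θ t), polarY (R t) (Θ t))).2 t := by
    have h := hq'.div (hw'.pow 3) (by
      simp only [Pi.pow_apply]
      rw [← hw]
      exact pow_ne_zero 3 hw0.ne')
    refine (h.congr_of_eventuallyEq
      (Eventually.of_forall fun s => by simp [polarY, mul_assoc])).congr_deriv ?_
    simp only [field, polarX, polarY, hP, hQ, perturbP, perturbQ, polyAt_real,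
      RCLike.ofReal_real_eq_id, id_eq, Pi.pow_apply, ← hC, ← hS, hw2, hww]
    generalize poly n a _ = f
    generalize poly n b _ = g
    field_simp
    push_cast
    ring_nf
    simp only [h22]
    linear_combination (4 * w ^ 4) * hRC
  exact hX.prodMk hY

/-- The rate of rotation `p q' - q p'` of a point moving with velocity `v`, in the coordinates
`p = 1 / x - 1`, `q = y x ^ (-3/2) / √2`. -/
noncomputable def angMom (q v : ℝ × ℝ) : ℝ :=
  (1 / q.1 - 1) * (v.2 / (√2 * √q.1 ^ 3) - 3 / 2 * (q.2 * v.1) / (√2 * √q.1 ^ 5)) -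
    q.2 / (√2 * √q.1 ^ 3) * (-v.1 / q.1 ^ 2)

theorem angMom_unperturbed (n : ℕ) (a b : ℕ → ℕ → ℝ) {q : ℝ × ℝ} (hq : 0 < q.1) :
    angMom q (field n a b 0 q) = √2 * √q.1 * (1 + H q) := by
  obtain ⟨x, y⟩ := q
  have hw : 0 < √x := Real.sqrt_pos.2 hq
  have hw2 : x = √x ^ 2 := (Real.sq_sqrt (le_of_lt hq)).symm
  simp only [angMom, field, H]
  generalize √x = w at *
  subst hw2
  have h20 : √2 ≠ 0 := by positivity
  have h22 : √2 ^ 2 = 2 := Real.sq_sqrt (by norm_num)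
  field_simp
  rw [h22]
  ring

/-- For small `ε` the perturbed field still rotates in the positive direction on a compact part of
the annulus. -/
theorem exists_angMom_pos (n : ℕ) (a b : ℕ → ℕ → ℝ) {K : Set (ℝ × ℝ)} (hK : IsCompact K)
    (hKA : K ⊆ annulus) :
    ∃ ε₂ > 0, ∀ ε, |ε| < ε₂ → ∀ q ∈ K, 0 < angMom q (field n a b ε q) := by
  have h : ∀ᶠ ε in 𝓝 (0 : ℝ), ∀ q ∈ K, 0 < angMom q (field n a b ε q) := by
    refine hK.eventually_forall_of_forall_eventually fun q hq => ?_
    have hq0 := (hKA hq).1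
    have hpos : 0 < angMom q (field n a b 0 q) := by
      rw [angMom_unperturbed n a b hq0]
      have := (hKA hq).2.1
      have := Real.sqrt_pos.2 hq0
      have : 0 < 1 + H q := by linarith
      positivity
    have hc1 := (contDiff_poly n a).continuous
    have hc2 := (contDiff_poly n b).continuous
    have hcf : Continuous fun z : ℝ × ℝ × ℝ => field n a b z.1 z.2 := by
      unfold field
      fun_prop
    have hcont : ContinuousAt (fun z : ℝ × ℝ × ℝ => angMom z.2 (field n a b z.1 z.2)) (0, q) := by
      have hcf1 := hcf.fst.continuousAt (x := (0, q))
      have hcf2 := hcf.snd.continuousAt (x := (0, q))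
      have hx : ContinuousAt (fun z : ℝ × ℝ × ℝ => z.2.1) (0, q) := by fun_prop
      have hy : ContinuousAt (fun z : ℝ × ℝ × ℝ => z.2.2) (0, q) := by fun_prop
      have hs : ContinuousAt (fun z : ℝ × ℝ × ℝ => √z.2.1) (0, q) := hx.sqrt
      have hs0 : √q.1 ≠ 0 := (Real.sqrt_pos.2 hq0).ne'
      have hx0 : q.1 ≠ 0 := hq0.ne'
      have h20 : √2 ≠ 0 := by positivity
      unfold angMom
      refine ((((continuousAt_const.div hx hx0).sub continuousAt_const).mul
        ((hcf2.div (continuousAt_const.mul (hs.pow 3)) (mul_ne_zero h20 (pow_ne_zero 3 hs0))).sub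
        ((continuousAt_const.mul (hy.mul hcf1)).div (continuousAt_const.mul (hs.pow 5))
          (mul_ne_zero h20 (pow_ne_zero 5 hs0))))).sub
        ((hy.div (continuousAt_const.mul (hs.pow 3)) (mul_ne_zero h20 (pow_ne_zero 3 hs0))).mul
          (hcf1.neg.div (hx.pow 2) (pow_ne_zero 2 hx0))))
    exact hcont.eventually (lt_mem_nhds hpos)
  obtain ⟨ε₂, hε₂, hball⟩ := Metric.eventually_nhds_iff.1 h
  exact ⟨ε₂, hε₂, fun ε hε => hball (by simpa using hε)⟩

/-- A periodic orbit in the annulus that rotates in the positive direction crosses the section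
`y = 0`, `x < 1`: otherwise the argument would be a strictly increasing periodic function. -/
theorem exists_mem_section {X : ℝ × ℝ → ℝ × ℝ} {γ : Set (ℝ × ℝ)} (h : IsPeriodicOrbit X γ)
    (hγ : γ ⊆ annulus) (hpos : ∀ q ∈ γ, 0 < angMom q (X q)) :
    ∃ x, (x, (0 : ℝ)) ∈ γ ∧ x < 1 := by
  obtain ⟨φ, T, hT, hφ, hper, -, rfl⟩ := h
  by_contra! hc
  set p : ℝ → ℝ := fun t => 1 / (φ t).1 - 1 with hp
  set q : ℝ → ℝ := fun t => (φ t).2 / (√2 * √(φ t).1 ^ 3) with hq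
  have hx0 : ∀ t, 0 < (φ t).1 := fun t => (hγ (mem_range_self t)).1
  set p' : ℝ → ℝ := fun t => -(X (φ t)).1 / (φ t).1 ^ 2 with hp'
  set q' : ℝ → ℝ := fun t => (X (φ t)).2 / (√2 * √(φ t).1 ^ 3) -
    3 / 2 * ((φ t).2 * (X (φ t)).1) / (√2 * √(φ t).1 ^ 5) with hq'
  have hdx : ∀ t, HasDerivAt (fun t => (φ t).1) (X (φ t)).1 t := fun t => (hφ t).fst
  have hdy : ∀ t, HasDerivAt (fun t => (φ t).2) (X (φ t)).2 t := fun t => (hφ t).snd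
  have hdp : ∀ t, HasDerivAt p (p' t) t := fun t => by
    have h1 := (hdx t).inv (hx0 t).ne'
    exact (h1.sub_const 1).congr_of_eventuallyEq (Eventually.of_forall fun s => by simp [hp])
  have hdq : ∀ t, HasDerivAt q (q' t) t := fun t => by
    have hs := Real.sqrt_pos.2 (hx0 t)
    have h1 := (hdy t).div ((((hdx t).sqrt (hx0 t).ne').pow 3).const_mul (√2))
      (by simp only [Pi.pow_apply]; positivity)
    refine h1.congr_deriv ?_
    simp only [hq', Pi.pow_apply]
    field_simp
    push_cast
    ring
  have hslit : ∀ t, -((p t : ℂ) + q t * Complex.I) ∈ Complex.slitPlane := fun t => by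
    rw [Complex.mem_slitPlane_iff]
    by_contra! hcon
    have hre : (-((p t : ℂ) + q t * Complex.I)).re = -p t := by simp
    have him : (-((p t : ℂ) + q t * Complex.I)).im = -q t := by simp
    rw [hre, him] at hcon
    have hy : (φ t).2 = 0 := by
      have h1 : q t = 0 := by linarith [hcon.2]
      have h2 : 0 < √2 * √(φ t).1 ^ 3 := by
        have := Real.sqrt_pos.2 (hx0 t)
        positivity
      exact (div_eq_zero_iff.1 h1).resolve_right h2.ne'
    have hx1 : 1 ≤ (φ t).1 := hc _ ⟨t, Prod.ext rfl hy⟩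
    have hx2 : (φ t).1 ≤ 1 := by
      have h1 : 0 ≤ 1 / (φ t).1 - 1 := by have := hcon.1; simp only [hp] at this; linarith
      rw [sub_nonneg, le_div_iff₀ (hx0 t)] at h1
      linarith
    have hx : (φ t).1 = 1 := le_antisymm hx2 hx1
    have hH := (hγ (mem_range_self t)).2.1
    rw [H, hx, hy] at hH
    norm_num at hH
  set A : ℝ → ℝ := fun t => (Complex.log (-((p t : ℂ) + q t * Complex.I))).im with hA
  have hAd : ∀ t, HasDerivAt A (angMom (φ t) (X (φ t)) / (p t ^ 2 + q t ^ 2)) t := fun t => by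
    have h1 : HasDerivAt (fun t => -((p t : ℂ) + q t * Complex.I))
        (-((p' t : ℂ) + q' t * Complex.I)) t :=
      ((hdp t).ofReal_comp.add ((hdq t).ofReal_comp.mul_const Complex.I)).neg
    have h2 := Complex.imCLM.hasFDerivAt.comp_hasDerivAt t (h1.clog_real (hslit t))
    refine h2.congr_deriv ?_
    have h3 : -((p' t : ℂ) + q' t * Complex.I) / -((p t : ℂ) + q t * Complex.I) =
        ((p' t : ℂ) + q' t * Complex.I) / ((p t : ℂ) + q t * Complex.I) := neg_div_neg_eq _ _
    rw [h3, Complex.imCLM_apply, Complex.div_im, Complex.normSq_apply]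
    simp only [Complex.add_re, Complex.ofReal_re, Complex.mul_re, Complex.I_re, mul_zero,
      Complex.ofReal_im, Complex.I_im, mul_one, sub_self, add_zero, Complex.add_im, Complex.mul_im,
      zero_add]
    rw [← sub_div, ← sq, ← sq]
    congr 1
    simp only [angMom, hp, hq, hp', hq']
    ring
  have hmono : StrictMono A := strictMono_of_deriv_pos fun t => by
    rw [(hAd t).deriv]
    refine div_pos (hpos _ (mem_range_self t)) ?_
    have hne : p t ≠ 0 ∨ q t ≠ 0 := by
      by_contra! hz
      have := hslit t
      rw [hz.1, hz.2] at this
      simp at this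
    rcases hne with h | h
    · have := pow_pos (abs_pos.2 h) 2
      rw [sq_abs] at this
      positivity
    · have := pow_pos (abs_pos.2 h) 2
      rw [sq_abs] at this
      positivity
  have h1 := hmono hT
  have h2 : A T = A 0 := by
    have : φ T = φ 0 := by simpa using hper 0
    simp only [hA, hp, hq, this]
  exact h1.ne' h2

end PolarSystem

/-! ### The polar system for complex radius -/

section ComplexRadius

open Set Filter

theorem continuousOn_perturb {T : Type*} [TopologicalSpace T] {A : Set T} (n : ℕ)
    (a b : ℕ → ℕ → ℝ) {w r c s : T → ℂ} (hw : ContinuousOn w A) (hr : ContinuousOn r A)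
    (hc : ContinuousOn c A) (hs : ContinuousOn s A) (hw0 : ∀ p ∈ A, w p ≠ 0)
    (hr0 : ∀ p ∈ A, r p ≠ 0) :
    ContinuousOn (fun p => perturbRad n a b (w p) (r p) (c p) (s p)) A ∧
      ContinuousOn (fun p => perturbAng n a b (w p) (r p) (c p) (s p)) A := by
  have hw2 : ∀ p ∈ A, w p ^ 2 ≠ 0 := fun p hp => pow_ne_zero 2 (hw0 p hp)
  have hw3 : ∀ p ∈ A, w p ^ 3 ≠ 0 := fun p hp => pow_ne_zero 3 (hw0 p hp)
  have h2 : ((√2 : ℝ) : ℂ) ≠ 0 := by simp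
  have hpoly : ∀ d : ℕ → ℕ → ℝ, ContinuousOn
      (fun p => polyAt n d (1 / w p ^ 2) (((√2 : ℝ) : ℂ) * r p * s p / w p ^ 3)) A := fun d => by
    have hx : ContinuousOn (fun p => 1 / w p ^ 2) A := continuousOn_const.div (hw.pow 2) hw2
    have hy : ContinuousOn (fun p => ((√2 : ℝ) : ℂ) * r p * s p / w p ^ 3) A :=
      ((continuousOn_const.mul hr).mul hs).div (hw.pow 3) hw3
    unfold polyAt
    fun_prop
  have hy : ContinuousOn (fun p => ((√2 : ℝ) : ℂ) * r p * s p / w p ^ 3) A :=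
    ((continuousOn_const.mul hr).mul hs).div (hw.pow 3) hw3
  have hP : ContinuousOn (fun p => perturbP n a (w p) (r p) (s p)) A :=
    (hw.pow 4).neg.mul (hpoly a)
  have hQ : ContinuousOn (fun p => perturbQ n a b (w p) (r p) (s p)) A :=
    ((hw.pow 3).div_const _).mul ((hpoly b).sub
      (((continuousOn_const.mul hy).mul (hw.pow 2)).mul (hpoly a)))
  exact ⟨hw.mul ((hP.mul hc).add (hQ.mul hs)),
    (hw.div hr hr0).mul ((hQ.mul hc).sub (hP.mul hs))⟩

theorem differentiableOn_perturb {A : Set ℂ} (n : ℕ) (a b : ℕ → ℕ → ℝ) {w : ℂ → ℂ} (c s : ℂ)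
    (hw : DifferentiableOn ℂ w A) (hw0 : ∀ z ∈ A, w z ≠ 0) (hr0 : ∀ z ∈ A, z ≠ 0) :
    DifferentiableOn ℂ (fun z => perturbRad n a b (w z) z c s) A ∧
      DifferentiableOn ℂ (fun z => perturbAng n a b (w z) z c s) A := by
  have hr : DifferentiableOn ℂ (fun z : ℂ => z) A := differentiableOn_id
  have hw2 : ∀ p ∈ A, w p ^ 2 ≠ 0 := fun p hp => pow_ne_zero 2 (hw0 p hp)
  have hw3 : ∀ p ∈ A, w p ^ 3 ≠ 0 := fun p hp => pow_ne_zero 3 (hw0 p hp)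
  have hy : DifferentiableOn ℂ (fun z => ((√2 : ℝ) : ℂ) * z * s / w z ^ 3) A :=
    ((hr.const_mul _).mul_const s).div (hw.pow 3) hw3
  have hpoly : ∀ d : ℕ → ℕ → ℝ, DifferentiableOn ℂ
      (fun z => polyAt n d (1 / w z ^ 2) (((√2 : ℝ) : ℂ) * z * s / w z ^ 3)) A := fun d => by
    have hx : DifferentiableOn ℂ (fun p => 1 / w p ^ 2) A :=
      (differentiableOn_const 1).div (hw.pow 2) hw2
    unfold polyAt
    fun_prop
  have hP : DifferentiableOn ℂ (fun z => perturbP n a (w z) z s) A :=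
    (hw.pow 4).neg.mul (hpoly a)
  have hQ : DifferentiableOn ℂ (fun z => perturbQ n a b (w z) z s) A :=
    ((hw.pow 3).div_const _).mul ((hpoly b).sub
      (((hy.const_mul _).mul (hw.pow 2)).mul (hpoly a)))
  exact ⟨hw.mul ((hP.mul_const c).add (hQ.mul_const s)),
    (hw.div hr hr0).mul ((hQ.mul_const c).sub (hP.mul_const s))⟩

/-- The complex radii for which the polar system is used. -/
def radii : Set ℂ := {z | 0 < z.re ∧ ‖z‖ < 1}

theorem isOpen_radii : IsOpen radii :=
  (isOpen_lt continuous_const Complex.continuous_re).inter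
    (isOpen_lt continuous_norm continuous_const)

theorem ne_zero_of_mem_radii {z : ℂ} (hz : z ∈ radii) : z ≠ 0 := by
  rintro rfl
  simpa using hz.1

theorem ofReal_mem_radii {x : ℝ} : (x : ℂ) ∈ radii ↔ x ∈ Ioo (0 : ℝ) 1 := by
  simp only [radii, mem_ofPred_eq, Complex.ofReal_re, Complex.norm_real, Real.norm_eq_abs, mem_Ioo]
  exact and_congr_right fun h => by rw [abs_of_pos h]

theorem one_add_mul_cos_mem_slitPlane {z : ℂ} (hz : z ∈ radii) (θ : ℝ) :
    1 + z * (Real.cos θ : ℂ) ∈ Complex.slitPlane := by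
  refine Or.inl ?_
  have h1 : (z * (Real.cos θ : ℂ)).re = z.re * Real.cos θ := Complex.re_mul_ofReal _ _
  have h2 : |z.re * Real.cos θ| < 1 := by
    rw [abs_mul]
    calc |z.re| * |Real.cos θ| ≤ |z.re| * 1 :=
          mul_le_mul_of_nonneg_left (Real.abs_cos_le_one θ) (abs_nonneg _)
      _ ≤ ‖z‖ := by rw [mul_one]; exact Complex.abs_re_le_norm z
      _ < 1 := hz.2
  rw [Complex.add_re, Complex.one_re, h1]
  linarith [(abs_lt.1 h2).1]

/-- The square root of `1 + z cos θ`. -/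
noncomputable def polarSqrt (θ : ℝ) (z : ℂ) : ℂ := (1 + z * (Real.cos θ : ℂ)) ^ (1 / 2 : ℂ)

theorem polarSqrt_ne_zero {z : ℂ} (hz : z ∈ radii) (θ : ℝ) : polarSqrt θ z ≠ 0 := by
  rw [polarSqrt, Ne, Complex.cpow_eq_zero_iff]
  exact fun h => Complex.slitPlane_ne_zero (one_add_mul_cos_mem_slitPlane hz θ) h.1

theorem polarSqrt_ofReal {x : ℝ} (hx : x ∈ Ioo (0 : ℝ) 1) (θ : ℝ) :
    polarSqrt θ x = (√(1 + x * Real.cos θ) : ℝ) := by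
  rw [polarSqrt, Real.sqrt_eq_rpow, Complex.ofReal_cpow (one_add_mul_cos_pos hx θ).le]
  push_cast
  rfl

/-- The coefficient of `ε` in `dr/dt`, multiplied by `√(1 + r cos θ)`. -/
noncomputable def radialPart (n : ℕ) (a b : ℕ → ℕ → ℝ) (θ : ℝ) (z : ℂ) : ℂ :=
  perturbRad n a b (polarSqrt θ z) z (Real.cos θ : ℂ) (Real.sin θ : ℂ)

/-- The coefficient of `ε` in `dθ/dt`, multiplied by `√(1 + r cos θ)`. -/
noncomputable def angularPart (n : ℕ) (a b : ℕ → ℕ → ℝ) (θ : ℝ) (z : ℂ) : ℂ :=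
  perturbAng n a b (polarSqrt θ z) z (Real.cos θ : ℂ) (Real.sin θ : ℂ)

theorem radialPart_ofReal (n : ℕ) (a b : ℕ → ℕ → ℝ) {x : ℝ} (hx : x ∈ Ioo (0 : ℝ) 1) (θ : ℝ) :
    radialPart n a b θ x =
      (perturbRad n a b (√(1 + x * Real.cos θ)) x (Real.cos θ) (Real.sin θ) : ℝ) := by
  rw [radialPart, polarSqrt_ofReal hx, ofReal_perturbRad]

theorem angularPart_ofReal (n : ℕ) (a b : ℕ → ℕ → ℝ) {x : ℝ} (hx : x ∈ Ioo (0 : ℝ) 1) (θ : ℝ) :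
    angularPart n a b θ x =
      (perturbAng n a b (√(1 + x * Real.cos θ)) x (Real.cos θ) (Real.sin θ) : ℝ) := by
  rw [angularPart, polarSqrt_ofReal hx, ofReal_perturbAng]

theorem continuousOn_parts (n : ℕ) (a b : ℕ → ℕ → ℝ) :
    ContinuousOn (Function.uncurry (radialPart n a b)) (univ ×ˢ radii) ∧
      ContinuousOn (Function.uncurry (angularPart n a b)) (univ ×ˢ radii) := by
  refine continuousOn_perturb n a b (w := fun p : ℝ × ℂ => polarSqrt p.1 p.2)
    (r := fun p => p.2) (c := fun p => (Real.cos p.1 : ℂ)) (s := fun p => (Real.sin p.1 : ℂ))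
    ?_ continuousOn_snd ?_ ?_ (fun p hp => polarSqrt_ne_zero hp.2 _)
    (fun p hp => ne_zero_of_mem_radii hp.2)
  · refine ContinuousOn.cpow_const ?_ fun p hp => one_add_mul_cos_mem_slitPlane hp.2 _
    exact (continuous_const.add (continuous_snd.mul
      (Complex.continuous_ofReal.comp (Real.continuous_cos.comp continuous_fst)))).continuousOn
  · exact (Complex.continuous_ofReal.comp (Real.continuous_cos.comp continuous_fst)).continuousOn
  · exact (Complex.continuous_ofReal.comp (Real.continuous_sin.comp continuous_fst)).continuousOn

theorem differentiableOn_parts (n : ℕ) (a b : ℕ → ℕ → ℝ) (θ : ℝ) :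
    DifferentiableOn ℂ (radialPart n a b θ) radii ∧
      DifferentiableOn ℂ (angularPart n a b θ) radii := by
  refine differentiableOn_perturb n a b (w := polarSqrt θ) _ _ ?_
    (fun z hz => polarSqrt_ne_zero hz _) fun z hz => ne_zero_of_mem_radii hz
  refine DifferentiableOn.cpow ?_ (differentiableOn_const _)
    fun z hz => one_add_mul_cos_mem_slitPlane hz _
  exact (differentiableOn_const _).add (differentiableOn_id.mul_const _)

/-- The polar system has a family of solutions near every compact interval of radii. -/
theorem exists_polarFamily (n : ℕ) (a b : ℕ → ℕ → ℝ) {r₁ r₂ : ℝ} (h1 : 0 < r₁) (h12 : r₁ ≤ r₂)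
    (h2 : r₂ < 1) :
    ∃ δ > 0, ∃ ε₁ > 0, ∃ R,
      Metric.thickening (2 * δ) ((fun x : ℝ => (x : ℂ)) '' Icc r₁ r₂) ⊆ radii ∧
      IsSolutionFamily ((fun x : ℝ => (x : ℂ)) '' Icc r₁ r₂) δ ε₁ (√2) (radialPart n a b)
        (angularPart n a b) R := by
  have hrange : ∀ x : ℝ, (x : ℂ) ∈ radii → x ∈ Ioo (0 : ℝ) 1 := fun x hx => ofReal_mem_radii.1 hx
  refine exists_isSolutionFamily (isCompact_Icc.image Complex.continuous_ofReal)
    ?_ ((nonempty_Icc.2 h12).image _) isOpen_radii ?_ (by positivity)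
    (continuousOn_parts n a b).1 (continuousOn_parts n a b).2
    (fun θ => (differentiableOn_parts n a b θ).1) (fun θ => (differentiableOn_parts n a b θ).2)
    (fun z θ => ?_) (fun z θ => ?_) (fun θ x hx => ?_) (fun θ x hx => ?_)
  · exact (convex_Icc r₁ r₂).linear_image Complex.ofRealCLM.toLinearMap
  · rintro _ ⟨x, hx, rfl⟩
    exact ofReal_mem_radii.2 ⟨h1.trans_le hx.1, hx.2.trans_lt h2⟩
  · simp only [radialPart, polarSqrt, Real.cos_add_two_pi, Real.sin_add_two_pi]
  · simp only [angularPart, polarSqrt, Real.cos_add_two_pi, Real.sin_add_two_pi]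
  · rw [radialPart_ofReal n a b (hrange x hx), Complex.ofReal_im]
  · rw [angularPart_ofReal n a b (hrange x hx), Complex.ofReal_im]

/-- On the real axis, the first order term of the displacement is a multiple of the Melnikov
function. -/
theorem integral_radialPart_ofReal (n : ℕ) (a b : ℕ → ℕ → ℝ) {x : ℝ} (hx : x ∈ Ioo (0 : ℝ) 1) :
    ∫ t in (0 : ℝ)..(2 * Real.pi), radialPart n a b t x / (√2 : ℝ) =
      ((ReversibleSystem.melnikov n a b (x ^ 2 - 1) / (2 * x) : ℝ) : ℂ) := by
  have hh : √(1 + (x ^ 2 - 1)) = x := by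
    rw [add_sub_cancel, Real.sqrt_sq hx.1.le]
  rw [melnikov_eq hx hh]
  simp only [radialPart_ofReal n a b hx]
  have h22 : √2 * √2 = 2 := Real.mul_self_sqrt (by norm_num)
  have h20 : √2 ≠ 0 := by positivity
  have hx0 := hx.1.ne'
  simp only [← Complex.ofReal_div]
  rw [intervalIntegral.integral_ofReal, intervalIntegral.integral_div]
  congr 1
  rw [div_eq_div_iff h20 (by positivity)]
  linear_combination (-x * ∫ θ in (0 : ℝ)..(2 * Real.pi),
    perturbRad n a b (√(1 + x * Real.cos θ)) x (Real.cos θ) (Real.sin θ)) * h22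

theorem differentiableOn_integral_radialPart (n : ℕ) (a b : ℕ → ℕ → ℝ) :
    DifferentiableOn ℂ (fun z => ∫ t in (0 : ℝ)..(2 * Real.pi), radialPart n a b t z / (√2 : ℝ))
      radii := by
  intro z hz
  obtain ⟨ρ, hρ, hball⟩ := Metric.nhds_basis_closedBall.mem_iff.1 (isOpen_radii.mem_nhds hz)
  obtain ⟨C, hC⟩ := exists_bound_of_periodic (isCompact_closedBall z ρ) hball
    (continuousOn_parts n a b).1 fun z θ => by
      simp only [radialPart, polarSqrt, Real.cos_add_two_pi, Real.sin_add_two_pi]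
  have hsub : Metric.ball z ρ ⊆ radii := Metric.ball_subset_closedBall.trans hball
  have h := differentiableOn_intervalIntegral (φ := fun t z => radialPart n a b t z / (√2 : ℝ))
    (Metric.isOpen_ball (x := z) (ε := ρ)) (c := 2 * Real.pi) (C := C / √2)
    (fun w hw => ?_) (fun t => ((differentiableOn_parts n a b t).1.mono hsub).div_const _)
    fun t _ w hw => ?_
  · exact (h.differentiableAt (Metric.ball_mem_nhds z hρ)).differentiableWithinAt
  · have h1 : Continuous fun t : ℝ => Function.uncurry (radialPart n a b) (t, w) :=
      (continuousOn_parts n a b).1.comp_continuous (continuous_id.prodMk continuous_const)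
        fun t => mk_mem_prod (mem_univ t) (hsub hw)
    exact h1.div_const _
  · rw [norm_div, Complex.norm_real, Real.norm_eq_abs, abs_of_pos (by positivity : (0 : ℝ) < √2)]
    exact div_le_div_of_nonneg_right (hC t w (Metric.ball_subset_closedBall hw)) (by positivity)

/-- If the Melnikov function does not vanish identically, the first order term of the displacement
has at most `n` zeros among the radii in `(0, 1)`. -/
theorem not_hasZeros_integral_radialPart {n : ℕ} {a b : ℕ → ℕ → ℝ}
    (hM : ∃ h ∈ Ioo (-1 : ℝ) 0, ReversibleSystem.melnikov n a b h ≠ 0)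
    {U : Set ℂ} (hU : IsOpen U)
    (hd : DifferentiableOn ℂ (fun z => ∫ t in (0 : ℝ)..(2 * Real.pi),
      radialPart n a b t z / (√2 : ℝ)) U) {r₁ r₂ : ℝ} (h1 : 0 < r₁) (h2 : r₂ < 1)
    (hIU : (fun x : ℝ => (x : ℂ)) '' Icc r₁ r₂ ⊆ U) :
    ¬ HasZeros (fun z => ∫ t in (0 : ℝ)..(2 * Real.pi), radialPart n a b t z / (√2 : ℝ))
      ((fun x : ℝ => (x : ℂ)) '' Icc r₁ r₂) (n + 1) := by
  obtain ⟨P, hP, hF⟩ := isMelnikovSeries_melnikov n a b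
  have hP0 : P ≠ 0 := by
    rintro rfl
    obtain ⟨h, hh, hne⟩ := hM
    have hr : √(1 + h) ∈ Ioo (0 : ℝ) 1 :=
      ⟨Real.sqrt_pos.2 (by linarith [hh.1]), by
        rw [Real.sqrt_lt' one_pos]; linarith [hh.2]⟩
    have h0 := hF _ hr
    simp only [Real.sq_sqrt (show 0 ≤ 1 + h by linarith [hh.1]), add_sub_cancel_left] at h0
    exact hne (h0.trans (by simp [evenSeries]))
  intro hz
  refine not_hasZeros_evenSeries abs_trigWeight_le trigWeight_pos hP0 ?_
  obtain ⟨S, m, hS, hm, hN⟩ := hz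
  have hre : ∀ z ∈ S, ((z.re : ℝ) : ℂ) = z ∧ z.re ∈ Icc r₁ r₂ := fun z hzS => by
    obtain ⟨x, hx, rfl⟩ := hS hzS
    exact ⟨by simp, by simpa using hx⟩
  refine ⟨S.image Complex.re, fun x => m x, ?_, ?_, ?_⟩
  · intro x hx
    obtain ⟨z, hzS, rfl⟩ := Finset.mem_image.1 hx
    have := (hre z hzS).2
    exact ⟨h1.trans_le this.1, this.2.trans_lt h2⟩
  · intro x hx
    obtain ⟨z, hzS, rfl⟩ := Finset.mem_image.1 hx
    obtain ⟨hzr, hzI⟩ := hre z hzS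
    have hx01 : z.re ∈ Ioo (0 : ℝ) 1 := ⟨h1.trans_le hzI.1, hzI.2.trans_lt h2⟩
    have hE : AnalyticAt ℝ (evenSeries trigWeight P) z.re :=
      analyticOnNhd_evenSeries abs_trigWeight_le P _ hx01
    have hzU : ((z.re : ℝ) : ℂ) ∈ U := hIU ⟨_, hzI, rfl⟩
    have han := hd.analyticAt (hU.mem_nhds hzU)
    have hbig := isBigO_of_le_analyticOrderAt (𝕜 := ℂ) (x := z.re) han
      (m := m z) ((hm z hzS).trans_eq (congrArg _ hzr.symm))
    beta_reduce
    rw [hzr]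
    have hg : AnalyticAt ℝ (fun y : ℝ => y / 2) z.re := analyticAt_id.div_const
    rw [← analyticOrderAt_mul_of_ne_zero hg (by have := hx01.1; positivity) hE]
    refine le_analyticOrderAt_of_isBigO (𝕜 := ℝ) (hg.mul hE) (hbig.norm_left.congr' ?_
      EventuallyEq.rfl |>.of_norm_left)
    filter_upwards [isOpen_Ioo.mem_nhds hx01] with y hy
    have hFy := hF y hy
    beta_reduce at hFy
    simp only [RCLike.ofReal_real_eq_id, id_eq]
    have hcast : ((y : ℝ) : ℂ) = (RCLike.ofReal y : ℂ) := rfl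
    rw [← hcast, integral_radialPart_ofReal n a b hy, hFy, Complex.norm_real]
    have := hy.1.ne'
    congr 1
    simp only [Pi.mul_apply]
    field_simp
  · rw [Finset.sum_image fun z hz w hw h => by
      rw [← (hre z hz).1, ← (hre w hw).1, h]]
    refine le_trans (Nat.add_le_add_right hP 1) (hN.trans (Finset.sum_le_sum fun z hz => ?_))
    rw [(hre z hz).1]

end ComplexRadius

/-! ### Solutions of the perturbed system from solutions of the polar system -/

section PolarFlow

open Set Filter MeasureTheory PlanarSystem ReversibleSystem

/-- The radius at angle `θ` on the solution that starts at the real radius `x`. -/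
noncomputable def radius (R : ℝ → ℝ → ℂ → ℂ) (ε x θ : ℝ) : ℝ := (R ε θ x).re

/-- The derivative of time with respect to the angle. -/
noncomputable def timeDensity (n : ℕ) (a b : ℕ → ℕ → ℝ) (R : ℝ → ℝ → ℂ → ℂ) (ε x θ : ℝ) : ℝ :=
  √(1 + radius R ε x θ * Real.cos θ) / (√2 + ε * (angularPart n a b θ (R ε θ x)).re)

/-- The time at which the solution that starts at the radius `x` reaches the angle `θ`. The family
`R` solves the polar system for `|θ| ≤ 14` only, and the clamped angle makes the integrand bounded
below by a positive constant. -/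
noncomputable def polarTime (n : ℕ) (a b : ℕ → ℕ → ℝ) (R : ℝ → ℝ → ℂ → ℂ) (ε x θ : ℝ) : ℝ :=
  ∫ t in (0 : ℝ)..θ, timeDensity n a b R ε x (clampAngle t)

variable {n : ℕ} {a b : ℕ → ℕ → ℝ} {I : Set ℂ} {δ ε₁ : ℝ} {R : ℝ → ℝ → ℂ → ℂ}

theorem ofReal_radius (hR : IsSolutionFamily I δ ε₁ (√2) (radialPart n a b) (angularPart n a b) R)
    {ε x : ℝ} (hε : |ε| < ε₁) (hx : (x : ℂ) ∈ Metric.thickening δ I) (θ : ℝ) :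
    ((radius R ε x θ : ℝ) : ℂ) = R ε θ x :=
  Complex.ext (by simp [radius]) (by simpa using (hR.im ε hε x hx θ).symm)

theorem radius_mem (hR : IsSolutionFamily I δ ε₁ (√2) (radialPart n a b) (angularPart n a b) R)
    (hU : Metric.thickening (2 * δ) I ⊆ radii)
    {ε x : ℝ} (hε : |ε| < ε₁) (hx : (x : ℂ) ∈ Metric.thickening δ I) (θ : ℝ) :
    radius R ε x θ ∈ Ioo (0 : ℝ) 1 := by
  rw [← ofReal_mem_radii, ofReal_radius hR hε hx]
  exact hU (hR.mem ε hε x hx θ)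

theorem radius_zero (hR : IsSolutionFamily I δ ε₁ (√2) (radialPart n a b) (angularPart n a b) R)
    {ε x : ℝ} (hε : |ε| < ε₁) (hx : (x : ℂ) ∈ Metric.thickening δ I) : radius R ε x 0 = x := by
  have h0 : clampAngle 0 = 0 := clampAngle_of_mem ⟨by norm_num, by norm_num⟩
  rw [radius, hR.eqn ε hε x hx, h0, intervalIntegral.integral_same]
  simp

theorem angularPart_radius
    (hR : IsSolutionFamily I δ ε₁ (√2) (radialPart n a b) (angularPart n a b) R)
    (hU : Metric.thickening (2 * δ) I ⊆ radii)
    {ε x : ℝ} (hε : |ε| < ε₁) (hx : (x : ℂ) ∈ Metric.thickening δ I) (θ : ℝ) :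
    angularPart n a b θ (R ε θ x) =
      (perturbAng n a b (√(1 + radius R ε x θ * Real.cos θ)) (radius R ε x θ) (Real.cos θ)
        (Real.sin θ) : ℝ) := by
  rw [← angularPart_ofReal n a b (radius_mem hR hU hε hx θ), ofReal_radius hR hε hx]

theorem radialPart_radius
    (hR : IsSolutionFamily I δ ε₁ (√2) (radialPart n a b) (angularPart n a b) R)
    (hU : Metric.thickening (2 * δ) I ⊆ radii)
    {ε x : ℝ} (hε : |ε| < ε₁) (hx : (x : ℂ) ∈ Metric.thickening δ I) (θ : ℝ) :
    radialPart n a b θ (R ε θ x) =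
      (perturbRad n a b (√(1 + radius R ε x θ * Real.cos θ)) (radius R ε x θ) (Real.cos θ)
        (Real.sin θ) : ℝ) := by
  rw [← radialPart_ofReal n a b (radius_mem hR hU hε hx θ), ofReal_radius hR hε hx]

theorem half_sqrt_two_le_denom
    (hR : IsSolutionFamily I δ ε₁ (√2) (radialPart n a b) (angularPart n a b) R)
    {ε x : ℝ} (hε : |ε| < ε₁) (hx : (x : ℂ) ∈ Metric.thickening δ I) (θ : ℝ) :
    √2 / 2 ≤ √2 + ε * (angularPart n a b θ (R ε θ x)).re := by
  have h1 := hR.denom ε hε θ _ (hR.mem ε hε x hx θ)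
  have h2 := (Complex.abs_re_le_norm ((ε : ℂ) * angularPart n a b θ (R ε θ x))).trans h1
  rw [Complex.re_ofReal_mul] at h2
  linarith [(abs_le.1 h2).1]

theorem continuous_parts
    (hR : IsSolutionFamily I δ ε₁ (√2) (radialPart n a b) (angularPart n a b) R)
    (hU : Metric.thickening (2 * δ) I ⊆ radii)
    {ε x : ℝ} (hε : |ε| < ε₁) (hx : (x : ℂ) ∈ Metric.thickening δ I) :
    Continuous (fun θ => radialPart n a b θ (R ε θ x)) ∧
      Continuous (fun θ => angularPart n a b θ (R ε θ x)) := by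
  have h1 : Continuous fun θ : ℝ => (θ, R ε θ x) := continuous_id.prodMk (hR.cont ε hε x hx)
  have h2 : ∀ θ : ℝ, (θ, R ε θ x) ∈ univ ×ˢ radii :=
    fun θ => mk_mem_prod (mem_univ θ) (hU (hR.mem ε hε x hx θ))
  have h3 : Continuous fun θ : ℝ => Function.uncurry (radialPart n a b) (θ, R ε θ x) :=
    (continuousOn_parts n a b).1.comp_continuous h1 h2
  have h4 : Continuous fun θ : ℝ => Function.uncurry (angularPart n a b) (θ, R ε θ x) :=
    (continuousOn_parts n a b).2.comp_continuous h1 h2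
  exact ⟨h3, h4⟩

theorem continuous_radius
    (hR : IsSolutionFamily I δ ε₁ (√2) (radialPart n a b) (angularPart n a b) R)
    {ε x : ℝ} (hε : |ε| < ε₁) (hx : (x : ℂ) ∈ Metric.thickening δ I) :
    Continuous (radius R ε x) := Complex.continuous_re.comp (hR.cont ε hε x hx)

/-- The polar equation for the real radius. -/
theorem hasDerivAt_radius
    (hR : IsSolutionFamily I δ ε₁ (√2) (radialPart n a b) (angularPart n a b) R)
    (hU : Metric.thickening (2 * δ) I ⊆ radii)
    {ε x : ℝ} (hε : |ε| < ε₁) (hx : (x : ℂ) ∈ Metric.thickening δ I) {θ : ℝ} (hθ : |θ| < 14) :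
    HasDerivAt (radius R ε x)
      (ε * ((radialPart n a b θ (R ε θ x)).re / (√2 + ε * (angularPart n a b θ (R ε θ x)).re)))
      θ := by
  obtain ⟨hc1, hc2⟩ := continuous_parts hR hU hε hx
  set q : ℝ → ℝ := fun θ =>
    (radialPart n a b θ (R ε θ x)).re / (√2 + ε * (angularPart n a b θ (R ε θ x)).re) with hq
  have hs : (0 : ℝ) < √2 := by positivity
  have hqc : Continuous q := (Complex.continuous_re.comp hc1).div
    (continuous_const.add (continuous_const.mul (Complex.continuous_re.comp hc2)))
    fun t => ne_of_gt (lt_of_lt_of_le (by positivity) (half_sqrt_two_le_denom hR hε hx t))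
  have heq : ∀ θ, radius R ε x θ = x + ε * ∫ t in (0 : ℝ)..clampAngle θ, q t := fun θ => by
    have h1 : ∀ t, radialPart n a b t (R ε t x) /
        (((√2 : ℝ) : ℂ) + ε * angularPart n a b t (R ε t x)) =
        (q t : ℝ) := fun t => by
      simp only [hq]
      rw [radialPart_radius hR hU hε hx, angularPart_radius hR hU hε hx]
      push_cast
      rfl
    have h2 := hR.eqn ε hε x hx θ
    simp only [h1] at h2
    rw [intervalIntegral.integral_ofReal, ← ofReal_radius hR hε hx] at h2
    exact_mod_cast h2
  have hd : HasDerivAt (fun θ => x + ε * ∫ t in (0 : ℝ)..θ, q t) (ε * q θ) θ :=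
    ((hqc.integral_hasStrictDerivAt 0 θ).hasDerivAt.const_mul ε).const_add x
  refine hd.congr_of_eventuallyEq ?_
  have : ∀ᶠ t in 𝓝 θ, t ∈ Ioo (-14 : ℝ) 14 := isOpen_Ioo.mem_nhds (abs_lt.1 hθ)
  filter_upwards [this] with t ht
  rw [heq, clampAngle_of_mem ⟨ht.1.le, ht.2.le⟩]

theorem continuous_timeDensity
    (hR : IsSolutionFamily I δ ε₁ (√2) (radialPart n a b) (angularPart n a b) R)
    (hU : Metric.thickening (2 * δ) I ⊆ radii)
    {ε x : ℝ} (hε : |ε| < ε₁) (hx : (x : ℂ) ∈ Metric.thickening δ I) :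
    Continuous (timeDensity n a b R ε x) := by
  have hs : (0 : ℝ) < √2 := by positivity
  refine Continuous.div ?_ (continuous_const.add (continuous_const.mul
    (Complex.continuous_re.comp (continuous_parts hR hU hε hx).2)))
    fun t => ne_of_gt (lt_of_lt_of_le (by positivity) (half_sqrt_two_le_denom hR hε hx t))
  exact (continuous_const.add ((continuous_radius hR hε hx).mul Real.continuous_cos)).sqrt

theorem timeDensity_pos (hR : IsSolutionFamily I δ ε₁ (√2) (radialPart n a b) (angularPart n a b) R)
    (hU : Metric.thickening (2 * δ) I ⊆ radii)
    {ε x : ℝ} (hε : |ε| < ε₁) (hx : (x : ℂ) ∈ Metric.thickening δ I) (θ : ℝ) :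
    0 < timeDensity n a b R ε x θ := by
  have hs : (0 : ℝ) < √2 := by positivity
  exact div_pos (Real.sqrt_pos.2 (one_add_mul_cos_pos (radius_mem hR hU hε hx θ) θ))
    (lt_of_lt_of_le (by positivity) (half_sqrt_two_le_denom hR hε hx θ))

theorem timeDensity_le (hR : IsSolutionFamily I δ ε₁ (√2) (radialPart n a b) (angularPart n a b) R)
    (hU : Metric.thickening (2 * δ) I ⊆ radii)
    {ε x : ℝ} (hε : |ε| < ε₁) (hx : (x : ℂ) ∈ Metric.thickening δ I) (θ : ℝ) :
    timeDensity n a b R ε x θ ≤ 2 := by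
  have hs : (0 : ℝ) < √2 := by positivity
  have h1 := half_sqrt_two_le_denom hR hε hx θ
  rw [timeDensity, div_le_iff₀ (lt_of_lt_of_le (by positivity) h1)]
  have h2 : √(1 + radius R ε x θ * Real.cos θ) ≤ √2 := by
    have hr := radius_mem hR hU hε hx θ
    have := Real.cos_le_one θ
    exact Real.sqrt_le_sqrt (by nlinarith [hr.1, hr.2])
  linarith

theorem strictMono_polarTime
    (hR : IsSolutionFamily I δ ε₁ (√2) (radialPart n a b) (angularPart n a b) R)
    (hU : Metric.thickening (2 * δ) I ⊆ radii)
    {ε x : ℝ} (hε : |ε| < ε₁) (hx : (x : ℂ) ∈ Metric.thickening δ I) :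
    StrictMono (polarTime n a b R ε x) :=
  strictMono_of_deriv_pos fun θ => by
    have hc := (continuous_timeDensity hR hU hε hx).comp continuous_clampAngle
    have hd : HasDerivAt (polarTime n a b R ε x) (timeDensity n a b R ε x (clampAngle θ)) θ :=
      (hc.integral_hasStrictDerivAt 0 θ).hasDerivAt
    rw [hd.deriv]
    exact timeDensity_pos hR hU hε hx _

/-- The solution that starts at the radius `x` on the section `θ = 0`, with the angle as a function
of time. -/
theorem exists_polarFlow
    (hR : IsSolutionFamily I δ ε₁ (√2) (radialPart n a b) (angularPart n a b) R)
    (hU : Metric.thickening (2 * δ) I ⊆ radii)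
    {ε x : ℝ} (hε : |ε| < ε₁) (hx : (x : ℂ) ∈ Metric.thickening δ I) :
    ∃ Θ : ℝ → ℝ, StrictMono Θ ∧ (∀ θ, Θ (polarTime n a b R ε x θ) = θ) ∧
      ∀ t, |Θ t| < 14 →
        HasDerivAt (fun s => (polarX (radius R ε x (Θ s)) (Θ s), polarY (radius R ε x (Θ s)) (Θ s)))
          (field n a b ε (polarX (radius R ε x (Θ t)) (Θ t), polarY (radius R ε x (Θ t)) (Θ t)))
          t := by
  have hc := (continuous_timeDensity hR hU hε hx).comp continuous_clampAngle
  obtain ⟨c, hc0, hck⟩ : ∃ c > 0, ∀ θ, c ≤ timeDensity n a b R ε x (clampAngle θ) := by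
    obtain ⟨t₀, -, ht₀⟩ := (isCompact_Icc (a := (-14 : ℝ)) (b := 14)).exists_isMinOn
      ⟨0, by norm_num, by norm_num⟩ (continuous_timeDensity hR hU hε hx).continuousOn
    exact ⟨_, timeDensity_pos hR hU hε hx t₀, fun θ => ht₀ (clampAngle_mem θ)⟩
  obtain ⟨Θ, hmono, hinv, hder⟩ := exists_inverse_of_primitive hc hc0 hck
  refine ⟨Θ, hmono, hinv, fun t ht => ?_⟩
  have hmem := radius_mem hR hU hε hx (Θ t)
  have hw : 0 < √(1 + radius R ε x (Θ t) * Real.cos (Θ t)) :=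
    Real.sqrt_pos.2 (one_add_mul_cos_pos hmem _)
  have hden : 0 < √2 + ε * (angularPart n a b (Θ t) (R ε (Θ t) x)).re :=
    lt_of_lt_of_le (by positivity) (half_sqrt_two_le_denom hR hε hx _)
  have hΘ : HasDerivAt Θ ((√2 + ε * (angularPart n a b (Θ t) (R ε (Θ t) x)).re) /
      √(1 + radius R ε x (Θ t) * Real.cos (Θ t))) t := by
    refine (hder t).congr_deriv ?_
    have : clampAngle (Θ t) = Θ t :=
      clampAngle_of_mem ⟨(abs_lt.1 ht).1.le, (abs_lt.1 ht).2.le⟩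
    rw [Function.comp_apply, this, timeDensity, inv_div]
  refine hasDerivAt_polar hmem rfl ?_ ?_
  · refine ((hasDerivAt_radius hR hU hε hx ht).comp t hΘ).congr_deriv ?_
    rw [radialPart_radius hR hU hε hx, Complex.ofReal_re]
    field_simp
  · refine hΘ.congr_deriv ?_
    rw [angularPart_radius hR hU hε hx, Complex.ofReal_re]

theorem continuousAt_polarTime
    (hR : IsSolutionFamily I δ ε₁ (√2) (radialPart n a b) (angularPart n a b) R)
    (hU : Metric.thickening (2 * δ) I ⊆ radii)
    {ε x : ℝ} (hε : |ε| < ε₁) (hx : (x : ℂ) ∈ Metric.thickening δ I) (θ : ℝ) :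
    ContinuousAt (fun y => polarTime n a b R ε y θ) x := by
  have hnhds : ∀ᶠ y : ℝ in 𝓝 x, (y : ℂ) ∈ Metric.thickening δ I :=
    Complex.continuous_ofReal.continuousAt.eventually (Metric.isOpen_thickening.mem_nhds hx)
  refine intervalIntegral.continuousAt_of_dominated_interval (bound := fun _ => 2) ?_ ?_
    intervalIntegrable_const ?_
  · filter_upwards [hnhds] with y hy
    exact ((continuous_timeDensity hR hU hε hy).comp continuous_clampAngle).aestronglyMeasurable
  · filter_upwards [hnhds] with y hy
    refine Eventually.of_forall fun t _ => ?_
    rw [Real.norm_eq_abs, abs_of_pos (timeDensity_pos hR hU hε hy _)]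
    exact timeDensity_le hR hU hε hy _
  · refine Eventually.of_forall fun t _ => ?_
    have h1 : ContinuousAt (fun y : ℝ => R ε (clampAngle t) y) x :=
      ((hR.diff ε hε (clampAngle t)).differentiableAt
        (Metric.isOpen_thickening.mem_nhds hx)).continuousAt.comp
          Complex.continuous_ofReal.continuousAt
    have h2 : ContinuousAt
        (fun y : ℝ => angularPart n a b (clampAngle t) (R ε (clampAngle t) y)) x :=
      ContinuousAt.comp (f := fun y : ℝ => R ε (clampAngle t) y)
        ((differentiableOn_parts n a b (clampAngle t)).2.differentiableAt
          (isOpen_radii.mem_nhds (hU (hR.mem ε hε x hx _)))).continuousAt h1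
    have hs : (0 : ℝ) < √2 := by positivity
    refine ContinuousAt.div ?_ (continuousAt_const.add (continuousAt_const.mul
      (Complex.continuous_re.continuousAt.comp h2)))
      (ne_of_gt (lt_of_lt_of_le (by positivity) (half_sqrt_two_le_denom hR hε hx _)))
    exact (continuousAt_const.add ((Complex.continuous_re.continuousAt.comp h1).mul
      continuousAt_const)).sqrt

end PolarFlow

/-! ### Periodic orbits and zeros of the displacement of the polar system -/

section PolarReturn

open Set Filter MeasureTheory PlanarSystem ReversibleSystem

theorem polarX_eq_of_sin_eq_zero {r : ℝ} (hr : r ∈ Ioo (0 : ℝ) 1) {θ : ℝ} (h1 : 0 < θ)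
    (h2 : θ < 3 * Real.pi) (hy : polarY r θ = 0) :
    (θ = Real.pi ∧ 1 < polarX r θ) ∨ (θ = 2 * Real.pi ∧ polarX r θ = 1 / (1 + r)) := by
  have hpi := Real.pi_pos
  have hw := Real.sqrt_pos.2 (one_add_mul_cos_pos hr θ)
  have h20 : √2 ≠ 0 := by positivity
  have hs : Real.sin θ = 0 := by
    rw [polarY, div_eq_zero_iff] at hy
    have := hy.resolve_right (pow_ne_zero 3 hw.ne')
    exact (mul_eq_zero.1 this).resolve_left (mul_ne_zero h20 hr.1.ne')
  obtain ⟨k, rfl⟩ := Real.sin_eq_zero_iff.1 hs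
  have hk1 : 0 < k := by
    have : (0 : ℝ) < k := by by_contra! h; nlinarith
    exact_mod_cast this
  have hk2 : k < 3 := by
    have : (k : ℝ) < 3 := lt_of_mul_lt_mul_right h2 hpi.le
    exact_mod_cast this
  obtain rfl | rfl : k = 1 ∨ k = 2 := by omega
  · left
    refine ⟨by simp, ?_⟩
    have : 0 < 1 + r * -1 := by linarith [hr.2]
    rw [polarX, Int.cast_one, one_mul, Real.cos_pi, lt_div_iff₀ this]
    linarith [hr.1]
  · right
    refine ⟨by simp, ?_⟩
    rw [polarX, Int.cast_ofNat, Real.cos_two_pi, mul_one]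

theorem polar_two_pi (r : ℝ) :
    (polarX r (2 * Real.pi), polarY r (2 * Real.pi)) = (1 / (1 + r), 0) := by
  simp [polarX, polarY]

variable {n : ℕ} {a b : ℕ → ℕ → ℝ} {I : Set ℂ} {δ ε₁ : ℝ} {R : ℝ → ℝ → ℂ → ℂ}

/-- Every solution that starts on the section is described by the polar system for as long as the
angle is less than `14`. -/
theorem eq_polar_of_solution
    (hR : IsSolutionFamily I δ ε₁ (√2) (radialPart n a b) (angularPart n a b) R)
    (hU : Metric.thickening (2 * δ) I ⊆ radii)
    {ε x : ℝ} (hε : |ε| < ε₁) (hx : (x : ℂ) ∈ Metric.thickening δ I) :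
    ∃ Θ : ℝ → ℝ, StrictMono Θ ∧ Θ 0 = 0 ∧ (∀ θ, Θ (polarTime n a b R ε x θ) = θ) ∧
      ∀ τ, Θ τ < 14 → ∀ φ : ℝ → ℝ × ℝ,
        (∀ t ∈ Icc 0 τ, HasDerivWithinAt φ (field n a b ε (φ t)) (Icc 0 τ) t) →
        φ 0 = (1 / (1 + x), 0) → ∀ t ∈ Icc 0 τ,
          φ t = (polarX (radius R ε x (Θ t)) (Θ t), polarY (radius R ε x (Θ t)) (Θ t)) := by
  obtain ⟨Θ, hmono, hinv, hder⟩ := exists_polarFlow hR hU hε hx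
  have h0 : Θ 0 = 0 := by
    have := hinv 0
    rwa [polarTime, intervalIntegral.integral_same] at this
  refine ⟨Θ, hmono, h0, hinv, fun τ hτ φ hφ hφ0 => ?_⟩
  refine eqOn_of_hasDerivWithinAt (contDiff_field n a b ε) hφ (fun t ht => ?_) ?_
  · refine (hder t (abs_lt.2 ⟨?_, ?_⟩)).hasDerivWithinAt
    · have := hmono.monotone ht.1
      linarith
    · exact (hmono.monotone ht.2).trans_lt hτ
  · rw [hφ0, h0, radius_zero hR hε hx]
    simp [polarX, polarY]

/-- The return map of the polar system maps a point of a periodic orbit to a point of the same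
periodic orbit. -/
theorem return_mem (hR : IsSolutionFamily I δ ε₁ (√2) (radialPart n a b) (angularPart n a b) R)
    (hU : Metric.thickening (2 * δ) I ⊆ radii)
    {ε x : ℝ} (hε : |ε| < ε₁) (hx : (x : ℂ) ∈ Metric.thickening δ I) {γ : Set (ℝ × ℝ)}
    (hγ : IsPeriodicOrbit (field n a b ε) γ) (hp : (1 / (1 + x), (0 : ℝ)) ∈ γ) :
    (1 / (1 + radius R ε x (2 * Real.pi)), (0 : ℝ)) ∈ γ := by
  obtain ⟨Θ, hmono, h0, hinv, hsol⟩ := eq_polar_of_solution hR hU hε hx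
  obtain ⟨φ, hφ, hφ0, hφγ⟩ := exists_solution_of_mem hγ hp
  have hpi := Real.pi_pos
  have hpi4 := Real.pi_lt_four
  have hT : 0 ≤ polarTime n a b R ε x (2 * Real.pi) := by
    rw [← hmono.le_iff_le, hinv, h0]; positivity
  have h := hsol _ (by rw [hinv]; linarith) φ (fun t _ => (hφ t).hasDerivWithinAt) hφ0 _
    (right_mem_Icc.2 hT)
  rw [hinv, polar_two_pi] at h
  rw [← h]
  exact hφγ _

theorem minimalPeriod_eq
    (hR : IsSolutionFamily I δ ε₁ (√2) (radialPart n a b) (angularPart n a b) R)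
    (hU : Metric.thickening (2 * δ) I ⊆ radii)
    {ε x : ℝ} (hε : |ε| < ε₁) (hx : (x : ℂ) ∈ Metric.thickening δ I)
    (hfix : radius R ε x (2 * Real.pi) = x) {T : ℝ}
    (hT : IsMinimalPeriod (field n a b ε) (1 / (1 + x), 0) T) :
    T = polarTime n a b R ε x (2 * Real.pi) := by
  obtain ⟨Θ, hmono, h0, hinv, hsol⟩ := eq_polar_of_solution hR hU hε hx
  obtain ⟨hT0, φ, hφ, hφ0, hφT, hne⟩ := hT
  have hpi := Real.pi_pos
  have hpi4 := Real.pi_lt_four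
  rcases lt_trichotomy T (polarTime n a b R ε x (2 * Real.pi)) with h | h | h
  · exfalso
    have hΘ1 : Θ T < 2 * Real.pi := by rw [← hinv (2 * Real.pi)]; exact hmono h
    have hΘ0 : 0 < Θ T := by rw [← h0]; exact hmono hT0
    have h1 := hsol T (by linarith) φ (fun t _ => (hφ t).hasDerivWithinAt) hφ0 T
      (right_mem_Icc.2 hT0.le)
    rw [hφT, Prod.mk.injEq] at h1
    have hmem := radius_mem hR hU hε hx (Θ T)
    rcases polarX_eq_of_sin_eq_zero hmem hΘ0 (by linarith) h1.2.symm with h2 | h2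
    · have hx0 : 0 < x := by
        rw [← radius_zero hR hε hx]
        exact (radius_mem hR hU hε hx 0).1
      rw [← h1.1, lt_div_iff₀ (by linarith)] at h2
      linarith [h2.2]
    · linarith [h2.1]
  · exact h
  · exfalso
    have hpos : 0 < polarTime n a b R ε x (2 * Real.pi) := by
      rw [← hmono.lt_iff_lt, hinv, h0]; positivity
    have h1 := hsol _ (by rw [hinv]; linarith) φ (fun t _ => (hφ t).hasDerivWithinAt) hφ0 _
      (right_mem_Icc.2 hpos.le)
    rw [hinv, polar_two_pi, hfix] at h1
    exact hne _ ⟨hpos, h⟩ h1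

/-- The displacement function on the section `s ↦ (1 / (1 + x) + s, 0)` and the displacement of the
polar system vanish to the same order. -/
theorem isBigO_of_displacementVanishes
    (hR : IsSolutionFamily I δ ε₁ (√2) (radialPart n a b) (angularPart n a b) R)
    (hU : Metric.thickening (2 * δ) I ⊆ radii)
    {ε x : ℝ} (hε : |ε| < ε₁) (hx : (x : ℂ) ∈ Metric.thickening δ I)
    (hfix : radius R ε x (2 * Real.pi) = x) {γ : Set (ℝ × ℝ)}
    (hp : (1 / (1 + x), (0 : ℝ)) ∈ γ)
    (hpos : ∀ q ∈ γ, 0 < angMom q (field n a b ε q)) {m : ℕ}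
    (hm : DisplacementVanishes (field n a b ε) γ m) :
    (fun ρ => radius R ε ρ (2 * Real.pi) - ρ) =O[𝓝 x] fun ρ => (ρ - x) ^ m := by
  have hpi := Real.pi_pos
  have hpi4 := Real.pi_lt_four
  have hx01 : x ∈ Ioo (0 : ℝ) 1 := by
    rw [← radius_zero hR hε hx]
    exact radius_mem hR hU hε hx 0
  have htr : IsTransversal (field n a b ε) (1 / (1 + x), 0) (1, 0) := by
    have h1 := hpos _ hp
    intro h2
    have h3 : (field n a b ε (1 / (1 + x), 0)).2 = 0 := by simpa using h2
    rw [angMom, h3] at h1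
    simp at h1
  obtain ⟨P, ⟨τ, hτmin, hτc, hτ⟩, hO⟩ := hm _ hp _ htr
  have hτ0 := minimalPeriod_eq hR hU hε hx hfix hτmin
  set σ : ℝ → ℝ := fun ρ => 1 / (1 + ρ) - 1 / (1 + x) with hσ
  have hσc : ContinuousAt σ x :=
    (continuousAt_const.div (continuousAt_const.add continuousAt_id)
      (show (1 : ℝ) + x ≠ 0 by have := hx01.1; positivity)).sub continuousAt_const
  have hσ0 : σ x = 0 := sub_self _
  have hσt : Tendsto σ (𝓝 x) (𝓝 0) := by
    have := hσc.tendsto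
    rwa [hσ0] at this
  have hnhds : ∀ᶠ y : ℝ in 𝓝 x, (y : ℂ) ∈ Metric.thickening δ I :=
    Complex.continuous_ofReal.continuousAt.eventually (Metric.isOpen_thickening.mem_nhds hx)
  have hτσ : Tendsto (fun ρ => τ (σ ρ)) (𝓝 x) (𝓝 (polarTime n a b R ε x (2 * Real.pi))) := by
    rw [← hτ0]; exact hτc.tendsto.comp hσt
  have hsm := strictMono_polarTime hR hU hε hx
  have hlow : ∀ᶠ ρ in 𝓝 x, polarTime n a b R ε ρ Real.pi < τ (σ ρ) :=
    (continuousAt_polarTime hR hU hε hx Real.pi).tendsto.eventually_lt hτσ (hsm (by linarith))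
  have hupp : ∀ᶠ ρ in 𝓝 x, τ (σ ρ) < polarTime n a b R ε ρ (3 * Real.pi) :=
    hτσ.eventually_lt (continuousAt_polarTime hR hU hε hx (3 * Real.pi)).tendsto
      (hsm (by linarith))
  have hbig1 : (fun ρ => radius R ε ρ (2 * Real.pi) - ρ) =O[𝓝 x]
      fun ρ => P (σ ρ) - σ ρ := by
    refine Asymptotics.IsBigO.of_bound 4 ?_
    filter_upwards [hnhds, hlow, hupp, hσt.eventually hτ] with ρ hρ h1 h2 h3
    obtain ⟨φ, hφ, hφ0, hφτ⟩ := h3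
    obtain ⟨Θ, hmono, h0, hinv, hsol⟩ := eq_polar_of_solution hR hU hε hρ
    have hρ01 : ρ ∈ Ioo (0 : ℝ) 1 := by
      rw [← radius_zero hR hε hρ]
      exact radius_mem hR hU hε hρ 0
    have hΘ1 : Real.pi < Θ (τ (σ ρ)) := by
      have := hmono h1
      rwa [hinv] at this
    have hΘ2 : Θ (τ (σ ρ)) < 3 * Real.pi := by
      have := hmono h2
      rwa [hinv] at this
    have hτpos : 0 ≤ τ (σ ρ) := by
      rw [← hmono.le_iff_le, h0]; linarith
    have h4 := hsol _ (by linarith) φ hφ (by rw [hφ0]; simp [hσ]) _ (right_mem_Icc.2 hτpos)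
    rw [hφτ, Prod.ext_iff] at h4
    simp only [Prod.smul_mk, Prod.mk_add_mk, smul_eq_mul, mul_zero, add_zero, mul_one] at h4
    have hr := radius_mem hR hU hε hρ (Θ (τ (σ ρ)))
    rcases polarX_eq_of_sin_eq_zero hr (by linarith) hΘ2 h4.2.symm with h5 | h5
    · linarith [h5.1]
    · have h6 := h4.1
      rw [h5.2, h5.1] at h6
      have hr2 := radius_mem hR hU hε hρ (2 * Real.pi)
      set r := radius R ε ρ (2 * Real.pi) with hrdef
      have hr1 : 0 < 1 + r := by linarith [hr2.1]
      have hρ1 : 0 < 1 + ρ := by linarith [hρ01.1]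
      have h7 : r - ρ = -(P (σ ρ) - σ ρ) * ((1 + r) * (1 + ρ)) := by
        have h8 : P (σ ρ) - σ ρ = 1 / (1 + r) - 1 / (1 + ρ) := by
          simp only [hσ] at h6 ⊢
          linarith
        rw [h8]
        field_simp
        ring
      rw [h7, norm_mul, norm_neg, mul_comm]
      refine mul_le_mul_of_nonneg_right ?_ (norm_nonneg _)
      rw [Real.norm_eq_abs, abs_of_pos (by positivity)]
      nlinarith [hr2.2, hρ01.2]
  have hbig2 : σ =O[𝓝 x] fun ρ => ρ - x := by
    refine Asymptotics.IsBigO.of_bound 1 ?_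
    filter_upwards [isOpen_Ioo.mem_nhds hx01] with ρ hρ
    have h1 : 0 < 1 + ρ := by linarith [hρ.1]
    have h2 : 0 < 1 + x := by linarith [hx01.1]
    have h3 : σ ρ = -(ρ - x) / ((1 + ρ) * (1 + x)) := by
      simp only [hσ]
      field_simp
      ring
    rw [h3, norm_div, norm_neg, one_mul]
    refine div_le_self (norm_nonneg _) ?_
    rw [Real.norm_eq_abs, abs_of_pos (by positivity)]
    nlinarith [hρ.1, hx01.1]
  exact hbig1.trans ((hO.comp_tendsto hσt).trans (hbig2.pow m))

theorem sqrt_one_add_H_section {ρ : ℝ} (hρ : 0 < ρ) : √(1 + H (1 / (1 + ρ), 0)) = ρ := by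
  have h1 : (1 : ℝ) + ρ ≠ 0 := by positivity
  have h2 : 1 + H (1 / (1 + ρ), 0) = ρ ^ 2 := by
    rw [H]
    field_simp
    ring
  rw [h2, Real.sqrt_sq hρ.le]

/-- A periodic orbit in `K` meets the section at a fixed point of the return map of the polar
system: this map is monotone, and it maps the compact set of the intersections to itself. -/
theorem exists_fixed_radius {r₁ r₂ : ℝ}
    (hR : IsSolutionFamily ((fun x : ℝ => (x : ℂ)) '' Icc r₁ r₂) δ ε₁ (√2) (radialPart n a b)
      (angularPart n a b) R) (hδ : 0 < δ)
    (hU : Metric.thickening (2 * δ) ((fun x : ℝ => (x : ℂ)) '' Icc r₁ r₂) ⊆ radii)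
    {ε : ℝ} (hε : |ε| < ε₁) {K : Set (ℝ × ℝ)} (hKA : K ⊆ annulus)
    (hKr : ∀ q ∈ K, √(1 + H q) ∈ Icc r₁ r₂) {γ : Set (ℝ × ℝ)}
    (hγ : IsPeriodicOrbit (field n a b ε) γ) (hγK : γ ⊆ K)
    (hpos : ∀ q ∈ γ, 0 < angMom q (field n a b ε q)) :
    ∃ x ∈ Icc r₁ r₂, (1 / (1 + x), (0 : ℝ)) ∈ γ ∧ radius R ε x (2 * Real.pi) = x := by
  have hth : ∀ x ∈ Icc r₁ r₂,
      (x : ℂ) ∈ Metric.thickening δ ((fun x : ℝ => (x : ℂ)) '' Icc r₁ r₂) :=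
    fun x hx => Metric.self_subset_thickening hδ _ ⟨x, hx, rfl⟩
  have hpos' : ∀ x ∈ Icc r₁ r₂, 0 < x := fun x hx => by
    rw [← radius_zero hR hε (hth x hx)]
    exact (radius_mem hR hU hε (hth x hx) 0).1
  set g : ℝ → ℝ := fun x => radius R ε x (2 * Real.pi) with hg
  have hgmono : ∀ x ∈ Icc r₁ r₂, ∀ y ∈ Icc r₁ r₂, x ≤ y → g x ≤ g y := fun x hx y hy hxy => by
    have h1 := (hR.lip ε hε _ (hth y hy) _ (hth x hx) (2 * Real.pi)).2
    have h2 : R ε (2 * Real.pi) y - R ε (2 * Real.pi) x - ((y : ℂ) - x) =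
        ((g y - g x - (y - x) : ℝ) : ℂ) := by
      push_cast
      simp only [hg]
      rw [ofReal_radius hR hε (hth x hx), ofReal_radius hR hε (hth y hy)]
    rw [h2, ← Complex.ofReal_sub, Complex.norm_real, Complex.norm_real, Real.norm_eq_abs,
      Real.norm_eq_abs, abs_of_nonneg (sub_nonneg.2 hxy)] at h1
    linarith [(abs_le.1 h1).1]
  have hgc : ContinuousOn g (Icc r₁ r₂) := fun x hx => by
    have h1 : ContinuousAt (fun y : ℝ => R ε (2 * Real.pi) y) x :=
      ((hR.diff ε hε (2 * Real.pi)).differentiableAt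
        (Metric.isOpen_thickening.mem_nhds (hth x hx))).continuousAt.comp
          Complex.continuous_ofReal.continuousAt
    exact (Complex.continuous_re.continuousAt.comp h1).continuousWithinAt
  set A : Set ℝ := {x ∈ Icc r₁ r₂ | (1 / (1 + x), (0 : ℝ)) ∈ γ} with hA
  have hAcomp : IsCompact A := by
    have h1 : ContinuousOn (fun x : ℝ => (1 / (1 + x), (0 : ℝ))) (Icc r₁ r₂) :=
      (continuousOn_const.div (continuousOn_const.add continuousOn_id)
        fun x hx => show (1 : ℝ) + x ≠ 0 by have := hpos' x hx; positivity).prodMk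
        continuousOn_const
    exact isCompact_Icc.of_isClosed_subset
      (h1.preimage_isClosed_of_isClosed isClosed_Icc (isCompact_of_isPeriodicOrbit hγ).isClosed)
      fun x hx => hx.1
  have hAg : ∀ x ∈ A, g x ∈ A := fun x hx => by
    have h1 := return_mem hR hU hε (hth x hx.1) hγ hx.2
    have h2 := hKr _ (hγK h1)
    rw [sqrt_one_add_H_section (radius_mem hR hU hε (hth x hx.1) _).1] at h2
    exact ⟨h2, h1⟩
  have hAne : A.Nonempty := by
    obtain ⟨x, hx, hx1⟩ := exists_mem_section hγ (hγK.trans hKA) hpos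
    have hx0 : 0 < x := (hKA (hγK hx)).1
    have hρ : 0 < 1 / x - 1 := by
      rw [sub_pos, lt_div_iff₀ hx0]
      linarith
    have hxe : 1 / (1 + (1 / x - 1)) = x := by rw [add_sub_cancel, one_div_one_div]
    have h2 := hKr _ (hγK hx)
    have h3 := sqrt_one_add_H_section hρ
    rw [hxe] at h3
    rw [h3] at h2
    exact ⟨1 / x - 1, h2, by rwa [hxe]⟩
  set B : Set ℝ := {x ∈ A | g x ≤ x} with hB
  have hBcomp : IsCompact B := by
    refine hAcomp.of_isClosed_subset ?_ fun x hx => hx.1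
    have h1 : ContinuousOn (fun x => g x - x) A :=
      (hgc.mono fun x hx => hx.1).sub continuousOn_id
    have h2 := h1.preimage_isClosed_of_isClosed hAcomp.isClosed isClosed_Iic (t := Iic 0)
    convert h2 using 1
    ext x
    simp [hB]
  have hBne : B.Nonempty := by
    obtain ⟨x, hx⟩ := hAcomp.exists_isGreatest hAne
    exact ⟨x, hx.1, hx.2 (hAg x hx.1)⟩
  obtain ⟨x, hxB, hxmin⟩ := hBcomp.exists_isLeast hBne
  refine ⟨x, hxB.1.1, hxB.1.2, le_antisymm hxB.2 (hxmin ⟨hAg x hxB.1, ?_⟩)⟩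
  exact hgmono _ (hAg x hxB.1).1 _ hxB.1.1 hxB.2

end PolarReturn

/-! ### Counting limit cycles -/

section Counting

open Set Filter PlanarSystem ReversibleSystem

/-- To bound a sum of suprema of natural numbers it suffices to bound the sums of the members. -/
theorem sum_iSup_le_of_forall {α : Type*} (S : Finset α) (p : α → ℕ → Prop) (N : ℕ)
    (h : ∀ m : α → ℕ, (∀ γ ∈ S, m γ = 0 ∨ p γ (m γ)) → ∑ γ ∈ S, m γ ≤ N) :
    ∑ γ ∈ S, (⨆ (k : ℕ) (_ : p γ k), (k : ℕ∞)) ≤ N := by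
  classical
  set A : α → Set ℕ := fun γ => {k | k = 0 ∨ p γ k} with hA
  have hbdd : ∀ γ ∈ S, BddAbove (A γ) := fun γ hγ => ⟨N, fun k hk => by
    have h1 := h (fun γ' => if γ' = γ then k else 0) fun γ' _ => by
      by_cases hc : γ' = γ
      · subst hc
        have hk' : k = 0 ∨ p γ' k := hk
        simpa using hk'
      · simp [hc]
    rwa [Finset.sum_ite_eq' S γ, if_pos hγ] at h1⟩
  refine le_trans (Finset.sum_le_sum (g := fun γ => ((sSup (A γ) : ℕ) : ℕ∞)) fun γ hγ => ?_) ?_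
  · exact iSup₂_le fun k hk => Nat.cast_le.2 (le_csSup (hbdd γ hγ) (Or.inr hk))
  · rw [← Nat.cast_sum, Nat.cast_le]
    exact h _ fun γ hγ => Nat.sSup_mem ⟨0, Or.inl rfl⟩ (hbdd γ hγ)

/-- A compact part of the annulus lies between two ovals. -/
theorem exists_radii_of_isCompact {K : Set (ℝ × ℝ)} (hK : IsCompact K) (hKA : K ⊆ annulus) :
    ∃ r₁ r₂ : ℝ, 0 < r₁ ∧ r₁ ≤ r₂ ∧ r₂ < 1 ∧ ∀ q ∈ K, √(1 + H q) ∈ Icc r₁ r₂ := by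
  rcases K.eq_empty_or_nonempty with rfl | hne
  · exact ⟨1 / 2, 1 / 2, by norm_num, le_rfl, by norm_num, fun q hq => hq.elim⟩
  · have hc : ContinuousOn (fun q => √(1 + H q)) K := by
      refine (continuousOn_const.add ?_).sqrt
      refine ContinuousOn.div (by fun_prop) (by fun_prop) fun q hq => ?_
      exact pow_ne_zero 3 (hKA hq).1.ne'
    obtain ⟨q₁, hq₁, h1⟩ := hK.exists_isMinOn hne hc
    obtain ⟨q₂, hq₂, h2⟩ := hK.exists_isMaxOn hne hc
    refine ⟨√(1 + H q₁), √(1 + H q₂), Real.sqrt_pos.2 ?_, h1 hq₂, ?_, fun q hq => ⟨h1 hq, h2 hq⟩⟩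
    · linarith [(hKA hq₁).2.1]
    · rw [Real.sqrt_lt' one_pos]
      linarith [(hKA hq₂).2.2]

/-- Limit cycles in `K` give zeros, of at least the same multiplicities, of the displacement of the
polar system. -/
theorem hasZeros_displacement {n : ℕ} {a b : ℕ → ℕ → ℝ} {δ ε₁ r₁ r₂ : ℝ} {R : ℝ → ℝ → ℂ → ℂ}
    (hR : IsSolutionFamily ((fun x : ℝ => (x : ℂ)) '' Icc r₁ r₂) δ ε₁ (√2) (radialPart n a b)
      (angularPart n a b) R) (hδ : 0 < δ)
    (hU : Metric.thickening (2 * δ) ((fun x : ℝ => (x : ℂ)) '' Icc r₁ r₂) ⊆ radii)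
    {ε : ℝ} (hε : |ε| < ε₁) {K : Set (ℝ × ℝ)} (hKA : K ⊆ annulus)
    (hKr : ∀ q ∈ K, √(1 + H q) ∈ Icc r₁ r₂)
    (hpos : ∀ q ∈ K, 0 < angMom q (field n a b ε q)) {S : Finset (Set (ℝ × ℝ))}
    (hS : ∀ γ ∈ S, IsPeriodicOrbit (field n a b ε) γ ∧ γ ⊆ K) {m : Set (ℝ × ℝ) → ℕ}
    (hm : ∀ γ ∈ S, m γ = 0 ∨ DisplacementVanishes (field n a b ε) γ (m γ)) :
    HasZeros (fun z => (R ε (2 * Real.pi) z - z) / ε) ((fun x : ℝ => (x : ℂ)) '' Icc r₁ r₂)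
      (∑ γ ∈ S, m γ) := by
  classical
  have hex : ∀ γ ∈ S, ∃ x ∈ Icc r₁ r₂, (1 / (1 + x), (0 : ℝ)) ∈ γ ∧
      radius R ε x (2 * Real.pi) = x := fun γ hγ =>
    exists_fixed_radius hR hδ hU hε hKA hKr (hS γ hγ).1 (hS γ hγ).2
      fun q hq => hpos q ((hS γ hγ).2 hq)
  choose! ρ hρI hρmem hρfix using hex
  have hinj : Set.InjOn (fun γ => ((ρ γ : ℝ) : ℂ)) S := fun γ hγ γ' hγ' h => by
    have h1 : ρ γ = ρ γ' := Complex.ofReal_injective h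
    refine periodicOrbit_eq_of_mem (contDiff_field n a b ε) (hS γ hγ).1 (hS γ' hγ').1
      (hρmem γ hγ) ?_
    rw [h1]
    exact hρmem γ' hγ'
  -- the lower bound for the order at a point, read off from the orbit that passes there
  refine ⟨S.image fun γ => ((ρ γ : ℝ) : ℂ),
    fun z => ∑ γ ∈ S with ((ρ γ : ℝ) : ℂ) = z, m γ, ?_, ?_, ?_⟩
  · intro z hz
    obtain ⟨γ, hγ, rfl⟩ := Finset.mem_image.1 hz
    exact ⟨_, hρI γ hγ, rfl⟩
  · intro z hz
    obtain ⟨γ, hγ, rfl⟩ := Finset.mem_image.1 hz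
    have hfilter : {γ' ∈ S | ((ρ γ' : ℝ) : ℂ) = ρ γ} = {γ} := by
      ext γ'
      simp only [Finset.mem_filter, Finset.mem_singleton]
      exact ⟨fun h => hinj h.1 hγ h.2, by rintro rfl; exact ⟨hγ, rfl⟩⟩
    beta_reduce
    rw [hfilter, Finset.sum_singleton]
    rcases hm γ hγ with h0 | hd
    · rw [h0]
      simp
    have hth : ∀ x ∈ Icc r₁ r₂,
        (x : ℂ) ∈ Metric.thickening δ ((fun x : ℝ => (x : ℂ)) '' Icc r₁ r₂) :=
      fun x hx => Metric.self_subset_thickening hδ _ ⟨x, hx, rfl⟩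
    have hx := hth _ (hρI γ hγ)
    have han : AnalyticAt ℂ (fun z => (R ε (2 * Real.pi) z - z) / ε) (ρ γ : ℂ) :=
      (((hR.diff ε hε (2 * Real.pi)).sub differentiableOn_id).div_const _).analyticAt
        (Metric.isOpen_thickening.mem_nhds hx)
    refine le_analyticOrderAt_of_isBigO (𝕜 := ℂ) han ?_
    have hbig := isBigO_of_displacementVanishes hR hU hε hx (hρfix γ hγ) (hρmem γ hγ)
      (fun q hq => hpos q ((hS γ hγ).2 hq)) hd
    have hnhds : ∀ᶠ y : ℝ in 𝓝 (ρ γ),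
        (y : ℂ) ∈ Metric.thickening δ ((fun x : ℝ => (x : ℂ)) '' Icc r₁ r₂) :=
      Complex.continuous_ofReal.continuousAt.eventually (Metric.isOpen_thickening.mem_nhds hx)
    refine ((hbig.const_mul_left ε⁻¹).norm_left.congr' ?_ EventuallyEq.rfl).of_norm_left
    filter_upwards [hnhds] with y hy
    have hcast : ((y : ℝ) : ℂ) = (RCLike.ofReal y : ℂ) := rfl
    rw [← hcast, ← ofReal_radius hR hε hy, ← Complex.ofReal_sub, ← Complex.ofReal_div,
      Complex.norm_real, div_eq_inv_mul]
  · rw [Finset.sum_image hinj]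
    refine Finset.sum_le_sum fun γ hγ => ?_
    exact Finset.single_le_sum (f := m) (fun _ _ => Nat.zero_le _)
      (Finset.mem_filter.2 ⟨hγ, rfl⟩)

/-- The bound `n` holds for every degree `n`. -/
theorem exists_limitCycleCount_le (n : ℕ) (a b : ℕ → ℕ → ℝ)
    (hM : ∃ h ∈ Ioo (-1 : ℝ) 0, melnikov n a b h ≠ 0) {K : Set (ℝ × ℝ)} (hK : IsCompact K)
    (hKA : K ⊆ annulus) :
    ∃ ε₀ : ℝ, 0 < ε₀ ∧ ∀ ε : ℝ, 0 < |ε| → |ε| < ε₀ →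
      limitCycleCount (field n a b ε) K ≤ n := by
  obtain ⟨r₁, r₂, h1, h12, h2, hKr⟩ := exists_radii_of_isCompact hK hKA
  obtain ⟨δ, hδ, ε₁, hε₁, R, hU, hR⟩ := exists_polarFamily n a b h1 h12 h2
  obtain ⟨ε₂, hε₂, hpos⟩ := exists_angMom_pos n a b hK hKA
  set I : Set ℂ := (fun x : ℝ => (x : ℂ)) '' Icc r₁ r₂ with hI
  set V := Metric.thickening δ I with hV
  have hVo : IsOpen V := Metric.isOpen_thickening
  have hIV : I ⊆ V := Metric.self_subset_thickening hδ I
  have hdiff : ∀ ε, |ε| < ε₁ →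
      DifferentiableOn ℂ (fun z => (R ε (2 * Real.pi) z - z) / ε) V := fun ε hε =>
    ((hR.diff ε hε (2 * Real.pi)).sub differentiableOn_id).div_const _
  have hsmall : ∀ᶠ ε in 𝓝[≠] (0 : ℝ), |ε| < ε₁ := by
    refine Filter.Eventually.filter_mono nhdsWithin_le_nhds ?_
    filter_upwards [Metric.ball_mem_nhds (0 : ℝ) hε₁] with ε hε
    simpa using hε
  have hlim : ∀ z ∈ V, Tendsto
      (fun q : ℝ × ℂ => (R q.1 (2 * Real.pi) q.2 - q.2) / q.1) (𝓝[≠] 0 ×ˢ 𝓝 z)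
      (𝓝 (∫ t in (0 : ℝ)..(2 * Real.pi), radialPart n a b t z / (√2 : ℝ))) := hR.limit
  have hlimdiff : DifferentiableOn ℂ (fun z => ∫ t in (0 : ℝ)..(2 * Real.pi),
      radialPart n a b t z / (√2 : ℝ)) V :=
    (differentiableOn_integral_radialPart n a b).mono
      ((Metric.thickening_mono (by linarith) I).trans hU)
  have hev := eventually_not_hasZeros hVo hIV (isCompact_Icc.image Complex.continuous_ofReal)
    (F := fun ε z => (R ε (2 * Real.pi) z - z) / ε) (hsmall.mono hdiff) hlimdiff hlim
    (not_hasZeros_integral_radialPart hM hVo hlimdiff h1 h2 hIV)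
  obtain ⟨ε₃, hε₃, hball⟩ := Metric.mem_nhdsWithin_iff.1 hev
  refine ⟨min ε₁ (min ε₂ ε₃), lt_min hε₁ (lt_min hε₂ hε₃), fun ε hε0 hε => ?_⟩
  have hε1 : |ε| < ε₁ := hε.trans_le (min_le_left _ _)
  have hε2 : |ε| < ε₂ := hε.trans_le ((min_le_right _ _).trans (min_le_left _ _))
  have hε3 : |ε| < ε₃ := hε.trans_le ((min_le_right _ _).trans (min_le_right _ _))
  have hno : ¬ HasZeros (fun z => (R ε (2 * Real.pi) z - z) / ε) I (n + 1) :=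
    hball ⟨by simpa using hε3, abs_pos.1 hε0⟩
  refine iSup₂_le fun S hS => ?_
  refine sum_iSup_le_of_forall S (fun γ k => DisplacementVanishes (field n a b ε) γ k) n
    fun m hm => ?_
  by_contra! hlt
  obtain ⟨S', m', hS', hm', hN⟩ := hasZeros_displacement hR hδ hU hε1 hKA hKr (hpos ε hε2)
    (fun γ hγ => ⟨(hS γ hγ).1.1, (hS γ hγ).2⟩) hm
  exact hno ⟨S', m', hS', hm', (Nat.succ_le_of_lt hlt).trans hN⟩

end Counting

/-- Smooth perturbations, of degree at most `n`, of the nongeneric quadratic reversible system: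
for every compact part `K` of the period annulus and every sufficiently small `ε ≠ 0`, the number
of limit cycles in `K`, counted with multiplicity, is at most `4` for `n = 2, 3` and at most
`3 n - 8` for `n ≥ 4`, provided that the first order Melnikov function is not identically zero. -/
theorem theorem1p2 (n : ℕ) (a b : ℕ → ℕ → ℝ)
    (hM : ∃ h ∈ Set.Ioo (-1 : ℝ) 0, ReversibleSystem.melnikov n a b h ≠ 0)
    (K : Set (ℝ × ℝ)) (hK : IsCompact K) (hKA : K ⊆ ReversibleSystem.annulus) :
    (n = 2 ∨ n = 3 → ∃ ε₀ : ℝ, 0 < ε₀ ∧ ∀ ε : ℝ, 0 < |ε| → |ε| < ε₀ →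
      PlanarSystem.limitCycleCount (ReversibleSystem.field n a b ε) K ≤ 4) ∧
    (4 ≤ n → ∃ ε₀ : ℝ, 0 < ε₀ ∧ ∀ ε : ℝ, 0 < |ε| → |ε| < ε₀ →
      PlanarSystem.limitCycleCount (ReversibleSystem.field n a b ε) K ≤
        ((3 * n - 8 : ℕ) : ℕ∞)) := by
  obtain ⟨ε₀, hε₀, h⟩ := exists_limitCycleCount_le n a b hM hK hKA
  refine ⟨fun hn => ⟨ε₀, hε₀, fun ε h0 h1 => (h ε h0 h1).trans ?_⟩,
    fun hn => ⟨ε₀, hε₀, fun ε h0 h1 => (h ε h0 h1).trans ?_⟩⟩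
  · exact_mod_cast (show n ≤ 4 by omega)
  · exact_mod_cast (show n ≤ 3 * n - 8 by omega)
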